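/- **Model (perceptive ring network).** $n$ agents occupy distinct points of a circle of circumference $1$. They have distinct identifiers from $\{1,\dots,N\}$, and each agent has its own sense of direction (which of the two directions on the circle it calls clockwise, or "right"); different agents may disagree. Time is divided into synchronous rounds of length $1$. At the beginning of a round each agent chooses to start moving right or left (in its own sense; idling is not allowed); all agents move at unit speed, and two agents that collide instantly reverse their directions. At the end of a round an agent learns only (i) the distance, in its own clockwise direction, from its position at the beginning of the round to its position at the end of the round, and (ii) the distance between its position at the beginning of the round and the place of its first collision in the round (or that it had no collision). A deterministic algorithm is the same for all agents: the choices and the output of an agent are functions of $N$, the parity of $n$, the agent's own identifier, and its own observations in the rounds so far; $n$ itself is not given to the agents. An algorithm solves *location discovery* (position discovery) in $t$ rounds on a network if all agents finish after exactly $t$ rounds and then every agent outputs the set of initial positions of all other agents, each position being given as the distance from the agent's own initial position in the agent's own clockwise direction. **Theorem.** There are a deterministic algorithm and a constant $C$ such that, for all $N\ge n>4$ and every network of $n$ agents with identifiers from $\{1,\dots,N\}$ (arbitrary distinct initial positions, arbitrary distinct identifiers, arbitrary senses of direction), the algorithm solves location discovery in the perceptive model in at most $$\frac n2 + C\,\sqrt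 n\,\log N$$ rounds. That is, location discovery can be solved in the perceptive model in $n/2+O(\sqrt n\log N)$ rounds. -/

import Mathlib

noncomputable section

namespace RingNetwork

/-! ### The circle and its motion

The circle of circumference one is `UnitAddCircle`, oriented so that adding a small positive real
moves a point clockwise.  This objective orientation is never disclosed to the agents. -/

/-- The length, in `[0, 1)`, of the clockwise arc from `x` to `y`. -/
def cwArc (x y : UnitAddCircle) : ℝ := (AddCircle.equivIco (1 : ℝ) 0 (y - x) : ℝ)

/-- The time in `(0, 1/2]` after which a point moving clockwise from `x` and a point moving
anticlockwise from `y`, both at unit speed, next meet.  Two agents that are at the same point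
because they have just bounced off each other meet again after time `1/2`, not after time `0`. -/
def meetTime (x y : UnitAddCircle) : ℝ := (AddCircle.equivIoc (1 : ℝ) 0 (y - x) : ℝ) / 2

/-- A snapshot of the `n` agents during a round. -/
structure Snapshot (n : ℕ) where
  /-- the time elapsed since the beginning of the round -/
  clock : ℝ
  /-- the current positions -/
  pos : Fin n → UnitAddCircle
  /-- whether an agent is currently moving clockwise (`true`) or anticlockwise (`false`) -/
  cw : Fin n → Bool
  /-- the place of the first collision of an agent in this round, if there has been one -/
  first : Fin n → Option UnitAddCircle

namespace Snapshot

variable {n : ℕ}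

/-- The agents `i` and `j` move in opposite directions and, moving on freely, next meet after
time `τ`. -/
def MeetAfter (s : Snapshot n) (i j : Fin n) (τ : ℝ) : Prop :=
  (s.cw i = true ∧ s.cw j = false ∧ meetTime (s.pos i) (s.pos j) = τ) ∨
  (s.cw j = true ∧ s.cw i = false ∧ meetTime (s.pos j) (s.pos i) = τ)

/-- The time until the next event: the next collision of two agents or the end of the round
(at clock `1`), whichever comes first. -/
def timeToNextEvent (s : Snapshot n) : ℝ :=
  sInf (insert (1 - s.clock) {τ | ∃ i j, s.MeetAfter i j τ})

/-- Agent `i` collides with another agent at the next event. -/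
def Collides (s : Snapshot n) (i : Fin n) : Prop := ∃ j, s.MeetAfter i j s.timeToNextEvent

open Classical in
/-- Let all agents move at unit speed until the next event; the agents that collide then reverse
their directions, and those for which this is the first collision record its place. -/
def step (s : Snapshot n) : Snapshot n :=
  let newPos : Fin n → UnitAddCircle := fun i =>
    s.pos i + ((if s.cw i then s.timeToNextEvent else -s.timeToNextEvent : ℝ) : UnitAddCircle)
  { clock := s.clock + s.timeToNextEvent
    pos := newPos
    cw := fun i => if s.Collides i then !(s.cw i) else s.cw i
    first := fun i => if s.Collides i then (s.first i).or (some (newPos i)) else s.first i }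

/-- The snapshot at the beginning of a round with starting positions `p` and starting
directions `d` (`true` for clockwise). -/
def start (p : Fin n → UnitAddCircle) (d : Fin n → Bool) : Snapshot n :=
  { clock := 0, pos := p, cw := d, first := fun _ => none }

/-- The snapshot at the end of a round: events are processed until one unit of time is over.
(Only finitely many collisions happen in a round that starts at distinct positions.) -/
def finish (p : Fin n → UnitAddCircle) (d : Fin n → Bool) : Snapshot n :=
  step^[sInf {k : ℕ | (step^[k] (start p d)).clock = 1}] (start p d)

end Snapshot

/-! ### Networks of agents and their algorithms -/

/-- `n` agents at distinct positions of the circle, with distinct identifiers from `{1, …, N}`,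
each with its own sense of direction. -/
structure Network (N n : ℕ) where
  /-- the initial positions -/
  pos : Fin n → UnitAddCircle
  pos_injective : Function.Injective pos
  /-- the identifiers -/
  ident : Fin n → ℕ
  ident_injective : Function.Injective ident
  ident_mem : ∀ i, ident i ∈ Finset.Icc 1 N
  /-- whether the agent's own clockwise direction is the objective one -/
  sense : Fin n → Bool

/-- The directions in which an agent of the perceptive model may start a round, according to its
own sense of direction; `right` is its own clockwise direction. -/
inductive Direction
  | right
  | left

/-- What an agent learns in a round of the perceptive model. -/
structure Observation where
  /-- the distance, in the agent's own clockwise direction, from its position at the beginning of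
  the round to its position at the end of the round -/
  dist : ℝ
  /-- the distance between its position at the beginning of the round and the place of its first
  collision in the round; `none` if it did not collide in the round -/
  coll : Option ℝ

/-- A deterministic algorithm, the same for all agents.  Everything that an agent does is a
function of `N`, of the parity of the number of agents (`true` for even), of the agent's own
identifier and of its observations in the rounds so far (in chronological order). -/
structure Algorithm where
  /-- the direction in which the agent starts the next round -/
  move : (N : ℕ) → (parity : Bool) → (ident : ℕ) → List Observation → Direction
  /-- `none` as long as the agent has not finished; when it finishes, it announces a set of
  positions, each given by its distance from the agent's own initial position in the agent's own
  clockwise direction -/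
  output : (N : ℕ) → (parity : Bool) → (ident : ℕ) → List Observation → Option (Set ℝ)

/-- The distance from `x` to `y` in the clockwise direction of an agent with the given sense of
direction. -/
def rightDist (sense : Bool) (x y : UnitAddCircle) : ℝ :=
  if sense then cwArc x y else cwArc y x

/-- Whether an agent with the given sense of direction that starts in direction `d` starts
clockwise in the objective sense. -/
def startsCw (sense : Bool) : Direction → Bool
  | .right => sense
  | .left => !sense

namespace Algorithm

variable {N n : ℕ}

/-- The agents' positions and their lists of observations after `t` rounds. -/
def run (A : Algorithm) (net : Network N n) :
    ℕ → (Fin n → UnitAddCircle) × (Fin n → List Observation)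
  | 0 => (net.pos, fun _ => [])
  | t + 1 =>
    let p := (A.run net t).1
    let h := (A.run net t).2
    let e := Snapshot.finish p fun i =>
      startsCw (net.sense i) (A.move N (decide (Even n)) (net.ident i) (h i))
    (e.pos, fun i => h i ++
      [{ dist := rightDist (net.sense i) (p i) (e.pos i)
         coll := (e.first i).map fun c => Dist.dist (p i) c }])

/-- The output of agent `i` after `t` rounds. -/
def outputAt (A : Algorithm) (net : Network N n) (t : ℕ) (i : Fin n) : Option (Set ℝ) :=
  A.output N (decide (Even n)) (net.ident i) ((A.run net t).2 i)

end Algorithm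

/-- The initial positions of all agents other than `i`, relative to the initial position and the
sense of direction of `i`. -/
def Network.othersFrom {N n : ℕ} (net : Network N n) (i : Fin n) : Set ℝ :=
  {x | ∃ j, j ≠ i ∧ x = rightDist (net.sense i) (net.pos i) (net.pos j)}

/-- The algorithm solves location discovery on the network in exactly `t` rounds: all agents finish
after round `t`, and not earlier, and each announces the initial positions of all other agents
with respect to its own initial position. -/
def Algorithm.SolvesLocationDiscovery {N n : ℕ} (A : Algorithm) (net : Network N n) (t : ℕ) :
    Prop :=
  ∀ i, (∀ s < t, A.outputAt net s i = none) ∧ A.outputAt net t i = some (net.othersFrom i)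

end RingNetwork

end

/-! A collision between two agents may be read as an exchange of two tokens that keep moving at unit
speed. After one round every token is back where it started, so the agents occupy the same set of
places in the same cyclic order, and the round has moved every agent on by the same number of
places: the difference between the numbers of agents starting clockwise and counterclockwise. An
agent that starts clockwise first meets the token of the next agent that starts counterclockwise, so
its first collision shows half the distance to the initial position of that agent.

Starting a round by the bits of the identifiers, in both directions and each time followed by the
reversed round, the agents find the distances to their neighbors, with whom they can then exchange
messages in `O(log N)` rounds. For a parameter `k`, they flood identifiers over distance `2 * k` and
keep the local maxima as candidates. There are few of these, so one of `O(k log N)` test sets,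
formed by the bits of the powers of the identifiers modulo a prime, has a nonzero signed number of
candidates and causes a rotation, unless `k ^ 2` is small compared with `n`; binary search for a
candidate that changes a rotation then yields a leader. Next, all agents learn the positions of the
`2 * k` places after the leader and find their own numbers and `n` by rotating by `2 * k` places at
a time. In the final sweep the agents on the first `O(k)` places control the rotation, while the
others form pairs that move towards each other and locate one another, so that every round shows an
agent two new places. Doubling `k` until it suffices costs `O(√n log N)` rounds in all. -/

noncomputable section

namespace RingNetwork

/-- The sign `±1` of a direction, `true` being positive. -/
def sgn (b : Bool) : ℝ := if b then 1 else -1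

@[simp] lemma sgn_true : sgn true = 1 := rfl

@[simp] lemma sgn_false : sgn false = -1 := rfl

@[simp] lemma sgn_not (b : Bool) : sgn (!b) = -sgn b := by cases b <;> simp

@[simp] lemma abs_sgn (b : Bool) : |sgn b| = 1 := by cases b <;> simp

lemma sgn_beq (a b : Bool) : sgn (a == b) = sgn a * sgn b := by cases a <;> cases b <;> simp

lemma add_int_mul_of_add_period {n : ℤ} {X : ℤ → ℝ} (h : ∀ k, X (k + n) = X k + 1) (k m : ℤ) :
    X (k + m * n) = X k + m := by
  simpa using AddConstMapClass.map_add_zsmul (⟨X, h⟩ : AddConstMap ℤ ℝ n 1) k m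

lemma sum_range_int_add_one {M : Type*} [AddCommMonoid M] (F : ℤ → M) (n : ℕ) :
    ∑ k ∈ Finset.range n, F (k + 1) + F 0 = ∑ k ∈ Finset.range n, F k + F n := by
  rw [← Finset.sum_range_succ (fun k : ℕ => F k), Finset.sum_range_succ' (fun k : ℕ => F k)]
  push_cast
  rfl

lemma int_eq_add_of_strictMono_of_surjective {ρ : ℤ → ℤ} (hρ : StrictMono ρ)
    (hρ' : Function.Surjective ρ) (k : ℤ) : ρ k = k + ρ 0 := by
  have ρ_succ (k : ℤ) : ρ (k + 1) = ρ k + 1 := (hρ.orderIsoOfSurjective ρ hρ').map_succ k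
  induction k using Int.induction_on with
  | zero => simp
  | succ i ih => rw [ρ_succ, ih]; ring
  | pred i ih =>
    have := ρ_succ (-i - 1)
    rw [sub_add_cancel, ih] at this
    linarith

/-! ### Frames -/

/-- An enumeration by the integers of the places of `n` agents along the circle, together with a
lift of the places to the real line.  The places are numbered clockwise if `isCw = true` and
anticlockwise otherwise; in the latter case the lift is with respect to the reversed circle. -/
structure Frame (n : ℕ) where
  isCw : Bool
  coord : ℤ → ℝ
  agent : ℤ → Fin n
  strictMono : StrictMono coord
  coord_add : ∀ k, coord (k + n) = coord k + 1
  agent_eq_iff : ∀ k l, agent k = agent l ↔ (n : ℤ) ∣ l - k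
  agent_surjective : Function.Surjective agent

namespace Frame

variable {n : ℕ} (f : Frame n)

include f in
lemma card_pos : 0 < n := (f.agent 0).pos

lemma agent_add_mul (k m : ℤ) : f.agent (k + m * n) = f.agent k := by
  rw [eq_comm, f.agent_eq_iff]
  simp

lemma agent_add (k : ℤ) : f.agent (k + n) = f.agent k := by
  simpa using f.agent_add_mul k 1

lemma coord_add_mul (k m : ℤ) : f.coord (k + m * n) = f.coord k + m :=
  add_int_mul_of_add_period f.coord_add k m

lemma coe_coord_eq_iff (k l : ℤ) :
    (f.coord k : UnitAddCircle) = f.coord l ↔ (n : ℤ) ∣ l - k := by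
  rw [eq_comm, ← sub_eq_zero, ← AddCircle.coe_sub, AddCircle.coe_eq_zero_iff]
  constructor
  · rintro ⟨m, hm⟩
    have h : f.coord l = f.coord (k + m * n) := by
      rw [f.coord_add_mul]
      simp only [zsmul_eq_mul, mul_one] at hm
      linarith
    exact ⟨m, by rw [f.strictMono.injective h]; ring⟩
  · rintro ⟨m, hm⟩
    refine ⟨m, ?_⟩
    rw [show l = k + m * n by linarith, f.coord_add_mul]
    simp

lemma sum_agent {M : Type*} [AddCommMonoid M] (F : Fin n → M) :
    ∑ k ∈ Finset.range n, F (f.agent k) = ∑ i, F i := by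
  rw [← Fin.sum_univ_eq_sum_range (fun k => F (f.agent k))]
  refine Fintype.sum_bijective (fun i : Fin n => f.agent (i : ℕ)) ?_ _ _ (fun _ => rfl)
  refine (Fintype.bijective_iff_injective_and_card _).2 ⟨fun i j h => ?_, rfl⟩
  have hdvd := (f.agent_eq_iff _ _).1 h
  have := Int.eq_zero_of_abs_lt_dvd hdvd (by rw [abs_lt]; constructor <;> omega)
  omega

lemma sum_coord_add (r : ℤ) :
    ∑ k ∈ Finset.range n, f.coord (k + r) = ∑ k ∈ Finset.range n, f.coord k + r := by
  have sum_succ (r : ℤ) : ∑ k ∈ Finset.range n, f.coord (k + (r + 1)) =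
      ∑ k ∈ Finset.range n, f.coord (k + r) + 1 := by
    have h := sum_range_int_add_one (fun k => f.coord (k + r)) n
    simp only [zero_add, add_comm (n : ℤ) r, f.coord_add, add_assoc, add_comm 1 r] at h
    linarith
  induction r using Int.induction_on with
  | zero => simp
  | succ i ih => rw [sum_succ, ih]; push_cast; ring
  | pred i ih =>
    have := sum_succ (-i - 1)
    rw [sub_add_cancel, ih] at this
    push_cast at this ⊢
    linarith

/-- The positions `p` are those of the frame after every agent has moved on by `R` places. -/
def At (R : ℤ) (p : Fin n → UnitAddCircle) : Prop :=
  ∀ k, p (f.agent k) = ((sgn f.isCw * f.coord (k + R) : ℝ) : UnitAddCircle)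

/-- The frame whose place `k` is the place `k + m` of the given one. -/
def shift (m : ℤ) : Frame n where
  isCw := f.isCw
  coord k := f.coord (k + m)
  agent k := f.agent (k + m)
  strictMono _ _ h := f.strictMono (by linarith)
  coord_add k := by rw [add_right_comm, f.coord_add]
  agent_eq_iff k l := by rw [f.agent_eq_iff, add_sub_add_right_eq_sub]
  agent_surjective i := by obtain ⟨k, rfl⟩ := f.agent_surjective i; exact ⟨k - m, by simp⟩

/-- The frame of the agents that have moved on by `R` places. -/
def rotate (R : ℤ) : Frame n where
  isCw := f.isCw
  coord k := f.coord (k + R)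
  agent := f.agent
  strictMono _ _ h := f.strictMono (by linarith)
  coord_add k := by rw [add_right_comm, f.coord_add]
  agent_eq_iff := f.agent_eq_iff
  agent_surjective := f.agent_surjective

/-- The frame that enumerates the same places in the opposite order. -/
def mirror : Frame n where
  isCw := !f.isCw
  coord k := -f.coord (-k)
  agent k := f.agent (-k)
  strictMono _ _ h := neg_lt_neg (f.strictMono (neg_lt_neg h))
  coord_add k := by
    have := f.coord_add (-k - n)
    rw [sub_add_cancel] at this
    rw [neg_add', this]
    ring
  agent_eq_iff k l := by rw [f.agent_eq_iff, neg_sub_neg, dvd_sub_comm]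
  agent_surjective i := by obtain ⟨k, rfl⟩ := f.agent_surjective i; exact ⟨-k, by simp⟩

/-- The frame of the agents at the reflected positions. -/
def reflect : Frame n where
  isCw := !f.isCw
  coord := f.coord
  agent := f.agent
  strictMono := f.strictMono
  coord_add := f.coord_add
  agent_eq_iff := f.agent_eq_iff
  agent_surjective := f.agent_surjective

variable {f} {R S : ℤ} {p q : Fin n → UnitAddCircle}

lemma At.shift (h : f.At R p) (m : ℤ) : (f.shift m).At R p := fun k => by
  change p (f.agent (k + m)) = ((sgn f.isCw * f.coord (k + R + m) : ℝ) : UnitAddCircle)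
  rw [h, add_right_comm]

lemma At.mirror (h : f.At R p) : f.mirror.At (-R) p := fun k => by
  change p (f.agent (-k)) = ((sgn (!f.isCw) * -f.coord (-(k + -R)) : ℝ) : UnitAddCircle)
  rw [h, show -(k + -R) = -k + R by ring, sgn_not, neg_mul_neg]

lemma At.reflect (h : f.At R p) : f.reflect.At R (-p) := fun k => by
  change -p (f.agent k) = ((sgn (!f.isCw) * f.coord (k + R) : ℝ) : UnitAddCircle)
  rw [h, sgn_not, neg_mul, AddCircle.coe_neg]

lemma at_rotate_iff : (f.rotate R).At S p ↔ f.At (R + S) p := by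
  refine forall_congr' fun k => ?_
  change p (f.agent k) = ((sgn f.isCw * f.coord (k + S + R) : ℝ) : UnitAddCircle) ↔ _
  rw [show k + S + R = k + (R + S) by ring]

lemma At.rotate (h : f.At R p) : (f.rotate R).At 0 p :=
  at_rotate_iff.2 (by rwa [add_zero])

lemma At.unique (h : f.At R p) (h' : f.At R q) : p = q := by
  ext i
  obtain ⟨k, rfl⟩ := f.agent_surjective i
  rw [h, h']

/-- Going through the places from `k` onwards, `c` first changes its value at the place `k + δ`. -/
structure FirstChange (f : Frame n) (c : Fin n → Bool) (k δ : ℤ) : Prop where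
  pos : 0 < δ
  ne : c (f.agent (k + δ)) ≠ c (f.agent k)
  eq : ∀ j, 0 < j → j < δ → c (f.agent (k + j)) = c (f.agent k)

lemma FirstChange.of_comp {c : Fin n → Bool} {k δ : ℤ} (φ : Bool → Bool)
    (h : f.FirstChange (fun i => φ (c i)) k δ) (hφ : Function.Injective φ) :
    f.FirstChange c k δ :=
  ⟨h.pos, fun e => h.ne (congrArg φ e), fun j h₁ h₂ => hφ (h.eq j h₁ h₂)⟩

lemma FirstChange.lt {c : Fin n → Bool} {k δ : ℤ} (h : f.FirstChange c k δ) : δ < n := by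
  have := f.card_pos
  by_contra hc
  have hle : (n : ℤ) ≤ δ := not_lt.1 hc
  rcases hle.eq_or_lt with rfl | hlt
  · exact h.ne (by rw [f.agent_add])
  · have := h.eq (δ - n) (by omega) (by omega)
    rw [← f.agent_add, show k + (δ - n) + n = k + δ by ring] at this
    exact h.ne this

lemma exists_agent_add_eq (f : Frame n) (k : ℤ) (i : Fin n) :
    ∃ m : ℕ, m < n ∧ f.agent (k + m) = i := by
  obtain ⟨l, rfl⟩ := f.agent_surjective i
  have hn : (0 : ℤ) < n := by exact_mod_cast f.card_pos
  have h0 := Int.emod_nonneg (l - k) hn.ne'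
  have hlt := Int.emod_lt_of_pos (l - k) hn
  refine ⟨((l - k) % n).toNat, by omega, (f.agent_eq_iff _ _).2 ⟨(l - k) / n, ?_⟩⟩
  rw [Int.toNat_of_nonneg h0]
  linarith [Int.emod_add_mul_ediv (l - k) n]

lemma exists_firstChange (f : Frame n) {c : Fin n → Bool} {k : ℤ} {i : Fin n}
    (hi : c i ≠ c (f.agent k)) : ∃ δ, f.FirstChange c k δ := by
  classical
  have hex : ∃ m : ℕ, c (f.agent (k + m)) ≠ c (f.agent k) := by
    obtain ⟨m, -, rfl⟩ := f.exists_agent_add_eq k i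
    exact ⟨m, hi⟩
  refine ⟨Nat.find hex, ?_, Nat.find_spec hex, fun j h1 h2 => ?_⟩
  · rw [Nat.cast_pos, Nat.pos_iff_ne_zero]
    intro h0
    have := Nat.find_spec hex
    simp [h0] at this
  · have := Nat.find_min hex (m := j.toNat) (by omega)
    rwa [not_not, Int.toNat_of_nonneg h1.le] at this

end Frame

/-! ### The times at which two points meet -/

lemma meetTime_pos (x y : UnitAddCircle) : 0 < meetTime x y :=
  half_pos (AddCircle.equivIoc (1 : ℝ) 0 (y - x)).2.1

lemma meetTime_coe {a b : ℝ} (h : a < b) (h' : b ≤ a + 1) :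
    meetTime (a : UnitAddCircle) b = (b - a) / 2 := by
  unfold meetTime
  rw [← AddCircle.coe_sub]
  congr 1
  exact (toIocMod_eq_iff one_pos).2 ⟨⟨by linarith, by linarith⟩, 0, by simp⟩

lemma meetTime_coe_le {a b : ℝ} (h : a < b) : meetTime (a : UnitAddCircle) b ≤ (b - a) / 2 := by
  rcases le_or_gt b (a + 1) with h' | h'
  · rw [meetTime_coe h h']
  · have := (AddCircle.equivIoc (1 : ℝ) 0 ((b : UnitAddCircle) - a)).2.2
    unfold meetTime
    linarith

lemma exists_two_mul_meetTime_coe_eq (a b : ℝ) :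
    ∃ m : ℤ, 2 * meetTime (a : UnitAddCircle) b = b + m - a := by
  obtain ⟨-, z, hz⟩ := (toIocMod_eq_iff (one_pos (α := ℝ))
    (b := b - a) (a := 0) (c := toIocMod one_pos 0 (b - a))).1 rfl
  refine ⟨-z, ?_⟩
  have hmeet : meetTime (a : UnitAddCircle) b = toIocMod one_pos 0 (b - a) / 2 := rfl
  rw [zsmul_eq_mul, mul_one] at hz
  rw [hmeet]
  push_cast
  linarith

lemma meetTime_neg_neg (x y : UnitAddCircle) : meetTime (-x) (-y) = meetTime y x := by
  unfold meetTime
  rw [neg_sub_neg]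

/-! ### Snapshots of a round -/

namespace Snapshot

variable {n : ℕ}

lemma finite_meet (s : Snapshot n) :
    (insert (1 - s.clock) {τ | ∃ i j, s.MeetAfter i j τ}).Finite := by
  refine Set.Finite.insert _ (Set.Finite.subset
    (Set.finite_range fun q : Fin n × Fin n => meetTime (s.pos q.1) (s.pos q.2)) ?_)
  rintro τ ⟨i, j, ⟨-, -, h⟩ | ⟨-, -, h⟩⟩
  · exact ⟨(i, j), h⟩
  · exact ⟨(j, i), h⟩

lemma timeToNextEvent_le (s : Snapshot n) : s.timeToNextEvent ≤ 1 - s.clock :=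
  csInf_le s.finite_meet.bddBelow (Set.mem_insert _ _)

lemma timeToNextEvent_le_meet (s : Snapshot n) {i j : Fin n} {τ : ℝ} (h : s.MeetAfter i j τ) :
    s.timeToNextEvent ≤ τ :=
  csInf_le s.finite_meet.bddBelow (Set.mem_insert_of_mem _ ⟨i, j, h⟩)

lemma timeToNextEvent_mem (s : Snapshot n) :
    s.timeToNextEvent = 1 - s.clock ∨ ∃ i j, s.MeetAfter i j s.timeToNextEvent :=
  (Set.insert_nonempty _ _).csInf_mem s.finite_meet

lemma timeToNextEvent_pos (s : Snapshot n) (h : s.clock < 1) : 0 < s.timeToNextEvent := by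
  rcases s.timeToNextEvent_mem with h' | ⟨i, j, ⟨-, -, h'⟩ | ⟨-, -, h'⟩⟩
  · linarith
  · exact h' ▸ meetTime_pos _ _
  · exact h' ▸ meetTime_pos _ _

lemma step_clock (s : Snapshot n) : s.step.clock = s.clock + s.timeToNextEvent := rfl

/-- The lift of the positions at the next event, if `X` is a lift of the current positions. -/
def advance (f : Frame n) (s : Snapshot n) (X : ℤ → ℝ) (k : ℤ) : ℝ :=
  X k + sgn (s.cw (f.agent k)) * s.timeToNextEvent

/-- `X` is a lift, along the frame `f`, of the positions of a snapshot `s` of a round that started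
at the places of `f` in the directions `d`.  Think of each agent as carrying a token and of
colliding agents as exchanging theirs: the tokens then move on at constant velocity, as
`exists_token` and `exists_carrier` say. -/
structure IsLift (f : Frame n) (d : Fin n → Bool) (s : Snapshot n) (X : ℤ → ℝ) : Prop where
  clock_nonneg : 0 ≤ s.clock
  clock_le_one : s.clock ≤ 1
  pos_eq : ∀ k, s.pos (f.agent k) = (X k : UnitAddCircle)
  add_period : ∀ k, X (k + n) = X k + 1
  le_succ : ∀ k, X k ≤ X (k + 1)
  cw_of_eq : ∀ k, X k = X (k + 1) → s.cw (f.agent k) = false ∧ s.cw (f.agent (k + 1)) = true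
  exists_token : ∀ k, ∃ a, d (f.agent a) = s.cw (f.agent k) ∧
    X k = f.coord a + sgn (s.cw (f.agent k)) * s.clock
  exists_carrier : ∀ a, ∃ k, s.cw (f.agent k) = d (f.agent a) ∧
    X k = f.coord a + sgn (d (f.agent a)) * s.clock
  sum_eq : ∑ k ∈ Finset.range n, X k =
    ∑ k ∈ Finset.range n, f.coord k + s.clock * ∑ i, sgn (d i)
  sum_cw : ∑ i, sgn (s.cw i) = ∑ i, sgn (d i)

/-- The agents at the places `k` and `k + 1` collide at the next event. -/
def CollidesWithNext (f : Frame n) (s : Snapshot n) (X : ℤ → ℝ) (k : ℤ) : Prop :=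
  s.cw (f.agent k) = true ∧ s.cw (f.agent (k + 1)) = false ∧
    X (k + 1) = X k + 2 * s.timeToNextEvent

open Classical in
/-- The place of the agent with which the agent at the place `k` exchanges its direction at the
next event; it is `k` itself if that agent does not collide. -/
def partner (f : Frame n) (s : Snapshot n) (X : ℤ → ℝ) (k : ℤ) : ℤ :=
  if CollidesWithNext f s X k then k + 1 else if CollidesWithNext f s X (k - 1) then k - 1 else k

variable {f : Frame n} {d : Fin n → Bool} {s : Snapshot n} {X : ℤ → ℝ}

lemma CollidesWithNext.not_next {k : ℤ} (h : CollidesWithNext f s X k) :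
    ¬ CollidesWithNext f s X (k + 1) := fun h' => by
  simpa [h.2.1] using h'.1

lemma partner_of_collidesWithNext {k : ℤ} (h : CollidesWithNext f s X k) :
    partner f s X k = k + 1 := if_pos h

lemma CollidesWithNext.partner_next {k : ℤ} (h : CollidesWithNext f s X k) :
    partner f s X (k + 1) = k := by
  rw [partner, if_neg h.not_next, add_sub_cancel_right, if_pos h]

lemma partner_partner (k : ℤ) : partner f s X (partner f s X k) = k := by
  by_cases h : CollidesWithNext f s X k
  · rw [partner_of_collidesWithNext h, h.partner_next]
  by_cases h' : CollidesWithNext f s X (k - 1)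
  · have hk := h'.partner_next
    rw [sub_add_cancel] at hk
    rw [hk, partner_of_collidesWithNext h', sub_add_cancel]
  · have hk : partner f s X k = k := by rw [partner, if_neg h, if_neg h']
    rw [hk, hk]

lemma advance_partner (k : ℤ) : advance f s X (partner f s X k) = advance f s X k := by
  have exchange {l : ℤ} (h : CollidesWithNext f s X l) :
      advance f s X (l + 1) = advance f s X l := by
    obtain ⟨hl, hl', hX⟩ := h
    simp only [advance, hl, hl', hX, sgn_true, sgn_false]
    ring
  unfold partner
  split_ifs with h h'
  · exact exchange h
  · simpa using (exchange h').symm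
  · rfl

namespace IsLift

lemma start (hf : f.isCw = true) {p : Fin n → UnitAddCircle} (hp : f.At 0 p) :
    IsLift f d (start p d) f.coord where
  clock_nonneg := le_rfl
  clock_le_one := zero_le_one
  pos_eq k := by simpa [Snapshot.start, hf] using hp k
  add_period := f.coord_add
  le_succ k := (f.strictMono (lt_add_one k)).le
  cw_of_eq k h := absurd h (f.strictMono (lt_add_one k)).ne
  exists_token k := ⟨k, rfl, by simp [Snapshot.start]⟩
  exists_carrier k := ⟨k, rfl, by simp [Snapshot.start]⟩
  sum_eq := by simp [Snapshot.start]
  sum_cw := rfl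

variable (h : IsLift f d s X)
include h

lemma monotone : Monotone X := monotone_int_of_le_succ h.le_succ

lemma cw_of_lt_of_eq {k l : ℤ} (hkl : k < l) (hX : X k = X l) :
    s.cw (f.agent k) = false ∧ s.cw (f.agent l) = true := by
  have hk : X k = X (k + 1) := le_antisymm (h.le_succ k) (hX ▸ h.monotone hkl)
  have hl : X (l - 1) = X (l - 1 + 1) := by
    rw [sub_add_cancel]
    exact le_antisymm (h.monotone (by omega)) (hX ▸ h.monotone (by omega))
  exact ⟨(h.cw_of_eq k hk).1, sub_add_cancel l 1 ▸ (h.cw_of_eq _ hl).2⟩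

lemma timeToNextEvent_le {k l : ℤ} (hk : s.cw (f.agent k) = true)
    (hl : s.cw (f.agent l) = false) (hkl : X k < X l) :
    2 * s.timeToNextEvent ≤ X l - X k := by
  have := s.timeToNextEvent_le_meet (i := f.agent k) (j := f.agent l) (Or.inl ⟨hk, hl, rfl⟩)
  rw [h.pos_eq, h.pos_eq] at this
  linarith [meetTime_coe_le hkl]

lemma exists_lift_right (k : ℤ) (j : Fin n) :
    ∃ l, f.agent l = j ∧ X l = X k + 2 * meetTime (s.pos (f.agent k)) (s.pos j) := by
  obtain ⟨l, rfl⟩ := f.agent_surjective j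
  obtain ⟨m, hm⟩ := exists_two_mul_meetTime_coe_eq (X k) (X l)
  refine ⟨l + m * n, f.agent_add_mul l m, ?_⟩
  rw [h.pos_eq, h.pos_eq, hm, add_int_mul_of_add_period h.add_period]
  ring

lemma exists_lift_left (k : ℤ) (j : Fin n) :
    ∃ l, f.agent l = j ∧ X k = X l + 2 * meetTime (s.pos j) (s.pos (f.agent k)) := by
  obtain ⟨l, rfl⟩ := f.agent_surjective j
  obtain ⟨m, hm⟩ := exists_two_mul_meetTime_coe_eq (X l) (X k)
  refine ⟨l + -m * n, f.agent_add_mul l (-m), ?_⟩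
  rw [h.pos_eq, h.pos_eq, hm, add_int_mul_of_add_period h.add_period]
  push_cast
  ring

lemma eq_succ_of_meet (hτ : 0 < s.timeToNextEvent) {k l : ℤ} (hk : s.cw (f.agent k) = true)
    (hl : s.cw (f.agent l) = false) (hkl : X l = X k + 2 * s.timeToNextEvent) : l = k + 1 := by
  have hlt : k < l := h.monotone.reflect_lt (by linarith)
  by_contra hne
  have hlt' : k + 1 < l := by omega
  cases hw : s.cw (f.agent (k + 1))
  · have hX : X k < X (k + 1) := (h.le_succ k).lt_of_ne fun he => by
      simpa [hk] using h.cw_of_eq k he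
    have := h.timeToNextEvent_le hk hw hX
    have hX' : X (k + 1) = X l := le_antisymm (h.monotone hlt'.le) (by linarith)
    simpa [hl] using h.cw_of_lt_of_eq hlt' hX'
  · have hX : X (k + 1) < X l := (h.monotone hlt'.le).lt_of_ne fun he => by
      simpa [hw] using h.cw_of_lt_of_eq hlt' he
    have := h.timeToNextEvent_le hw hl hX
    have hX' : X k = X (k + 1) := le_antisymm (h.le_succ k) (by linarith)
    simpa [hk] using h.cw_of_eq k hX'

lemma meetAfter_of_collidesWithNext (hτ : 0 < s.timeToNextEvent) {k : ℤ}
    (hC : CollidesWithNext f s X k) :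
    s.MeetAfter (f.agent k) (f.agent (k + 1)) s.timeToNextEvent := by
  obtain ⟨hk, hk', hX⟩ := hC
  refine Or.inl ⟨hk, hk', le_antisymm ?_
    (s.timeToNextEvent_le_meet (i := f.agent k) (Or.inl ⟨hk, hk', rfl⟩))⟩
  rw [h.pos_eq, h.pos_eq]
  linarith [meetTime_coe_le (a := X k) (b := X (k + 1)) (by linarith)]

lemma collides_of_cw (hτ : 0 < s.timeToNextEvent) {k : ℤ} (hk : s.cw (f.agent k) = true) :
    s.Collides (f.agent k) ↔ CollidesWithNext f s X k := by
  refine ⟨?_, fun hC => ⟨_, h.meetAfter_of_collidesWithNext hτ hC⟩⟩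
  rintro ⟨j, ⟨-, hj, hm⟩ | ⟨-, hj, -⟩⟩
  · obtain ⟨l, rfl, hl⟩ := h.exists_lift_right k j
    rw [hm] at hl
    obtain rfl := h.eq_succ_of_meet hτ hk hj hl
    exact ⟨hk, hj, hl⟩
  · simp [hk] at hj

lemma collides_of_not_cw (hτ : 0 < s.timeToNextEvent) {k : ℤ}
    (hk : s.cw (f.agent (k + 1)) = false) :
    s.Collides (f.agent (k + 1)) ↔ CollidesWithNext f s X k := by
  refine ⟨?_, fun hC => ⟨_, (h.meetAfter_of_collidesWithNext hτ hC).symm⟩⟩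
  rintro ⟨j, ⟨hj, -, -⟩ | ⟨hj, -, hm⟩⟩
  · simp [hk] at hj
  · obtain ⟨l, rfl, hl⟩ := h.exists_lift_left (k + 1) j
    rw [hm] at hl
    obtain rfl : k = l := by linarith [h.eq_succ_of_meet hτ hj hk hl]
    exact ⟨hj, hk, hl⟩

lemma step_cw (hτ : 0 < s.timeToNextEvent) (k : ℤ) :
    s.step.cw (f.agent k) = s.cw (f.agent (partner f s X k)) := by
  classical
  have hstep : s.step.cw (f.agent k) =
    if s.Collides (f.agent k) then !s.cw (f.agent k) else s.cw (f.agent k) := rfl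
  rw [hstep]
  cases hk : s.cw (f.agent k)
  · have hC : ¬ CollidesWithNext f s X k := fun hC => by simp [hC.1] at hk
    have hiff := h.collides_of_not_cw hτ (k := k - 1) (by rwa [sub_add_cancel])
    rw [sub_add_cancel] at hiff
    simp only [hiff, partner, if_neg hC]
    split_ifs with hC'
    · exact hC'.1.symm
    · exact hk.symm
  · have hC : ¬ CollidesWithNext f s X (k - 1) := fun hC => by
      have := hC.2.1
      simp [hk] at this
    simp only [h.collides_of_cw hτ hk, partner, if_neg hC]
    split_ifs with hC'
    · exact hC'.2.1.symm
    · exact hk.symm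

lemma step_pos (k : ℤ) : s.step.pos (f.agent k) = (advance f s X k : UnitAddCircle) := by
  change s.pos (f.agent k) + _ = _
  rw [h.pos_eq, advance]
  cases s.cw (f.agent k) <;> simp

lemma advance_le_succ (hτ : 0 < s.timeToNextEvent) (k : ℤ) :
    advance f s X k ≤ advance f s X (k + 1) := by
  have hle := h.le_succ k
  unfold advance
  cases hk : s.cw (f.agent k) <;> cases hk' : s.cw (f.agent (k + 1)) <;>
    simp only [sgn_true, sgn_false]
  · linarith
  · linarith
  · have hlt : X k < X (k + 1) := hle.lt_of_ne fun he => by simpa [hk] using h.cw_of_eq k he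
    linarith [h.timeToNextEvent_le hk hk' hlt]
  · linarith

lemma collidesWithNext_of_advance_eq (hτ : 0 < s.timeToNextEvent) {k : ℤ}
    (he : advance f s X k = advance f s X (k + 1)) : CollidesWithNext f s X k := by
  have hle := h.le_succ k
  have hcw := h.cw_of_eq k
  unfold advance at he
  cases hk : s.cw (f.agent k) <;> cases hk' : s.cw (f.agent (k + 1)) <;>
    simp only [hk, hk', sgn_true, sgn_false] at he hcw
  · simpa using hcw (by linarith)
  · linarith
  · exact ⟨hk, hk', by linarith⟩
  · simpa using hcw (by linarith)

lemma collidesWithNext_add_period (k : ℤ) :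
    CollidesWithNext f s X (k + n) ↔ CollidesWithNext f s X k := by
  simp only [CollidesWithNext, add_right_comm k (n : ℤ) 1, f.agent_add, h.add_period,
    add_right_comm (X k) 1, add_left_inj]

lemma sum_step_cw (hτ : 0 < s.timeToNextEvent) :
    ∑ i, sgn (s.step.cw i) = ∑ i, sgn (s.cw i) := by
  classical
  let C (k : ℤ) : ℝ := if CollidesWithNext f s X k then 1 else 0
  have periodic (k : ℤ) : C (k + n) = C k := by
    simp only [C, h.collidesWithNext_add_period]
  have balance (k : ℤ) : sgn (s.step.cw (f.agent (k + 1))) + 2 * C (k + 1) =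
      sgn (s.cw (f.agent (k + 1))) + 2 * C k := by
    rw [h.step_cw hτ, partner, add_sub_cancel_right]
    by_cases h1 : CollidesWithNext f s X (k + 1)
    · have h0 : ¬ CollidesWithNext f s X k := fun h0 => h0.not_next h1
      norm_num [C, h1, h0, h1.1, h1.2.1]
    · by_cases h0 : CollidesWithNext f s X k
      · norm_num [C, h1, h0, h0.1, h0.2.1]
      · simp [C, h1, h0]
  have hsum := Finset.sum_congr (rfl : Finset.range n = _) fun k _ => balance k
  have hC := sum_range_int_add_one C n
  have hcw (s : Snapshot n) :
      ∑ k ∈ Finset.range n, sgn (s.cw (f.agent (k + 1))) = ∑ i, sgn (s.cw i) :=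
    (f.shift 1).sum_agent fun i => sgn (s.cw i)
  have := periodic 0
  rw [zero_add] at this
  simp only [Finset.sum_add_distrib, ← Finset.mul_sum, hcw] at hsum
  linarith

theorem step (hc : s.clock < 1) : IsLift f d s.step (advance f s X) := by
  have hτ := s.timeToNextEvent_pos hc
  refine ⟨?_, ?_, h.step_pos, fun k => ?_, h.advance_le_succ hτ, fun k he => ?_, fun k => ?_,
    fun a => ?_, ?_, (h.sum_step_cw hτ).trans h.sum_cw⟩
  · rw [step_clock]
    linarith [h.clock_nonneg]
  · rw [step_clock]
    linarith [s.timeToNextEvent_le]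
  · simp only [advance, f.agent_add, h.add_period]
    ring
  · have hC := h.collidesWithNext_of_advance_eq hτ he
    rw [h.step_cw hτ, h.step_cw hτ, partner_of_collidesWithNext hC, hC.partner_next]
    exact ⟨hC.2.1, hC.1⟩
  · obtain ⟨a, ha, hX⟩ := h.exists_token (partner f s X k)
    rw [h.step_cw hτ, ← advance_partner, step_clock]
    refine ⟨a, ha, ?_⟩
    rw [advance, hX]
    ring
  · obtain ⟨k, hk, hX⟩ := h.exists_carrier a
    refine ⟨partner f s X k, ?_, ?_⟩
    · rw [h.step_cw hτ, partner_partner, hk]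
    · rw [advance_partner, advance, hX, hk, step_clock]
      ring
  · simp only [advance]
    rw [Finset.sum_add_distrib, h.sum_eq, ← Finset.sum_mul,
      f.sum_agent fun i => sgn (s.cw i), h.sum_cw, step_clock]
    ring

end IsLift

end Snapshot

/-- The number of places by which the agents move on in a round, counted in the direction in which
the agents with `c i = true` start. -/
def rotation {n : ℕ} (c : Fin n → Bool) : ℤ := ∑ i, if c i then 1 else -1

lemma rotation_cast {n : ℕ} (c : Fin n → Bool) : (rotation c : ℝ) = ∑ i, sgn (c i) := by
  simp [rotation, sgn]

lemma rotation_not {n : ℕ} (c : Fin n → Bool) : rotation (fun i => !c i) = -rotation c := by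
  rw [rotation, rotation, ← Finset.sum_neg_distrib]
  exact Finset.sum_congr rfl fun i _ => by cases c i <;> rfl

namespace Snapshot

variable {n : ℕ} {f : Frame n} {d : Fin n → Bool} {s : Snapshot n} {X : ℤ → ℝ}
  {p : Fin n → UnitAddCircle}

/-! ### Rounds in a clockwise frame -/

/-- The clocks at which an event can happen in a round that starts at the places of `f`. -/
def eventClocks (f : Frame n) : Set ℝ :=
  {c | c = 1 ∨ c ≤ 1 ∧ ∃ a b, 0 < c ∧ f.coord b - f.coord a = 2 * c}

lemma finite_eventClocks (f : Frame n) : (eventClocks f).Finite := by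
  have hn : (0 : ℤ) < n := mod_cast f.card_pos
  refine (Set.Finite.insert (1 : ℝ) (((Set.finite_Ico (0 : ℤ) n).prod
    (Set.finite_Icc (0 : ℤ) (3 * n))).image fun q => (f.coord q.2 - f.coord q.1) / 2)).subset ?_
  rintro c (rfl | ⟨hc1, a, b, hc0, hab⟩)
  · exact Set.mem_insert _ _
  have coord_a := f.coord_add_mul (a % n) (a / n)
  have coord_b := f.coord_add_mul (b - a / n * n) (a / n)
  rw [sub_add_cancel] at coord_b
  rw [Int.emod_add_ediv_mul] at coord_a
  have hlt : a < b := f.strictMono.lt_iff_lt.1 (by linarith)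
  have hle : b ≤ a + 2 * n := f.strictMono.le_iff_le.1 (by
    rw [f.coord_add_mul]
    push_cast
    linarith)
  have emod_nonneg := Int.emod_nonneg a hn.ne'
  have emod_lt := Int.emod_lt_of_pos a hn
  have emod_add := Int.emod_add_ediv_mul a n
  refine Set.mem_insert_of_mem _ ⟨(a % n, b - a / n * n), ⟨⟨emod_nonneg, emod_lt⟩, ?_, ?_⟩, ?_⟩
  · change 0 ≤ b - a / n * n
    linarith
  · change b - a / n * n ≤ 3 * n
    linarith
  · change (f.coord (b - a / n * n) - f.coord (a % n)) / 2 = c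
    linarith

lemma IsLift.step_clock_mem (h : IsLift f d s X) (hc : s.clock < 1) :
    s.step.clock ∈ eventClocks f := by
  have of_meet {i j : Fin n} (hi : s.cw i = true) (hj : s.cw j = false)
      (hm : meetTime (s.pos i) (s.pos j) = s.timeToNextEvent) : s.step.clock ∈ eventClocks f := by
    obtain ⟨k, rfl⟩ := f.agent_surjective i
    obtain ⟨l, rfl, hl⟩ := h.exists_lift_right k j
    obtain ⟨a, -, ha⟩ := h.exists_token k
    obtain ⟨b, -, hb⟩ := h.exists_token l
    rw [hi, sgn_true] at ha
    rw [hj, sgn_false] at hb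
    refine Or.inr ⟨(h.step hc).clock_le_one, a, b, ?_, ?_⟩
    · exact add_pos_of_nonneg_of_pos h.clock_nonneg (s.timeToNextEvent_pos hc)
    · rw [step_clock]
      linarith
  rcases s.timeToNextEvent_mem with h' | ⟨i, j, ⟨hi, hj, hm⟩ | ⟨hj, hi, hm⟩⟩
  · left
    rw [step_clock]
    linarith
  · exact of_meet hi hj hm
  · exact of_meet hj hi hm

lemma exists_isLift_iterate (hf : f.isCw = true) (hp : f.At 0 p)
    {P : Snapshot n → (ℤ → ℝ) → Prop} (start : P (start p d) f.coord)
    (step : ∀ s X, IsLift f d s X → s.clock < 1 → P s X → P s.step (advance f s X)) (k : ℕ)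
    (hk : ∀ j < k, (Snapshot.step^[j] (Snapshot.start p d)).clock ≠ 1) :
    ∃ X, IsLift f d (Snapshot.step^[k] (Snapshot.start p d)) X ∧
      P (Snapshot.step^[k] (Snapshot.start p d)) X := by
  induction k with
  | zero => exact ⟨f.coord, .start hf hp, start⟩
  | succ k ih =>
    obtain ⟨X, hX, hP⟩ := ih fun j hj => hk j (hj.trans k.lt_succ_self)
    have hc := hX.clock_le_one.lt_of_ne (hk k k.lt_succ_self)
    rw [Function.iterate_succ_apply']
    exact ⟨_, hX.step hc, step _ X hX hc hP⟩

lemma exists_iterate_clock_eq_one (hf : f.isCw = true) (hp : f.At 0 p) :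
    ∃ k, (step^[k] (start p d)).clock = 1 := by
  by_contra! hne
  set u : ℕ → Snapshot n := fun k => step^[k] (start p d)
  have u_succ (k : ℕ) : u (k + 1) = (u k).step := Function.iterate_succ_apply' _ _ _
  have exists_lift (k : ℕ) : ∃ X, IsLift f d (u k) X :=
    (exists_isLift_iterate hf hp (P := fun _ _ => True) trivial (fun _ _ _ _ _ => trivial) k
      fun j _ => hne j).imp fun _ => And.left
  have clock_lt (k : ℕ) : (u k).clock < 1 := by
    obtain ⟨X, hX⟩ := exists_lift k
    exact hX.clock_le_one.lt_of_ne (hne k)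
  have clock_strictMono : StrictMono fun k => (u (k + 1)).clock :=
    strictMono_nat_of_lt_succ fun k => by
      rw [u_succ (k + 1), step_clock]
      linarith [(u (k + 1)).timeToNextEvent_pos (clock_lt _)]
  refine Set.infinite_of_injective_forall_mem clock_strictMono.injective (fun k => ?_)
    (finite_eventClocks f)
  obtain ⟨X, hX⟩ := exists_lift k
  rw [u_succ]
  exact hX.step_clock_mem (clock_lt k)

theorem finish_induction (hf : f.isCw = true) (hp : f.At 0 p)
    {P : Snapshot n → (ℤ → ℝ) → Prop} (start : P (start p d) f.coord)
    (step : ∀ s X, IsLift f d s X → s.clock < 1 → P s X → P s.step (advance f s X)) :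
    ∃ X, IsLift f d (finish p d) X ∧ (finish p d).clock = 1 ∧ P (finish p d) X := by
  obtain ⟨X, hX, hP⟩ := exists_isLift_iterate hf hp start step
    (sInf {k : ℕ | (Snapshot.step^[k] (Snapshot.start p d)).clock = 1})
    fun j hj => Nat.notMem_of_lt_sInf hj
  exact ⟨X, hX, Nat.sInf_mem (exists_iterate_clock_eq_one hf hp), hP⟩

lemma IsLift.strictMono_of_clock_eq_one (h : IsLift f d s X) (hc : s.clock = 1) :
    StrictMono X := by
  refine strictMono_int_of_lt_succ fun k => (h.le_succ k).lt_of_ne fun he => ?_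
  obtain ⟨hk, hk'⟩ := h.cw_of_eq k he
  obtain ⟨a, ha, ha'⟩ := h.exists_token k
  obtain ⟨b, hb, hb'⟩ := h.exists_token (k + 1)
  rw [hk, sgn_false, hc] at ha'
  rw [hk', sgn_true, hc] at hb'
  have hab : a = b + 2 * n := f.strictMono.injective (by
    rw [f.coord_add_mul]
    push_cast
    linarith)
  rw [hab, f.agent_add_mul, hb, hk, hk'] at ha
  exact Bool.noConfusion ha

lemma IsLift.exists_eq_coord (h : IsLift f d s X) (hc : s.clock = 1) (k : ℤ) :
    ∃ m, X k = f.coord m := by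
  obtain ⟨a, -, ha⟩ := h.exists_token k
  rw [hc] at ha
  cases hk : s.cw (f.agent k) <;> rw [ha, hk]
  · exact ⟨a + -1 * n, by rw [f.coord_add_mul]; simp⟩
  · exact ⟨a + 1 * n, by rw [f.coord_add_mul]; simp⟩

lemma IsLift.exists_coord_eq (h : IsLift f d s X) (hc : s.clock = 1) (m : ℤ) :
    ∃ k, X k = f.coord m := by
  cases hm : d (f.agent m)
  · obtain ⟨k, -, hX⟩ := h.exists_carrier (m + 1 * n)
    rw [f.agent_add_mul, hm, f.coord_add_mul, hc] at hX
    exact ⟨k, by simpa using hX⟩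
  · obtain ⟨k, -, hX⟩ := h.exists_carrier (m + -1 * n)
    rw [f.agent_add_mul, hm, f.coord_add_mul, hc] at hX
    exact ⟨k, by simpa using hX⟩

lemma finish_at_of_isCw (hf : f.isCw = true) (hp : f.At 0 p) :
    f.At (rotation d) (finish p d).pos := by
  obtain ⟨X, hX, hc, -⟩ := finish_induction (d := d) (P := fun _ _ => True) hf hp trivial
    (fun _ _ _ _ _ => trivial)
  choose ρ hρ using hX.exists_eq_coord hc
  have ρ_strictMono : StrictMono ρ := fun a b hab => by
    rw [← f.strictMono.lt_iff_lt, ← hρ, ← hρ]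
    exact hX.strictMono_of_clock_eq_one hc hab
  have ρ_surjective : Function.Surjective ρ := fun m => by
    obtain ⟨k, hk⟩ := hX.exists_coord_eq hc m
    exact ⟨k, f.strictMono.injective (by rw [← hρ, hk])⟩
  have X_eq (k : ℤ) : X k = f.coord (k + ρ 0) := by
    rw [hρ, int_eq_add_of_strictMono_of_surjective ρ_strictMono ρ_surjective]
  have ρ_zero : ρ 0 = rotation d := by
    have hsum := hX.sum_eq
    simp only [X_eq, f.sum_coord_add, hc, ← rotation_cast] at hsum
    have : (ρ 0 : ℝ) = rotation d := by linarith
    exact_mod_cast this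
  intro k
  rw [hX.pos_eq, X_eq, ρ_zero, hf, sgn_true, one_mul]

end Snapshot

namespace Snapshot

variable {n : ℕ} {f : Frame n} {d : Fin n → Bool} {s : Snapshot n} {X : ℤ → ℝ}
  {p : Fin n → UnitAddCircle} {R : ℤ}

lemma step_cw_of_not_collides {i : Fin n} (h : ¬ s.Collides i) : s.step.cw i = s.cw i := if_neg h

lemma step_first_of_not_collides {i : Fin n} (h : ¬ s.Collides i) :
    s.step.first i = s.first i := if_neg h

open Classical in
lemma step_first_of_some {i : Fin n} {c : UnitAddCircle} (h : s.first i = some c) :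
    s.step.first i = some c := by
  change (if s.Collides i then (s.first i).or _ else s.first i) = some c
  simp [h]

open Classical in
lemma step_first_of_collides {i : Fin n} (h : s.Collides i) (h' : s.first i = none) :
    s.step.first i = some (s.step.pos i) := by
  change (if s.Collides i then (s.first i).or (some (s.step.pos i)) else s.first i) = _
  rw [if_pos h, h', Option.none_or]

lemma finish_first_eq_none_of_isCw (hf : f.isCw = true) (hp : f.At 0 p) (hd : ∀ i j, d i = d j)
    (i : Fin n) : (finish p d).first i = none := by
  refine Exists.elim (finish_induction (d := d) (P := fun s _ => ∀ i, s.first i = none) hf hp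
    (fun _ => rfl) fun s X hX _ h i => ?_) fun X ⟨_, _, h⟩ => h i
  have cw_eq (i j : Fin n) : s.cw i = s.cw j := by
    obtain ⟨k, rfl⟩ := f.agent_surjective i
    obtain ⟨l, rfl⟩ := f.agent_surjective j
    obtain ⟨a, ha, -⟩ := hX.exists_token k
    obtain ⟨b, hb, -⟩ := hX.exists_token l
    rw [← ha, ← hb, hd]
  rw [step_first_of_not_collides, h]
  rintro ⟨j, ⟨hi, hj, -⟩ | ⟨hj, hi, -⟩⟩ <;>
    simpa [hi, hj] using cw_eq i j

section FirstCollision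

variable {k δ : ℤ} (hk : d (f.agent k) = true) (hδ : f.FirstChange d k δ) (hX : IsLift f d s X)
  (hlt : 2 * s.clock < f.coord (k + δ) - f.coord k)
  (hcw : s.cw (f.agent k) = true) (hXk : X k = f.coord k + s.clock)
include hk hδ hX hlt hcw hXk

lemma IsLift.two_mul_step_clock_le : 2 * s.step.clock ≤ f.coord (k + δ) - f.coord k := by
  have hkδ : d (f.agent (k + δ)) = false := by simpa [hk] using hδ.ne
  obtain ⟨l, hl, hXl⟩ := hX.exists_carrier (k + δ)
  rw [hkδ] at hl hXl
  rw [sgn_false] at hXl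
  have := hX.timeToNextEvent_le hcw hl (by linarith)
  rw [step_clock]
  linarith

lemma IsLift.collides_iff_two_mul_step_clock_eq (hc : s.clock < 1) :
    s.Collides (f.agent k) ↔ 2 * s.step.clock = f.coord (k + δ) - f.coord k := by
  have hτ := s.timeToNextEvent_pos hc
  have hkδ : d (f.agent (k + δ)) = false := by simpa [hk] using hδ.ne
  rw [hX.collides_of_cw hτ hcw]
  constructor
  · rintro ⟨-, hcw', hX'⟩
    obtain ⟨a, ha, hXa⟩ := hX.exists_token (k + 1)
    rw [hcw'] at ha hXa
    rw [sgn_false] at hXa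
    have hka : k < a := f.strictMono.lt_iff_lt.1 (by linarith [hX.clock_nonneg])
    have hδa : k + δ ≤ a := by
      by_contra hlt
      have := hδ.eq (a - k) (by omega) (by omega)
      rw [add_sub_cancel, ha, hk] at this
      exact Bool.noConfusion this
    have := f.strictMono.monotone hδa
    refine le_antisymm (hX.two_mul_step_clock_le hk hδ hlt hcw hXk) ?_
    rw [step_clock]
    linarith
  · intro heq
    obtain ⟨l, hl, hXl⟩ := hX.exists_carrier (k + δ)
    rw [hkδ] at hl hXl
    rw [sgn_false] at hXl
    rw [step_clock] at heq
    have hXl' : X l = X k + 2 * s.timeToNextEvent := by linarith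
    obtain rfl := hX.eq_succ_of_meet hτ hcw hl hXl'
    exact ⟨hcw, hl, hXl'⟩

end FirstCollision

lemma finish_first_of_isCw (hf : f.isCw = true) (hp : f.At 0 p) {k δ : ℤ}
    (hk : d (f.agent k) = true) (hδ : f.FirstChange d k δ) :
    (finish p d).first (f.agent k) =
      some (((f.coord k + f.coord (k + δ)) / 2 : ℝ) : UnitAddCircle) := by
  set gap := f.coord (k + δ) - f.coord k
  have gap_pos : 0 < gap := sub_pos.2 (f.strictMono (by linarith [hδ.pos]))
  have gap_lt : gap < 1 := by
    have := f.strictMono (show k + δ < k + n by linarith [hδ.lt])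
    rw [f.coord_add] at this
    linarith
  refine Exists.elim (finish_induction (d := d) (P := fun s X =>
    (2 * s.clock < gap →
      s.first (f.agent k) = none ∧ s.cw (f.agent k) = true ∧ X k = f.coord k + s.clock) ∧
    (gap ≤ 2 * s.clock → s.first (f.agent k) =
      some (((f.coord k + f.coord (k + δ)) / 2 : ℝ) : UnitAddCircle))) hf hp ?_ ?_)
    fun X ⟨_, hc, h⟩ => h.2 (by rw [hc]; linarith)
  · refine ⟨fun _ => ⟨rfl, hk, by simp [start]⟩, fun h => ?_⟩
    simp only [start] at h
    linarith
  rintro s X hX hc ⟨before, after⟩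
  rcases lt_or_ge (2 * s.clock) gap with hlt | hge
  · obtain ⟨hfirst, hcw, hXk⟩ := before hlt
    have hle := hX.two_mul_step_clock_le hk hδ hlt hcw hXk
    have hiff := hX.collides_iff_two_mul_step_clock_eq hk hδ hlt hcw hXk hc
    by_cases hC : s.Collides (f.agent k)
    · have heq := hiff.1 hC
      refine ⟨fun h => by linarith, fun _ => ?_⟩
      rw [step_first_of_collides hC hfirst, hX.step_pos, advance, hcw, sgn_true]
      rw [step_clock] at heq
      congr 2
      linarith
    · refine ⟨fun _ => ⟨?_, ?_, ?_⟩, fun h => absurd (le_antisymm hle h) (mt hiff.2 hC)⟩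
      · rw [step_first_of_not_collides hC, hfirst]
      · rw [step_cw_of_not_collides hC, hcw]
      · rw [advance, hcw, hXk, step_clock, sgn_true]
        ring
  · have := s.timeToNextEvent_pos hc
    refine ⟨fun h => ?_, fun _ => step_first_of_some (after hge)⟩
    rw [step_clock] at h
    linarith

/-! ### Reflection of the circle -/

/-- The mirror image of a snapshot. -/
def reflect (s : Snapshot n) : Snapshot n where
  clock := s.clock
  pos := -s.pos
  cw i := !s.cw i
  first i := (s.first i).map Neg.neg

lemma meetAfter_reflect {i j : Fin n} {τ : ℝ} : s.reflect.MeetAfter i j τ ↔ s.MeetAfter i j τ := by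
  simp only [MeetAfter, reflect, Pi.neg_apply, meetTime_neg_neg, Bool.not_eq_true',
    Bool.not_eq_false']
  tauto

lemma timeToNextEvent_reflect : s.reflect.timeToNextEvent = s.timeToNextEvent := by
  simp only [timeToNextEvent, meetAfter_reflect]
  rfl

lemma collides_reflect {i : Fin n} : s.reflect.Collides i ↔ s.Collides i := by
  simp only [Collides, timeToNextEvent_reflect, meetAfter_reflect]

lemma step_reflect : s.reflect.step = s.step.reflect := by
  classical
  have pos_eq (i : Fin n) : s.reflect.step.pos i = -s.step.pos i := by
    have hpos : s.reflect.step.pos i = -s.pos i +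
      ((if !s.cw i then s.timeToNextEvent else -s.timeToNextEvent : ℝ) : UnitAddCircle) := by
        simp only [step, timeToNextEvent_reflect]
        rfl
    rw [hpos]
    cases h : s.cw i <;> simp [step, h, add_comm]
  have first_eq (i : Fin n) : s.reflect.step.first i = (s.step.first i).map Neg.neg := by
    change (if s.reflect.Collides i then ((s.first i).map Neg.neg).or (some (s.reflect.step.pos i))
      else (s.first i).map Neg.neg) =
        (if s.Collides i then (s.first i).or (some (s.step.pos i)) else s.first i).map Neg.neg
    rw [pos_eq, collides_reflect]
    split_ifs <;> cases s.first i <;> rfl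
  have cw_eq (i : Fin n) : s.reflect.step.cw i = !s.step.cw i := by
    change (if s.reflect.Collides i then !!s.cw i else !s.cw i) =
      !if s.Collides i then !s.cw i else s.cw i
    rw [collides_reflect]
    split_ifs <;> rfl
  have clock_eq : s.reflect.step.clock = s.step.clock := by
    rw [step_clock, timeToNextEvent_reflect]
    rfl
  change Snapshot.mk _ _ _ _ = Snapshot.mk _ _ _ _
  congr 1
  · exact funext pos_eq
  · exact funext cw_eq
  · exact funext first_eq

lemma finish_reflect (p : Fin n → UnitAddCircle) (d : Fin n → Bool) :
    finish (-p) (fun i => !d i) = (finish p d).reflect := by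
  have h : Function.Semiconj (reflect : Snapshot n → Snapshot n) step step :=
    fun _ => step_reflect.symm
  have hstart : start (-p) (fun i => !d i) = (start p d).reflect := rfl
  have iterate (k : ℕ) : step^[k] (start p d).reflect = (step^[k] (start p d)).reflect :=
    (h.iterate_right k (start p d)).symm
  simp only [finish, hstart, iterate]
  rfl

/-! ### Rounds in an arbitrary frame -/

theorem finish_at (hp : f.At R p) (d : Fin n → Bool) :
    f.At (R + rotation fun i => d i == f.isCw) (finish p d).pos := by
  rw [← Frame.at_rotate_iff]
  cases hf : f.isCw
  · have h := (finish_at_of_isCw (d := fun i => !d i) (congrArg not hf) hp.rotate.reflect).reflect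
    rw [finish_reflect] at h
    simpa [reflect, Frame.reflect, Frame.At] using h
  · simpa using finish_at_of_isCw (d := d) (f := f.rotate R) hf hp.rotate

theorem finish_first_eq_none (hp : f.At R p) {d : Fin n → Bool} (hd : ∀ i j, d i = d j)
    (i : Fin n) : (finish p d).first i = none := by
  cases hf : f.isCw
  · exact finish_first_eq_none_of_isCw (congrArg not hf) hp.mirror.rotate hd i
  · exact finish_first_eq_none_of_isCw (f := f.rotate R) hf hp.rotate hd i

theorem finish_first (hp : f.At R p) {d : Fin n → Bool} {k δ : ℤ}
    (hk : d (f.agent k) = f.isCw) (hδ : f.FirstChange d k δ) :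
    (finish p d).first (f.agent k) =
      some ((sgn f.isCw * ((f.coord (k + R) + f.coord (k + δ + R)) / 2) : ℝ) : UnitAddCircle) := by
  cases hf : f.isCw
  · have hδ' : (f.rotate R).reflect.FirstChange (fun i => !d i) k δ :=
      ⟨hδ.pos, Bool.not_inj_iff.not.2 hδ.ne, fun j h h' => Bool.not_inj_iff.2 (hδ.eq j h h')⟩
    have h := finish_first_of_isCw (congrArg not hf) hp.rotate.reflect
      (congrArg not (hk.trans hf)) hδ'
    rw [finish_reflect] at h
    obtain ⟨c, hc, hc'⟩ := Option.map_eq_some_iff.1 h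
    rw [show (finish p d).first (f.agent k) = some c from hc, sgn_false, neg_one_mul,
      AddCircle.coe_neg]
    exact congrArg some (neg_eq_iff_eq_neg.1 hc')
  · rw [sgn_true, one_mul]
    exact finish_first_of_isCw (f := f.rotate R) hf hp.rotate (hk.trans hf)
      ⟨hδ.pos, hδ.ne, hδ.eq⟩

end Snapshot

/-! ### Existence of frames -/

lemma coe_cwArc (x y : UnitAddCircle) : ((cwArc x y : ℝ) : UnitAddCircle) = y - x :=
  (AddCircle.equivIco (1 : ℝ) 0).symm_apply_apply (y - x)

lemma coe_rightDist_coe (b : Bool) (u v : ℝ) :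
    ((rightDist b (u : UnitAddCircle) v : ℝ) : UnitAddCircle) =
      ((sgn b * (v - u) : ℝ) : UnitAddCircle) := by
  cases b <;> simp [rightDist, coe_cwArc]

lemma dist_coe_of_abs_sub_lt {u v : ℝ} (h : |u - v| < 1 / 2) :
    dist (u : UnitAddCircle) (v : UnitAddCircle) = |u - v| := by
  obtain ⟨h₁, h₂⟩ := abs_lt.1 h
  have hround : round (u - v) = 0 := round_eq_zero_iff.2 ⟨by linarith, by linarith⟩
  rw [dist_eq_norm, ← AddCircle.coe_sub, UnitAddCircle.norm_eq, hround, Int.cast_zero, sub_zero]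

/-- The residue of an integer modulo `n`. -/
def residue (n : ℕ) [NeZero n] (k : ℤ) : Fin n :=
  ⟨(k % n).toNat, by
    have hn : (0 : ℤ) < n := mod_cast NeZero.pos n
    have := Int.emod_nonneg k hn.ne'
    have := Int.emod_lt_of_pos k hn
    omega⟩

section Residue

variable {n : ℕ} [NeZero n]

lemma coe_residue (k : ℤ) : ((residue n k : ℕ) : ℤ) = k % n :=
  Int.toNat_of_nonneg (Int.emod_nonneg k (mod_cast NeZero.ne n))

lemma residue_eq_iff (k l : ℤ) : residue n k = residue n l ↔ (n : ℤ) ∣ l - k := by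
  rw [Fin.ext_iff, ← Int.modEq_iff_dvd, Int.ModEq, ← coe_residue, ← coe_residue, Nat.cast_inj]

lemma residue_coe (i : Fin n) : residue n (i : ℕ) = i := by
  have := coe_residue (n := n) (i : ℕ)
  rw [Int.emod_eq_of_lt (by omega) (by omega)] at this
  exact Fin.ext (mod_cast this)

lemma strictMono_comp_residue_add_ediv {y : Fin n → ℝ} (hy : StrictMono y)
    (hmem : ∀ i, y i ∈ Set.Ico (0 : ℝ) 1) :
    StrictMono fun k : ℤ => y (residue n k) + (k / n : ℤ) := by
  have hn : (0 : ℤ) < n := mod_cast NeZero.pos n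
  refine strictMono_int_of_lt_succ fun k => ?_
  rcases (Int.ediv_le_ediv hn (show k ≤ k + 1 by omega)).eq_or_lt with heq | hlt
  · have hres : residue n k < residue n (k + 1) := by
      have h₁ := Int.emod_add_mul_ediv k n
      have h₂ := Int.emod_add_mul_ediv (k + 1) n
      rw [← heq] at h₂
      rw [Fin.lt_def, ← Nat.cast_lt (α := ℤ), coe_residue, coe_residue]
      linarith
    simpa only [heq, add_lt_add_iff_right] using hy hres
  · have : ((k / n : ℤ) : ℝ) + 1 ≤ ((k + 1) / n : ℤ) := mod_cast hlt
    linarith [(hmem (residue n k)).2, (hmem (residue n (k + 1))).1]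

end Residue

theorem exists_frame {n : ℕ} (hn : 0 < n) {p : Fin n → UnitAddCircle}
    (hp : Function.Injective p) : ∃ f : Frame n, f.At 0 p := by
  have : NeZero n := ⟨hn.ne'⟩
  set lift : Fin n → ℝ := fun i => AddCircle.equivIco (1 : ℝ) 0 (p i)
  have coe_lift (i : Fin n) : ((lift i : ℝ) : UnitAddCircle) = p i :=
    (AddCircle.equivIco (1 : ℝ) 0).symm_apply_apply (p i)
  have lift_mem (i : Fin n) : lift i ∈ Set.Ico (0 : ℝ) 1 := by
    simpa using (AddCircle.equivIco (1 : ℝ) 0 (p i)).2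
  have lift_injective : Function.Injective lift := fun i j h => hp (by
    rw [← coe_lift, h, coe_lift])
  let order := Tuple.sort lift
  have strictMono_order : StrictMono (lift ∘ order) :=
    (Tuple.monotone_sort lift).strictMono_of_injective (lift_injective.comp order.injective)
  have residue_add (k : ℤ) : residue n (k + n) = residue n k := (residue_eq_iff _ _).2 (by simp)
  refine ⟨⟨true, fun k => lift (order (residue n k)) + (k / n : ℤ), fun k => order (residue n k),
    strictMono_comp_residue_add_ediv strictMono_order fun i => lift_mem _, fun k => ?_,
    fun k l => order.injective.eq_iff.trans (residue_eq_iff k l), fun i => ?_⟩, fun k => ?_⟩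
  · simp only [residue_add, Int.add_ediv_of_dvd_right (dvd_refl (n : ℤ)),
      Int.ediv_self (show (n : ℤ) ≠ 0 by omega), Int.cast_add, Int.cast_one, add_assoc]
  · exact ⟨(order.symm i : ℕ), by simp only [residue_coe, Equiv.apply_symm_apply]⟩
  · simp [coe_lift]

/-! ### One round as the agents see it -/

section Round

variable {n : ℕ} {f : Frame n} {R : ℤ} {p : Fin n → UnitAddCircle} {σ c : Fin n → Bool}

/-- The snapshot at the end of a round in which agent `i` starts right, in its own sense of
direction `σ i`, if and only if `c i = true`. -/
def roundEnd (σ : Fin n → Bool) (p : Fin n → UnitAddCircle) (c : Fin n → Bool) : Snapshot n :=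
  Snapshot.finish p fun i => σ i == c i

/-- The observation of agent `i` in the round of `roundEnd`. -/
def observation (σ : Fin n → Bool) (p : Fin n → UnitAddCircle) (c : Fin n → Bool) (i : Fin n) :
    Observation where
  dist := rightDist (σ i) (p i) ((roundEnd σ p c).pos i)
  coll := ((roundEnd σ p c).first i).map (Dist.dist (p i))

/-- Whether an agent starts in the direction in which a frame with `isCw = g` counts its places. -/
def startsForward (σ : Fin n → Bool) (g : Bool) (c : Fin n → Bool) (i : Fin n) : Bool :=
  (σ i == c i) == g

/-- The number of places of a frame with `isCw = g` by which the agents move on in a round. -/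
def rotationOf (σ : Fin n → Bool) (g : Bool) (c : Fin n → Bool) : ℤ :=
  rotation (startsForward σ g c)

lemma startsForward_bnot (g : Bool) (i : Fin n) :
    startsForward σ (!g) c i = !startsForward σ g c i := by
  unfold startsForward
  cases σ i <;> cases c i <;> cases g <;> rfl

lemma startsForward_mirror (k : ℤ) :
    startsForward σ f.mirror.isCw c (f.mirror.agent k) =
      !startsForward σ f.isCw c (f.agent (-k)) :=
  startsForward_bnot _ _

lemma rotationOf_not (g : Bool) : rotationOf σ g (fun i => !c i) = -rotationOf σ g c := by
  rw [rotationOf, rotationOf, ← rotation_not]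
  congr 1
  ext i
  simp only [startsForward]
  cases σ i <;> cases c i <;> cases g <;> rfl

lemma roundEnd_at (hp : f.At R p) : f.At (R + rotationOf σ f.isCw c) (roundEnd σ p c).pos :=
  Snapshot.finish_at hp _

lemma roundEnd_reverse (hp : f.At R p) :
    (roundEnd σ (roundEnd σ p c).pos fun i => !c i).pos = p := by
  have h := roundEnd_at (σ := σ) (c := fun i => !c i) (roundEnd_at (σ := σ) (c := c) hp)
  rw [rotationOf_not, add_neg_cancel_right] at h
  exact h.unique hp

lemma coe_observation_dist (hp : f.At R p) (k : ℤ) :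
    (((observation σ p c (f.agent k)).dist : ℝ) : UnitAddCircle) =
      ((sgn (σ (f.agent k) == f.isCw) *
        (f.coord (k + R + rotationOf σ f.isCw c) - f.coord (k + R)) : ℝ) : UnitAddCircle) := by
  change ((rightDist _ (p (f.agent k)) ((roundEnd σ p c).pos (f.agent k)) : ℝ) :
    UnitAddCircle) = _
  rw [hp k, roundEnd_at hp k, coe_rightDist_coe, sgn_beq, ← add_assoc]
  congr 1
  ring

lemma observation_coll_eq_none (hp : f.At R p)
    (h : ∀ i j, startsForward σ f.isCw c i = startsForward σ f.isCw c j) (i : Fin n) :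
    (observation σ p c i).coll = none := by
  refine Option.map_eq_none_iff.2 (Snapshot.finish_first_eq_none hp (fun i j => ?_) i)
  have := h i j
  unfold startsForward at this
  generalize (σ i == c i) = a, (σ j == c j) = b at this ⊢
  cases a <;> cases b <;> cases f.isCw <;> simp_all

lemma observation_coll_forward (hp : f.At R p) {k δ : ℤ}
    (hk : startsForward σ f.isCw c (f.agent k) = true)
    (hδ : f.FirstChange (startsForward σ f.isCw c) k δ) :
    (observation σ p c (f.agent k)).coll = some ((f.coord (k + δ + R) - f.coord (k + R)) / 2) := by
  have hδ' : f.FirstChange (fun i => σ i == c i) k δ :=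
    hδ.of_comp (· == f.isCw) (by cases f.isCw <;> decide)
  have hfirst := Snapshot.finish_first hp (beq_iff_eq.1 hk) hδ'
  change (Option.map _ ((Snapshot.finish p _).first (f.agent k))) = _
  have hpos := f.strictMono (show k + R < k + δ + R by linarith [hδ.pos])
  have hlt := f.strictMono (show k + δ + R < k + R + n by linarith [hδ.lt])
  rw [f.coord_add] at hlt
  have habs : |sgn f.isCw * f.coord (k + R) -
      sgn f.isCw * ((f.coord (k + R) + f.coord (k + δ + R)) / 2)| =
        (f.coord (k + δ + R) - f.coord (k + R)) / 2 := by
    rw [← mul_sub, abs_mul, abs_sgn, one_mul, abs_of_nonpos] <;> linarith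
  rw [hfirst, Option.map_some, hp k, dist_coe_of_abs_sub_lt (by rw [habs]; linarith), habs]

lemma exists_firstChange_of_observation_coll (hp : f.At R p) {i : Fin n} {v : ℝ}
    (hv : (observation σ p c i).coll = some v) (k : ℤ) :
    ∃ δ, f.FirstChange (startsForward σ f.isCw c) k δ := by
  by_contra! hconst
  have h (j : Fin n) : startsForward σ f.isCw c j = startsForward σ f.isCw c (f.agent k) := by
    by_contra hj
    obtain ⟨δ, hδ⟩ := f.exists_firstChange hj
    exact hconst δ hδ
  rw [observation_coll_eq_none hp fun i j => (h i).trans (h j).symm] at hv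
  cases hv

lemma exists_observation_coll_forward (hp : f.At R p) {k : ℤ}
    (hk : startsForward σ f.isCw c (f.agent k) = true) {v : ℝ}
    (hv : (observation σ p c (f.agent k)).coll = some v) :
    ∃ δ, 0 < δ ∧ startsForward σ f.isCw c (f.agent (k + δ)) = false ∧
      v = (f.coord (k + δ + R) - f.coord (k + R)) / 2 := by
  obtain ⟨δ, hδ⟩ := exists_firstChange_of_observation_coll hp hv k
  refine ⟨δ, hδ.pos, by simpa [hk] using hδ.ne, ?_⟩
  rw [observation_coll_forward hp hk hδ] at hv
  exact (Option.some_inj.1 hv).symm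

/-- The distance to the first collision, and `1` if there was none; all other values are less
than `1 / 2`. -/
def Observation.collDist (o : Observation) : ℝ := o.coll.getD 1

lemma exists_observation_collDist_forward (hp : f.At R p) {k : ℤ} {i : Fin n}
    (hk : startsForward σ f.isCw c (f.agent k) = true)
    (hi : startsForward σ f.isCw c i = false) :
    ∃ δ, f.FirstChange (startsForward σ f.isCw c) k δ ∧
      (observation σ p c (f.agent k)).collDist =
        (f.coord (k + δ + R) - f.coord (k + R)) / 2 := by
  obtain ⟨δ, hδ⟩ := f.exists_firstChange (c := startsForward σ f.isCw c) (k := k) (i := i)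
    (by rw [hi, hk]; exact Bool.false_ne_true)
  exact ⟨δ, hδ, by rw [Observation.collDist, observation_coll_forward hp hk hδ]; rfl⟩

lemma Frame.coord_add_one_sub_lt_one (f : Frame n) (hn : 1 < n) (k : ℤ) :
    f.coord (k + 1) - f.coord k < 1 := by
  have := f.strictMono (show k + 1 < k + n by omega)
  rw [f.coord_add] at this
  linarith

section Neighbors

variable (hn : 1 < n) (hp : f.At R p) {k : ℤ}
include hn hp

lemma halfGap_le_collDist_forward (hk : startsForward σ f.isCw c (f.agent k) = true) :
    (f.coord (k + 1 + R) - f.coord (k + R)) / 2 ≤ (observation σ p c (f.agent k)).collDist := by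
  have hgap := f.coord_add_one_sub_lt_one hn (k + R)
  have hpos := f.strictMono (show k + R < k + R + 1 by omega)
  rw [add_right_comm]
  unfold Observation.collDist
  cases hv : (observation σ p c (f.agent k)).coll with
  | none => rw [Option.getD_none]; linarith
  | some v =>
    obtain ⟨δ, hδ, -, rfl⟩ := exists_observation_coll_forward hp hk hv
    have := f.strictMono.monotone (show k + R + 1 ≤ k + δ + R by omega)
    rw [Option.getD_some]
    linarith

lemma collDist_forward_eq_iff (hk : startsForward σ f.isCw c (f.agent k) = true) :
    (observation σ p c (f.agent k)).collDist = (f.coord (k + 1 + R) - f.coord (k + R)) / 2 ↔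
      startsForward σ f.isCw c (f.agent (k + 1)) = false := by
  constructor
  · intro h
    have hgap := f.coord_add_one_sub_lt_one hn (k + R)
    have hpos := f.strictMono (show k + R < k + R + 1 by omega)
    rw [add_right_comm k 1 R] at h
    unfold Observation.collDist at h
    cases hv : (observation σ p c (f.agent k)).coll with
    | none => rw [hv, Option.getD_none] at h; linarith
    | some v =>
      obtain ⟨δ, -, hstart, rfl⟩ := exists_observation_coll_forward hp hk hv
      rw [hv, Option.getD_some] at h
      have := f.strictMono.injective (show f.coord (k + δ + R) = f.coord (k + R + 1) by linarith)
      rwa [show k + 1 = k + δ by omega]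
  · intro h
    rw [Observation.collDist, observation_coll_forward hp hk (δ := 1)
      ⟨one_pos, by rw [h, hk]; exact Bool.false_ne_true, fun j h₁ h₂ => by omega⟩, Option.getD_some]

lemma halfGap_le_collDist_backward (hk : startsForward σ f.isCw c (f.agent k) = false) :
    (f.coord (k + R) - f.coord (k - 1 + R)) / 2 ≤ (observation σ p c (f.agent k)).collDist := by
  have h := halfGap_le_collDist_forward (σ := σ) (c := c) hn hp.mirror (k := -k)
    (by rw [startsForward_mirror, neg_neg, hk, Bool.not_false])
  simp only [Frame.mirror, neg_neg] at h
  rw [show -(-k + -R) = k + R by ring, show -(-k + 1 + -R) = k - 1 + R by ring] at h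
  linarith

lemma collDist_backward_eq_iff (hk : startsForward σ f.isCw c (f.agent k) = false) :
    (observation σ p c (f.agent k)).collDist = (f.coord (k + R) - f.coord (k - 1 + R)) / 2 ↔
      startsForward σ f.isCw c (f.agent (k - 1)) = true := by
  have h := collDist_forward_eq_iff (σ := σ) (c := c) hn hp.mirror (k := -k)
    (by rw [startsForward_mirror, neg_neg, hk, Bool.not_false])
  rw [startsForward_mirror, Bool.not_eq_false', show -(-k + 1) = k - 1 by ring] at h
  rw [← h]
  simp only [Frame.mirror, neg_neg]
  rw [show -(-k + -R) = k + R by ring, show -(-k + 1 + -R) = k - 1 + R by ring, neg_sub_neg]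

end Neighbors

end Round

/-! ### Programs -/

/-- A program for one agent: it ends with a result, or it starts a round in some direction (right
if the Boolean is `true`) and goes on depending on the observation. -/
inductive Program (α : Type) : Type
  | done : α → Program α
  | act : Bool → (Observation → Program α) → Program α

namespace Program

variable {α β : Type}

/-- Run a program and then a second one that depends on the result of the first. -/
def bind : Program α → (α → Program β) → Program β
  | done a, k => k a
  | act b h, k => act b fun o => (h o).bind k

instance : Monad Program where
  pure := done
  bind := bind

/-- The program of one round. -/
def turn (b : Bool) : Program Observation := act b done

/-- One round, followed by the reversed round, which restores the positions. -/
def probe (b : Bool) : Program Observation := do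
  let o ← turn b
  let _ ← turn (!b)
  return o

/-- What is left of a program after an observation. -/
def step : Program α → Observation → Program α
  | done a, _ => done a
  | act _ h, o => h o

/-- What is left of a program after some observations. -/
def feed (P : Program α) (l : List Observation) : Program α := l.foldl step P

/-- Whether a program starts the next round to the right; `true` by convention if it has ended. -/
def next : Program α → Bool
  | done _ => true
  | act b _ => b

/-- The result of a program that has ended. -/
def result : Program α → Option α
  | done a => some a
  | act _ _ => none

lemma feed_append_singleton (P : Program α) (l : List Observation) (o : Observation) :
    P.feed (l ++ [o]) = (P.feed l).step o :=
  List.foldl_append ..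

end Program

/-- When the agents with senses of direction `σ` start the programs at the positions `p`, all of
them end after exactly `T` rounds, at the positions `p'`, with the results `a`. -/
inductive Runs {n : ℕ} (σ : Fin n → Bool) {α : Type} : (Fin n → UnitAddCircle) →
    (Fin n → Program α) → ℕ → (Fin n → UnitAddCircle) → (Fin n → α) → Prop
  | done (p : Fin n → UnitAddCircle) (a : Fin n → α) : Runs σ p (fun i => .done (a i)) 0 p a
  | act (p : Fin n → UnitAddCircle) (c : Fin n → Bool) (k : Fin n → Observation → Program α)
      (T : ℕ) (p' : Fin n → UnitAddCircle) (a : Fin n → α)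
      (h : Runs σ (roundEnd σ p c).pos (fun i => k i (observation σ p c i)) T p' a) :
      Runs σ p (fun i => .act (c i) (k i)) (T + 1) p' a

namespace Runs

variable {n : ℕ} {f : Frame n} {R : ℤ} {σ : Fin n → Bool} {p p' p'' : Fin n → UnitAddCircle}
  {α β : Type} {T T' : ℕ}

lemma pure (p : Fin n → UnitAddCircle) (a : Fin n → α) :
    Runs σ p (fun i => (Pure.pure (a i) : Program α)) 0 p a := Runs.done p a

lemma bind {P : Fin n → Program α} {a : Fin n → α} (h : Runs σ p P T p' a)
    {k : Fin n → α → Program β} {b : Fin n → β} (h' : Runs σ p' (fun i => k i (a i)) T' p'' b) :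
    Runs σ p (fun i => P i >>= k i) (T + T') p'' b := by
  induction h with
  | done p a => rwa [zero_add]
  | act p c k₁ T p' a _ ih =>
    rw [add_right_comm]
    exact Runs.act p c (fun i o => (k₁ i o).bind (k i)) _ _ _ (ih h')

lemma map {P : Fin n → Program α} {a : Fin n → α} (h : Runs σ p P T p' a)
    (k : Fin n → α → β) :
    Runs σ p (fun i => P i >>= fun x => Pure.pure (k i x)) T p' fun i => k i (a i) :=
  h.bind (k := fun i x => Pure.pure (k i x)) (Runs.pure p' _)

lemma of_rounds_eq {P : Fin n → Program α} {a : Fin n → α} (hT : T = T')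
    (h : Runs σ p P T p' a) : Runs σ p P T' p' a := hT ▸ h

lemma turn (p : Fin n → UnitAddCircle) (c : Fin n → Bool) :
    Runs σ p (fun i => Program.turn (c i)) 1 (roundEnd σ p c).pos (observation σ p c) :=
  Runs.act p c (fun _ => Program.done) 0 _ _ (Runs.done _ _)

lemma turn_reverse (hp : f.At R p) (c : Fin n → Bool) :
    Runs σ (roundEnd σ p c).pos (fun i => Program.turn (!c i)) 1 p
      (observation σ (roundEnd σ p c).pos fun i => !c i) := by
  simpa only [roundEnd_reverse hp] using
    Runs.turn (σ := σ) (roundEnd σ p c).pos fun i => !c i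

lemma probe (hp : f.At R p) (c : Fin n → Bool) :
    Runs σ p (fun i => Program.probe (c i)) 2 p (observation σ p c) :=
  (Runs.turn p c).bind (k := fun i o => Program.turn (!c i) >>= fun _ => Pure.pure o)
    ((turn_reverse hp c).map fun i _ => observation σ p c i)

end Runs

/-! ### From programs to algorithms -/

/-- The direction that an agent calls right if `b = true`, left otherwise. -/
def dir (b : Bool) : Direction := if b then .right else .left

lemma startsCw_dir (s b : Bool) : startsCw s (dir b) = (s == b) := by
  cases s <;> cases b <;> rfl

/-- The algorithm in which an agent with identifier `id` executes the program `P N id`. -/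
def Algorithm.ofProgram (P : ℕ → ℕ → Program (Set ℝ)) : Algorithm where
  move N _ id l := dir ((P N id).feed l).next
  output N _ id l := ((P N id).feed l).result

section Run

variable {N n : ℕ} {net : Network N n} {P : ℕ → ℕ → Program (Set ℝ)} {t : ℕ}

lemma run_ofProgram_succ {p : Fin n → UnitAddCircle} {c : Fin n → Bool}
    (hpos : ((Algorithm.ofProgram P).run net t).1 = p)
    (hnext : ∀ i, ((P N (net.ident i)).feed (((Algorithm.ofProgram P).run net t).2 i)).next = c i) :
    (Algorithm.ofProgram P).run net (t + 1) = ((roundEnd net.sense p c).pos,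
      fun i => ((Algorithm.ofProgram P).run net t).2 i ++ [observation net.sense p c i]) := by
  have hdir : (fun i => startsCw (net.sense i) ((Algorithm.ofProgram P).move N (decide (Even n))
      (net.ident i) (((Algorithm.ofProgram P).run net t).2 i))) = fun i => net.sense i == c i := by
    ext i
    rw [← hnext, ← startsCw_dir]
    rfl
  simp only [Algorithm.run, hdir, hpos]
  rfl

lemma outputAt_ofProgram_of_runs {p p' : Fin n → UnitAddCircle} {Q : Fin n → Program (Set ℝ)}
    {T : ℕ} {a : Fin n → Set ℝ} (h : Runs net.sense p Q T p' a)
    (hpos : ((Algorithm.ofProgram P).run net t).1 = p)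
    (hfeed : ∀ i, (P N (net.ident i)).feed (((Algorithm.ofProgram P).run net t).2 i) = Q i)
    (i : Fin n) :
    (∀ s < T, (Algorithm.ofProgram P).outputAt net (t + s) i = none) ∧
      (Algorithm.ofProgram P).outputAt net (t + T) i = some (a i) := by
  induction h generalizing t with
  | done p a =>
    refine ⟨fun s hs => absurd hs s.not_lt_zero, ?_⟩
    change ((P N (net.ident i)).feed _).result = _
    rw [add_zero, hfeed]
    rfl
  | act p c k T _ a _ ih =>
    have hrun := run_ofProgram_succ (c := c) hpos fun i => by rw [hfeed]; rfl
    obtain ⟨hnone, hsome⟩ := ih (t := t + 1) (congrArg Prod.fst hrun) fun i => by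
      rw [hrun, Program.feed_append_singleton, hfeed]
      rfl
    refine ⟨fun s hs => ?_, by rw [← hsome, add_assoc, add_comm 1 T]⟩
    cases s with
    | zero =>
      change ((P N (net.ident i)).feed _).result = _
      rw [add_zero, hfeed]
      rfl
    | succ s =>
      rw [add_comm s 1, ← add_assoc]
      exact hnone s (by omega)

theorem solvesLocationDiscovery_ofProgram {T : ℕ} {p' : Fin n → UnitAddCircle}
    (h : Runs net.sense net.pos (fun i => P N (net.ident i)) T p' net.othersFrom) :
    (Algorithm.ofProgram P).SolvesLocationDiscovery net T := fun i => by
  simpa only [zero_add] using outputAt_ofProgram_of_runs (t := 0) h rfl (fun _ => rfl) i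

end Run

/-! ### Exchange of information between neighbors -/

section Neighbors

variable {n : ℕ} {f h : Frame n} {p : Fin n → UnitAddCircle} {σ c : Fin n → Bool} {i : Fin n}

namespace Frame

/-- The frame `h` is that of the agent `i` at the positions `p`: it starts at this agent and counts
the places in the direction that this agent calls right. -/
structure IsOwn (h : Frame n) (σ : Fin n → Bool) (p : Fin n → UnitAddCircle) (i : Fin n) :
    Prop where
  isCw_eq : h.isCw = σ i
  agent_zero : h.agent 0 = i
  at_zero : h.At 0 p

/-- The neighbor of agent `h.agent 0` in the direction of the frame (`true`) or in the opposite
one. -/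
def neighbor (h : Frame n) (e : Bool) : Fin n := if e then h.agent 1 else h.agent (-1)

/-- Half the distance between agent `h.agent 0` and `h.neighbor e`. -/
def halfGap (h : Frame n) (e : Bool) : ℝ :=
  if e then (h.coord 1 - h.coord 0) / 2 else (h.coord 0 - h.coord (-1)) / 2

/-- The frame of the agent at the place `k` of `f`. -/
def own (f : Frame n) (σ : Fin n → Bool) (k : ℤ) : Frame n :=
  if σ (f.agent k) = f.isCw then f.shift k else (f.shift k).mirror

lemma isOwn_own (hp : f.At 0 p) (k : ℤ) : (f.own σ k).IsOwn σ p (f.agent k) := by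
  unfold own
  split_ifs with hg
  · exact ⟨hg.symm, by simp [shift], hp.shift k⟩
  · exact ⟨(Bool.eq_not.2 hg).symm, by simp [shift, mirror], by simpa using (hp.shift k).mirror⟩

lemma own_neighbor (k : ℤ) :
    (f.own σ k).neighbor true = f.agent (k + 1) ∧ (f.own σ k).neighbor false = f.agent (k - 1) ∨
      (f.own σ k).neighbor true = f.agent (k - 1) ∧
        (f.own σ k).neighbor false = f.agent (k + 1) := by
  unfold own
  split_ifs
  · left; simp [neighbor, shift, add_comm, sub_eq_add_neg]
  · right; simp [neighbor, shift, mirror, add_comm, sub_eq_add_neg]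

lemma exists_isOwn (hp : f.At 0 p) (σ : Fin n → Bool) (i : Fin n) :
    ∃ h : Frame n, h.IsOwn σ p i := by
  obtain ⟨k, rfl⟩ := f.agent_surjective i
  exact ⟨_, isOwn_own hp k⟩

lemma agent_add_one_ne (hn : 1 < n) (f : Frame n) (k : ℤ) : f.agent (k + 1) ≠ f.agent k :=
  (f.agent_eq_iff _ _).not.2 fun hdvd => by
    have := Int.le_of_dvd one_pos ((dvd_neg.1 (by simpa using hdvd)) : (n : ℤ) ∣ 1)
    omega

lemma neighbor_ne (hn : 1 < n) (h : Frame n) (e : Bool) : h.neighbor e ≠ h.agent 0 := by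
  cases e
  · simpa [neighbor] using (h.agent_add_one_ne hn (-1)).symm
  · simpa [neighbor] using h.agent_add_one_ne hn 0

namespace IsOwn

variable (hn : 1 < n) (hi : h.IsOwn σ p i)
include hi

lemma startsForward_eq : startsForward σ h.isCw c i = c i := by
  rw [startsForward, hi.isCw_eq]
  cases σ i <;> cases c i <;> rfl

include hn

lemma halfGap_le_collDist : h.halfGap (c i) ≤ (observation σ p c i).collDist := by
  have hstart := hi.startsForward_eq (c := c)
  obtain ⟨hg, rfl, hp⟩ := hi
  cases hc : c (h.agent 0)
  · simpa [halfGap] using halfGap_le_collDist_backward hn hp (hstart.trans hc)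
  · simpa [halfGap] using halfGap_le_collDist_forward hn hp (hstart.trans hc)

lemma collDist_eq_halfGap_iff : (observation σ p c i).collDist = h.halfGap (c i) ↔
    (σ (h.neighbor (c i)) == σ i) ≠ (c (h.neighbor (c i)) == c i) := by
  have hstart := hi.startsForward_eq (c := c)
  have relative (a b s t : Bool) : (((a == b) == s) = !t) ↔ (a == s) ≠ (b == t) := by
    revert a b s t
    decide
  obtain ⟨hg, rfl, hp⟩ := hi
  rw [← relative, ← hg]
  cases hc : c (h.agent 0)
  · simpa [halfGap, neighbor, startsForward] using collDist_backward_eq_iff hn hp (hstart.trans hc)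
  · simpa [halfGap, neighbor, startsForward] using collDist_forward_eq_iff hn hp (hstart.trans hc)

end IsOwn

end Frame

/-- The distances to the two neighbors and whether they have the same sense of direction. -/
structure Link where
  halfGap : Bool → ℝ
  same : Bool → Bool

/-- The link of every agent is as stated by `L`. -/
def AreLinks (σ : Fin n → Bool) (p : Fin n → UnitAddCircle) (L : Fin n → Link) : Prop :=
  ∀ i h, Frame.IsOwn h σ p i →
    (L i).halfGap = h.halfGap ∧ ∀ e, (L i).same e = (σ (h.neighbor e) == σ i)

end Neighbors

namespace Program

/-- A round in each of the two directions, with its reversal; the result consists of the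
observations in the round that started right (`true`) and in the one that started left. -/
def probeBoth (b : Bool) : Program (Bool → Observation) := do
  let o ← probe b
  let o' ← probe (!b)
  return fun e => if b == e then o else o'

/-- Measure half the distances to the neighbors by means of the `b` lowest bits of `v`. -/
def gaps : ℕ → ℕ → Program (Bool → ℝ)
  | 0, _ => do
    let o ← probeBoth true
    return fun e => (o e).collDist
  | b + 1, v => do
    let o ← probeBoth (v % 2 == 1)
    let r ← gaps b (v / 2)
    return fun e => min (o e).collDist (r e)

open Classical in
/-- Determine the link to the neighbors, by means of distinct numbers `v < 2 ^ b`. -/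
def link (b v : ℕ) : Program Link := do
  let r ← gaps b v
  let o ← probeBoth true
  return ⟨r, fun e => decide ((o e).collDist ≠ r e)⟩

open Classical in
/-- Send a bit to the neighbors and receive theirs. -/
def exchange (L : Link) (v : Bool) : Program (Bool → Bool) := do
  let o ← probeBoth v
  return fun e => (L.same e ^^ decide ((o e).collDist = L.halfGap e)) == v

/-- Send the number consisting of the `b` lowest bits of `v` and receive those of the
neighbors. -/
def exchangeNat (L : Link) : ℕ → ℕ → Program (Bool → ℕ)
  | 0, _ => return fun _ => 0
  | b + 1, v => do
    let r ← exchange L (v % 2 == 1)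
    let q ← exchangeNat L b (v / 2)
    return fun e => (r e).toNat + 2 * q e

/-- The maximum of the numbers held by the agents up to distance `j`. -/
def flood (L : Link) (b : ℕ) : ℕ → ℕ → Program ℕ
  | 0, v => return v
  | j + 1, v => do
    let q ← exchangeNat L b v
    flood L b j (max v (max (q true) (q false)))

end Program

lemma mod_two_beq_one_eq_iff (a b : ℕ) : (a % 2 == 1) = (b % 2 == 1) ↔ a % 2 = b % 2 := by
  rcases Nat.mod_two_eq_zero_or_one a with ha | ha <;>
    rcases Nat.mod_two_eq_zero_or_one b with hb | hb <;> simp [ha, hb]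

lemma toNat_mod_two_beq_one (a : ℕ) : (a % 2 == 1).toNat = a % 2 := by
  rcases Nat.mod_two_eq_zero_or_one a with ha | ha <;> simp [ha]

lemma exists_abs_le_abs_sub_le_one {d : ℤ} {j : ℕ} (hd : |d| ≤ (j + 1 : ℕ)) :
    ∃ d' : ℤ, |d'| ≤ j ∧ |d - d'| ≤ 1 := by
  simp only [abs_le] at hd ⊢
  rcases lt_trichotomy d 0 with h | h | h
  · exact ⟨d + 1, by omega⟩
  · exact ⟨d, by omega⟩
  · exact ⟨d - 1, by omega⟩

section Exchange

variable {n : ℕ} {f : Frame n} {p : Fin n → UnitAddCircle} {σ : Fin n → Bool} {L : Fin n → Link}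

lemma Frame.le_max_neighbor (v : Fin n → ℕ) (k : ℤ) {d : ℤ} (hd : |d| ≤ 1) :
    v (f.agent (k + d)) ≤ max (v (f.agent k))
      (max (v ((f.own σ k).neighbor true)) (v ((f.own σ k).neighbor false))) := by
  obtain rfl | rfl | rfl : d = 0 ∨ d = 1 ∨ d = -1 := by
    rw [abs_le] at hd
    omega
  · simp
  all_goals
    rcases f.own_neighbor (σ := σ) k with ⟨h₁, h₂⟩ | ⟨h₁, h₂⟩ <;> rw [h₁, h₂] <;>
      simp [sub_eq_add_neg]

variable (hn : 1 < n) (hp : f.At 0 p)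
include hn hp

theorem runs_probeBoth (c : Fin n → Bool) :
    ∃ o : Fin n → Bool → Observation, Runs σ p (fun i => Program.probeBoth (c i)) 4 p o ∧
      ∀ i h, Frame.IsOwn h σ p i → ∀ e, h.halfGap e ≤ (o i e).collDist ∧
        ((o i e).collDist = h.halfGap e ↔
          (σ (h.neighbor e) == σ i) ≠ (c (h.neighbor e) == c i)) := by
  refine ⟨_, (Runs.probe hp c).bind
    (k := fun i o => Program.probe (!c i) >>= fun o' => pure fun e => if c i == e then o else o')
    ((Runs.probe hp fun i => !c i).map
      fun i o' e => if c i == e then observation σ p c i else o'), fun i h hi e => ?_⟩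
  by_cases hc : c i = e
  · subst hc
    simp only [BEq.rfl, if_true]
    exact ⟨hi.halfGap_le_collDist hn, hi.collDist_eq_halfGap_iff hn⟩
  · obtain rfl : (!c i) = e := (Bool.eq_not.2 (Ne.symm hc)).symm
    have beq_not_self (a : Bool) : (a == !a) = false := by cases a <;> rfl
    have not_beq_not (a b : Bool) : ((!a) == !b) = (a == b) := by cases a <;> cases b <;> rfl
    have collDist_iff := hi.collDist_eq_halfGap_iff (c := fun i => !c i) hn
    simp only [beq_not_self, not_beq_not, Bool.false_eq_true, if_false] at collDist_iff ⊢
    exact ⟨hi.halfGap_le_collDist (c := fun i => !c i) hn, collDist_iff⟩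

theorem runs_gaps (b : ℕ) (v : Fin n → ℕ) :
    ∃ r : Fin n → Bool → ℝ, Runs σ p (fun i => Program.gaps b (v i)) (4 * (b + 1)) p r ∧
      ∀ i h, Frame.IsOwn h σ p i → ∀ e, h.halfGap e ≤ r i e ∧
        (σ (h.neighbor e) ≠ σ i ∨ v (h.neighbor e) % 2 ^ b ≠ v i % 2 ^ b →
          r i e = h.halfGap e) := by
  induction b generalizing v with
  | zero =>
    obtain ⟨o, ho, H⟩ := runs_probeBoth (σ := σ) hn hp fun _ => true
    refine ⟨_, ho.map fun _ o e => (o e).collDist,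
      fun i h hi e => ⟨(H i h hi e).1, fun hdiff => (H i h hi e).2.2 ?_⟩⟩
    simpa [Nat.mod_one] using hdiff
  | succ b ih =>
    obtain ⟨o, ho, H⟩ := runs_probeBoth (σ := σ) hn hp fun i => v i % 2 == 1
    obtain ⟨r, hr, H'⟩ := ih fun i => v i / 2
    refine ⟨_, Runs.of_rounds_eq (by ring) (ho.bind (hr.bind (Runs.pure p _))),
      fun i h hi e => ⟨le_min (H i h hi e).1 (H' i h hi e).1, fun hdiff => ?_⟩⟩
    obtain ⟨ho_le, ho_eq⟩ := H i h hi e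
    obtain ⟨hr_le, hr_eq⟩ := H' i h hi e
    refine le_antisymm ?_ (le_min ho_le hr_le)
    by_cases hr_diff : σ (h.neighbor e) ≠ σ i ∨ v (h.neighbor e) / 2 % 2 ^ b ≠ v i / 2 % 2 ^ b
    · exact (min_le_right _ _).trans (hr_eq hr_diff).le
    · push Not at hr_diff
      have hbit : v (h.neighbor e) % 2 ≠ v i % 2 := fun heq =>
        hdiff.elim (· hr_diff.1) fun hne => hne (by
          rw [pow_succ', Nat.mod_mul, Nat.mod_mul, hr_diff.2, heq])
      refine (min_le_left _ _).trans (ho_eq.2 ?_).le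
      rw [hr_diff.1, BEq.rfl, ne_comm, ne_eq, Bool.not_eq_true, beq_eq_false_iff_ne]
      exact (mod_two_beq_one_eq_iff _ _).not.2 hbit

theorem runs_link (b : ℕ) (v : Fin n → ℕ) (hv : Function.Injective v) (hb : ∀ i, v i < 2 ^ b) :
    ∃ L : Fin n → Link, Runs σ p (fun i => Program.link b (v i)) (4 * (b + 2)) p L ∧
      AreLinks σ p L := by
  classical
  obtain ⟨r, hr, H⟩ := runs_gaps (σ := σ) hn hp b v
  obtain ⟨o, ho, H'⟩ := runs_probeBoth (σ := σ) hn hp fun _ => true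
  refine ⟨_, Runs.of_rounds_eq (by ring) (hr.bind (ho.bind (Runs.pure p _))), fun i h hi => ?_⟩
  have r_eq : r i = h.halfGap := funext fun e => (H i h hi e).2 <| Or.inr <| by
    rw [Nat.mod_eq_of_lt (hb _), Nat.mod_eq_of_lt (hb _)]
    exact hv.ne (hi.agent_zero ▸ h.neighbor_ne hn e)
  refine ⟨r_eq, fun e => ?_⟩
  have h2 := (H' i h hi e).2
  simp only [r_eq, ne_eq, h2, BEq.rfl]
  cases (σ (h.neighbor e) == σ i) <;> simp

theorem runs_exchange (hL : AreLinks σ p L) (v : Fin n → Bool) :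
    ∃ r : Fin n → Bool → Bool, Runs σ p (fun i => Program.exchange (L i) (v i)) 4 p r ∧
      ∀ i h, Frame.IsOwn h σ p i → ∀ e, r i e = v (h.neighbor e) := by
  classical
  obtain ⟨o, ho, H⟩ := runs_probeBoth (σ := σ) hn hp v
  refine ⟨_, ho.map fun i o e =>
    (((L i).same e ^^ decide ((o e).collDist = (L i).halfGap e)) == v i), fun i h hi e => ?_⟩
  obtain ⟨halfGap_eq, same_eq⟩ := hL i h hi
  simp only [halfGap_eq, same_eq, (H i h hi e).2]
  generalize σ (h.neighbor e) = x, σ i = y, v (h.neighbor e) = z, v i = w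
  revert x y z w
  decide

theorem runs_exchangeNat (hL : AreLinks σ p L) (b : ℕ) (v : Fin n → ℕ) :
    ∃ q : Fin n → Bool → ℕ, Runs σ p (fun i => Program.exchangeNat (L i) b (v i)) (4 * b) p q ∧
      ∀ i h, Frame.IsOwn h σ p i → ∀ e, q i e = v (h.neighbor e) % 2 ^ b := by
  induction b generalizing v with
  | zero => exact ⟨fun _ _ => 0, Runs.pure p _, fun i h _ e => by simp [Nat.mod_one]⟩
  | succ b ih =>
    obtain ⟨r, hr, H⟩ := runs_exchange hn hp hL fun i => v i % 2 == 1
    obtain ⟨q, hq, H'⟩ := ih fun i => v i / 2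
    refine ⟨_, Runs.of_rounds_eq (by ring) (hr.bind (hq.bind (Runs.pure p _))),
      fun i h hi e => ?_⟩
    rw [H i h hi e, H' i h hi e, toNat_mod_two_beq_one, pow_succ', Nat.mod_mul]

theorem runs_flood (hL : AreLinks σ p L) (b j : ℕ) (v : Fin n → ℕ) (hb : ∀ i, v i < 2 ^ b) :
    ∃ a : Fin n → ℕ, Runs σ p (fun i => Program.flood (L i) b j (v i)) (4 * b * j) p a ∧
      (∀ k d : ℤ, |d| ≤ j → v (f.agent (k + d)) ≤ a (f.agent k)) ∧
      ∀ V, (∀ i, v i ≤ V) → ∀ i, a i ≤ V := by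
  induction j generalizing v with
  | zero =>
    refine ⟨v, Runs.pure p _, fun k d hd => ?_, fun V hV => hV⟩
    rw [abs_nonpos_iff.1 hd, add_zero]
  | succ j ih =>
    obtain ⟨q, hq, H⟩ := runs_exchangeNat hn hp hL b v
    have q_eq (i : Fin n) (h : Frame n) (hi : h.IsOwn σ p i) (e : Bool) :
        q i e = v (h.neighbor e) := by rw [H i h hi e, Nat.mod_eq_of_lt (hb _)]
    have max_le_of_le {V : ℕ} (hV : ∀ i, v i ≤ V) (i : Fin n) :
        max (v i) (max (q i true) (q i false)) ≤ V := by
      obtain ⟨h, hi⟩ := Frame.exists_isOwn hp σ i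
      rw [q_eq i h hi, q_eq i h hi]
      exact max_le (hV _) (max_le (hV _) (hV _))
    obtain ⟨a, ha, le_a, a_le⟩ := ih (fun i => max (v i) (max (q i true) (q i false))) fun i =>
      (Nat.lt_iff_le_pred (by positivity)).2 (max_le_of_le (fun i => Nat.le_pred_of_lt (hb i)) i)
    refine ⟨a, Runs.of_rounds_eq (by ring) (hq.bind ha), fun k d hd => ?_,
      fun V hV => a_le V (max_le_of_le hV)⟩
    obtain ⟨d', hd', hdd'⟩ := exists_abs_le_abs_sub_le_one hd
    refine le_trans ?_ (le_a k d' hd')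
    have hown := Frame.isOwn_own (σ := σ) hp (k + d')
    rw [q_eq _ _ hown, q_eq _ _ hown, show k + d = k + d' + (d - d') by ring]
    exact f.le_max_neighbor v (k + d') hdd'

end Exchange

/-! ### Finding an agent whose starting direction changes the rotation -/

section SignSum

variable {n : ℕ} {f : Frame n} {p : Fin n → UnitAddCircle} {σ : Fin n → Bool}

/-- The signed number of agents in `F`, where the sign of an agent is `1` if it calls right the
direction `g` and `-1` otherwise. -/
def signSum (σ : Fin n → Bool) (g : Bool) (F : Fin n → Bool) : ℤ :=
  ∑ i, if F i then (if σ i == g then 1 else -1) else 0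

@[simp] lemma signSum_false (g : Bool) : signSum σ g (fun _ => false) = 0 := by simp [signSum]

lemma rotationOf_not_eq_sub (g : Bool) (F : Fin n → Bool) :
    rotationOf σ g (fun i => !F i) = rotationOf σ g (fun _ => true) - 2 * signSum σ g F := by
  unfold rotationOf rotation signSum startsForward
  rw [Finset.mul_sum, ← Finset.sum_sub_distrib]
  refine Finset.sum_congr rfl fun i _ => ?_
  beta_reduce
  generalize σ i = x, F i = y
  revert x y g
  decide

lemma coe_sgn_mul_sub_eq_iff (b : Bool) (x y z : ℝ) :
    ((sgn b * (x - z) : ℝ) : UnitAddCircle) = ((sgn b * (y - z) : ℝ) : UnitAddCircle) ↔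
      (x : UnitAddCircle) = y := by
  cases b
  · rw [sgn_false, neg_one_mul, neg_one_mul, neg_sub, neg_sub, AddCircle.coe_sub,
      AddCircle.coe_sub, sub_right_inj]
  · rw [sgn_true, one_mul, one_mul, AddCircle.coe_sub, AddCircle.coe_sub, sub_left_inj]

/-- The displacement of agent `i`, to its right, in the round in which exactly the agents in `F`
start left. -/
def displacement (σ : Fin n → Bool) (p : Fin n → UnitAddCircle) (F : Fin n → Bool) (i : Fin n) :
    UnitAddCircle := ((observation σ p (fun i => !F i) i).dist : UnitAddCircle)

lemma displacement_eq_iff (hp : f.At 0 p) (F : Fin n → Bool) (i : Fin n) :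
    displacement σ p F i = displacement σ p (fun _ => false) i ↔
      (n : ℤ) ∣ 2 * signSum σ f.isCw F := by
  obtain ⟨k, rfl⟩ := f.agent_surjective i
  rw [displacement, displacement, coe_observation_dist hp, coe_observation_dist hp,
    rotationOf_not_eq_sub, rotationOf_not_eq_sub, coe_sgn_mul_sub_eq_iff, f.coe_coord_eq_iff,
    signSum_false]
  congr! 1
  ring

end SignSum

namespace Program

/-- A round and its reversal; the result is the displacement of the agent, to its right, in the
first of them, which the agent starts left if `b` and right otherwise. -/
def spin (b : Bool) : Program UnitAddCircle := do
  let o ← probe (!b)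
  return (o.dist : UnitAddCircle)

open Classical in
/-- Find a set of identifiers in the list such that the round in which the marked agents in it
start left does not have the displacement `D`. -/
def search (D : UnitAddCircle) (m : Bool) (id : ℕ) : List (ℕ → Bool) → Program (Option (ℕ → Bool))
  | [] => return none
  | F :: l => do
    let E ← spin (m && F id)
    if E = D then search D m id l else return some F

open Classical in
/-- Binary search in `[lo, hi)`, in `b` steps, for the identifier of a marked agent. -/
def bisect (D : UnitAddCircle) (m : Bool) (id : ℕ) : ℕ → ℕ → ℕ → Program ℕ
  | 0, lo, _ => return lo
  | b + 1, lo, hi => do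
    let E ← spin (m && decide (id < (lo + hi) / 2))
    if E = D then bisect D m id b ((lo + hi) / 2) hi else bisect D m id b lo ((lo + hi) / 2)

end Program

section Search

variable {n : ℕ} {f : Frame n} {p : Fin n → UnitAddCircle} {σ : Fin n → Bool}

lemma runs_spin (hp : f.At 0 p) (F : Fin n → Bool) :
    Runs σ p (fun i => Program.spin (F i)) 2 p (displacement σ p F) :=
  (Runs.probe hp fun i => !F i).map fun _ o => (o.dist : UnitAddCircle)

open Classical in
lemma runs_spin_bind_ite (hp : f.At 0 p) (F : Fin n → Bool) {α : Type} {P Q : Fin n → Program α}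
    {T : ℕ} {a : Fin n → α}
    (h : Runs σ p (if (n : ℤ) ∣ 2 * signSum σ f.isCw F then P else Q) T p a) :
    Runs σ p (fun i => Program.spin (F i) >>= fun E =>
      if E = displacement σ p (fun _ => false) i then P i else Q i) (2 + T) p a := by
  refine (runs_spin hp F).bind (k := fun i E =>
    if E = displacement σ p (fun _ => false) i then P i else Q i) ?_
  convert h using 2 with i
  simp only [displacement_eq_iff hp]
  split_ifs <;> rfl

theorem runs_search (hp : f.At 0 p) (m : Fin n → Bool) (id : Fin n → ℕ) (l : List (ℕ → Bool)) :
    ∃ T ≤ 2 * l.length, ∃ r : Option (ℕ → Bool),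
      Runs σ p (fun i => Program.search (displacement σ p (fun _ => false) i) (m i) (id i) l) T p
        (fun _ => r) ∧
      (r = none → ∀ F ∈ l, (n : ℤ) ∣ 2 * signSum σ f.isCw fun i => m i && F (id i)) ∧
      ∀ F, r = some F → ¬ (n : ℤ) ∣ 2 * signSum σ f.isCw fun i => m i && F (id i) := by
  classical
  induction l with
  | nil => exact ⟨0, le_rfl, none, Runs.pure p _, by simp, by simp⟩
  | cons F l ih =>
    obtain ⟨T, hT, r, hr, dvd_of_none, not_dvd_of_some⟩ := ih
    by_cases hd : (n : ℤ) ∣ 2 * signSum σ f.isCw fun i => m i && F (id i)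
    · refine ⟨2 + T, by rw [List.length_cons]; omega, r, runs_spin_bind_ite hp _ ?_,
        fun hnone => List.forall_mem_cons.2 ⟨hd, dvd_of_none hnone⟩, not_dvd_of_some⟩
      rwa [if_pos hd]
    · refine ⟨2 + 0, by simp, some F, runs_spin_bind_ite hp _ ?_, by simp, ?_⟩
      · rw [if_neg hd]
        exact Runs.pure p _
      · rintro _ ⟨⟩
        exact hd

theorem runs_bisect (hp : f.At 0 p) (m : Fin n → Bool) (id : Fin n → ℕ) (b lo hi : ℕ)
    (hlt : lo < hi) (hle : hi - lo ≤ 2 ^ b)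
    (hlo : (n : ℤ) ∣ 2 * signSum σ f.isCw fun i => m i && decide (id i < lo))
    (hhi : ¬ (n : ℤ) ∣ 2 * signSum σ f.isCw fun i => m i && decide (id i < hi)) :
    ∃ i, Runs σ p
      (fun j => Program.bisect (displacement σ p (fun _ => false) j) (m j) (id j) b lo hi)
      (2 * b) p (fun _ => id i) := by
  classical
  induction b generalizing lo hi with
  | zero =>
    obtain rfl : hi = lo + 1 := by rw [pow_zero] at hle; omega
    obtain ⟨i, rfl⟩ : ∃ i, id i = lo := by
      by_contra! hne
      have lt_succ_iff (i : Fin n) : id i < lo + 1 ↔ id i < lo := by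
        have := hne i
        omega
      simp only [lt_succ_iff] at hhi
      exact hhi hlo
    exact ⟨i, Runs.pure p _⟩
  | succ b ih =>
    rw [pow_succ] at hle
    have rounds_eq : 2 + 2 * b = 2 * (b + 1) := by ring
    by_cases hd : (n : ℤ) ∣ 2 * signSum σ f.isCw fun i => m i && decide (id i < (lo + hi) / 2)
    · obtain ⟨i, hrun⟩ := ih ((lo + hi) / 2) hi (by omega) (by omega) hd hhi
      refine ⟨i, Runs.of_rounds_eq rounds_eq (runs_spin_bind_ite hp _ ?_)⟩
      rwa [if_pos hd]
    · have hne : lo ≠ (lo + hi) / 2 := fun h => hd (by rwa [← h])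
      obtain ⟨i, hrun⟩ := ih lo ((lo + hi) / 2) (by omega) (by omega) hlo hd
      refine ⟨i, Runs.of_rounds_eq rounds_eq (runs_spin_bind_ite hp _ ?_)⟩
      rwa [if_neg hd]

end Search

/-! ### A family of sets that tells small signed sets from zero -/

/-- The sets of the numbers `x` such that the bit `β < b` of `x ^ e` modulo `P` is set, where
`e < m`. -/
def powerFamily (P m b : ℕ) : List (ℕ → Bool) :=
  (List.range m).flatMap fun e => (List.range b).map fun β => fun x => (x ^ e % P).testBit β

lemma length_powerFamily (P m b : ℕ) : (powerFamily P m b).length = m * b := by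
  simp [powerFamily, List.length_flatMap]

lemma testBit_mem_powerFamily {P m b e β : ℕ} (he : e < m) (hβ : β < b) :
    (fun x => (x ^ e % P).testBit β) ∈ powerFamily P m b := by
  simp only [powerFamily, List.mem_flatMap, List.mem_map, List.mem_range]
  exact ⟨e, he, β, hβ, rfl⟩

lemma sum_range_testBit {b x : ℕ} (hx : x < 2 ^ b) :
    ∑ β ∈ Finset.range b, (if x.testBit β then 2 ^ β else 0) = x := by
  rw [← Finset.sum_filter]
  convert Finset.sum_toFinset_bitIndices_two_pow x using 2
  ext β
  simp only [Finset.mem_filter, Finset.mem_range, List.mem_toFinset, Nat.mem_bitIndices,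
    and_iff_right_iff_imp]
  exact fun h => (Nat.pow_lt_pow_iff_right one_lt_two).1 ((Nat.ge_two_pow_of_testBit h).trans_lt hx)

section PowerFamily

variable {ι : Type*} {P m b : ℕ} {M : Finset ι} {id : ι → ℕ} {s : ι → ℤ}

lemma sum_mul_pow_mod_eq_zero (hP₀ : 0 < P) (hP : P ≤ 2 ^ b)
    (h : ∀ F ∈ powerFamily P m b, ∑ i ∈ M, (if F (id i) then s i else 0) = 0) {e : ℕ}
    (he : e < m) : ∑ i ∈ M, s i * ((id i ^ e % P : ℕ) : ℤ) = 0 := by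
  have binary (i : ι) : ((id i ^ e % P : ℕ) : ℤ) =
      ∑ β ∈ Finset.range b, if (id i ^ e % P).testBit β then (2 : ℤ) ^ β else 0 := by
    conv_lhs => rw [← sum_range_testBit ((Nat.mod_lt _ hP₀).trans_le hP)]
    push_cast
    rfl
  simp_rw [binary, Finset.mul_sum]
  rw [Finset.sum_comm]
  refine Finset.sum_eq_zero fun β hβ => ?_
  calc ∑ i ∈ M, s i * (if (id i ^ e % P).testBit β then (2 : ℤ) ^ β else 0)
      = ∑ i ∈ M, 2 ^ β * (if (id i ^ e % P).testBit β then s i else 0) :=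
        Finset.sum_congr rfl fun i _ => by split_ifs <;> ring
    _ = 0 := by
        rw [← Finset.mul_sum, h _ (testBit_mem_powerFamily he (Finset.mem_range.1 hβ)), mul_zero]

/-- If all sums vanish, then the signs, as elements of `ZMod P`, are in the kernel of a
Vandermonde matrix. -/
theorem exists_powerFamily_sum_ne_zero [hP : Fact P.Prime] (hPb : P ≤ 2 ^ b) (hM : M.Nonempty)
    (hm : M.card ≤ m) (hid : Set.InjOn id M) (hlt : ∀ i ∈ M, id i < P)
    (hs : ∀ i, s i = 1 ∨ s i = -1) :
    ∃ F ∈ powerFamily P m b, ∑ i ∈ M, (if F (id i) then s i else 0) ≠ 0 := by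
  by_contra! hzero
  let φ := M.equivFin.symm
  have signs_eq_zero : (fun j => (s (φ j) : ZMod P)) = 0 := by
    refine Matrix.eq_zero_of_forall_pow_sum_mul_pow_eq_zero
      (f := fun j : Fin M.card => (id (φ j) : ZMod P)) (fun j j' hj => ?_) fun e => ?_
    · have h_mod := (ZMod.natCast_eq_natCast_iff' _ _ _).1 hj
      rw [Nat.mod_eq_of_lt (hlt _ (φ j).2), Nat.mod_eq_of_lt (hlt _ (φ j').2)] at h_mod
      exact φ.injective (Subtype.ext (hid (φ j).2 (φ j').2 h_mod))
    · have hsum := congrArg (Int.cast : ℤ → ZMod P)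
        (sum_mul_pow_mod_eq_zero hP.out.pos hPb hzero (e.2.trans_le hm))
      rw [← Finset.sum_coe_sort, ← Equiv.sum_comp φ] at hsum
      push_cast [ZMod.natCast_mod] at hsum
      exact hsum
  obtain ⟨i, hi⟩ := hM
  have sign_eq_zero := congrFun signs_eq_zero (M.equivFin ⟨i, hi⟩)
  simp only [φ, Equiv.symm_apply_apply, Pi.zero_apply] at sign_eq_zero
  rcases hs i with h | h <;> rw [h] at sign_eq_zero <;> simp at sign_eq_zero

end PowerFamily

/-! ### Electing a leader -/

open Classical in
/-- Elect a leader, given the link to the neighbors: after flooding over distance `j` only local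
maxima remain, and some set of the family tells their signed number from zero. -/
def Program.elect (family : List (ℕ → Bool)) (b j : ℕ) (L : Link) (id : ℕ) :
    Program (Option ℕ) := do
  let v ← flood L b j id
  let D ← spin false
  let r ← search D (decide (v = id)) id family
  match r with
  | none => return none
  | some F => do
    let θ ← bisect D (decide (v = id) && F id) id b 0 (2 ^ b)
    return some θ

section Elect

variable {n j k b P : ℕ} {f : Frame n} {p : Fin n → UnitAddCircle} {σ : Fin n → Bool}
  {id v : Fin n → ℕ}

lemma card_localMax_mul_le (hid : Function.Injective id) (hj : j < n)
    (hv : ∀ k d : ℤ, |d| ≤ j → id (f.agent (k + d)) ≤ v (f.agent k)) :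
    (Finset.univ.filter fun i => v i = id i).card * (j + 1) ≤ n := by
  choose place agent_place using f.agent_surjective
  suffices ((Finset.univ.filter fun i => v i = id i) ×ˢ Finset.range (j + 1)).card ≤
      (Finset.univ : Finset (Fin n)).card by simpa using this
  refine Finset.card_le_card_of_injOn (fun q => f.agent (place q.1 + (q.2 : ℕ)))
    (fun _ _ => Finset.mem_coe.2 (Finset.mem_univ _)) ?_
  have id_le {i i' : Fin n} {a a' : ℕ} (h : f.agent (place i + a) = f.agent (place i' + a'))
      (ha : a < j + 1) (ha' : a' < j + 1) : id i' ≤ v i := by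
    have agent_eq : f.agent (place i + (a - a' : ℤ)) = i' := by
      rw [← agent_place i', f.agent_eq_iff]
      rw [f.agent_eq_iff] at h
      convert h using 1
      ring
    have := hv (place i) (a - a') (by rw [abs_le]; omega)
    rwa [agent_eq, agent_place] at this
  rintro ⟨i, a⟩ hia ⟨i', a'⟩ hia' h
  simp only [Finset.coe_product, Set.mem_prod, Finset.mem_coe, Finset.mem_filter,
    Finset.mem_univ, true_and, Finset.mem_range] at hia hia' h
  obtain rfl : i = i' := hid <| le_antisymm
    ((id_le h.symm hia'.2 hia.2).trans_eq hia'.1) ((id_le h hia.2 hia'.2).trans_eq hia.1)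
  rw [f.agent_eq_iff] at h
  have := Int.eq_zero_of_abs_lt_dvd h (by rw [abs_lt]; omega)
  rw [Prod.mk.injEq]
  omega

lemma exists_localMax (hn : 0 < n) (le_v : ∀ i, id i ≤ v i)
    (v_le : ∀ V, (∀ i, id i ≤ V) → ∀ i, v i ≤ V) : ∃ i, v i = id i := by
  have : Nonempty (Fin n) := ⟨⟨0, hn⟩⟩
  obtain ⟨i, hi⟩ := Finite.exists_max id
  exact ⟨i, le_antisymm (v_le _ hi i) (le_v i)⟩

lemma abs_sum_ite_le_card {ι : Type*} (M : Finset ι) (F : ι → Bool) {s : ι → ℤ}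
    (hs : ∀ i, s i = 1 ∨ s i = -1) : |∑ i ∈ M, if F i then s i else 0| ≤ M.card := by
  refine (Finset.abs_sum_le_sum_abs _ _).trans ?_
  rw [Finset.card_eq_sum_ones, Nat.cast_sum]
  refine Finset.sum_le_sum fun i _ => ?_
  rcases hs i with h | h <;> rw [h] <;> split_ifs <;> simp

lemma exists_not_dvd_signSum [Fact P.Prime] (hP : P ≤ 2 ^ b) (hid : Function.Injective id)
    (hlt : ∀ i, id i < P) (hk : 0 < k) (hkn : 2 * k + 1 ≤ n) (hnk : n ≤ 32 * k ^ 2)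
    (hmax : ∃ i, v i = id i)
    (hv : ∀ l d : ℤ, |d| ≤ (2 * k : ℕ) → id (f.agent (l + d)) ≤ v (f.agent l)) :
    ∃ F ∈ powerFamily P (16 * k) b,
      ¬ (n : ℤ) ∣ 2 * signSum σ f.isCw fun i => decide (v i = id i) && F (id i) := by
  set M : Finset (Fin n) := Finset.univ.filter fun i => v i = id i with hM
  have M_nonempty : M.Nonempty := hmax.imp fun i hi => by simpa [hM] using hi
  have card_mul_le : M.card * (2 * k + 1) ≤ n := card_localMax_mul_le hid hkn hv
  have card_le : M.card ≤ 16 * k := by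
    by_contra! hlt_card
    have := Nat.mul_le_mul_right (2 * k + 1) hlt_card
    nlinarith
  have sign (i : Fin n) : (if σ i == f.isCw then (1 : ℤ) else -1) = 1 ∨
      (if σ i == f.isCw then (1 : ℤ) else -1) = -1 := by split_ifs <;> simp
  obtain ⟨F, hF, hne⟩ := exists_powerFamily_sum_ne_zero hP M_nonempty card_le hid.injOn
    (fun i _ => hlt i) sign
  refine ⟨F, hF, fun hdvd => hne ?_⟩
  have signSum_eq : signSum σ f.isCw (fun i => decide (v i = id i) && F (id i)) =
      ∑ i ∈ M, (if F (id i) then (if σ i == f.isCw then 1 else -1) else 0) := by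
    rw [signSum, hM, Finset.sum_filter]
    refine Finset.sum_congr rfl fun i _ => ?_
    by_cases h : v i = id i <;> simp [h]
  rw [signSum_eq] at hdvd
  have abs_le := abs_sum_ite_le_card M (fun i => F (id i)) sign
  have card_mul_three_le : M.card * 3 ≤ n := (Nat.mul_le_mul_left _ (by omega)).trans card_mul_le
  have := M_nonempty.card_pos
  have := Int.eq_zero_of_abs_lt_dvd hdvd (by rw [abs_mul, abs_two]; omega)
  omega

theorem runs_elect (hn : 1 < n) (hp : f.At 0 p) {L : Fin n → Link} (hL : AreLinks σ p L)
    (hid : Function.Injective id) (hb : ∀ i, id i < 2 ^ b) [Fact P.Prime] (hP : P ≤ 2 ^ (b + 1))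
    (hlt : ∀ i, id i < P) (hk : 0 < k) (hkn : 2 * k + 1 ≤ n) :
    ∃ T ≤ 8 * b * k + 32 * k * (b + 1) + 2 * b + 2, ∃ r : Option ℕ,
      Runs σ p (fun i => Program.elect (powerFamily P (16 * k) (b + 1)) b (2 * k) (L i) (id i)) T p
        (fun _ => r) ∧
      (∀ θ, r = some θ → ∃ i, id i = θ) ∧ (n ≤ 32 * k ^ 2 → r ≠ none) := by
  classical
  obtain ⟨v, hflood, id_le_v, v_le⟩ := runs_flood hn hp hL b (2 * k) id hb
  obtain ⟨T, hT, r, hsearch, dvd_of_none, not_dvd_of_some⟩ := runs_search (σ := σ) hp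
    (fun i => decide (v i = id i)) id (powerFamily P (16 * k) (b + 1))
  rw [length_powerFamily] at hT
  have hspin := runs_spin (σ := σ) hp fun _ => false
  have id_le_v_self (i : Fin n) : id i ≤ v i := by
    obtain ⟨l, rfl⟩ := f.agent_surjective i
    simpa using id_le_v l 0 (by simp)
  have ne_none (hnk : n ≤ 32 * k ^ 2) : r ≠ none := fun hnone => by
    obtain ⟨F, hF, hndvd⟩ := exists_not_dvd_signSum (f := f) (σ := σ) hP hid hlt hk hkn hnk
      (exists_localMax (by omega) id_le_v_self v_le) id_le_v
    exact hndvd (dvd_of_none hnone F hF)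
  cases r with
  | none =>
    refine ⟨4 * b * (2 * k) + (2 + (T + 0)), by nlinarith, none, ?_, by simp,
      fun hnk => absurd rfl (ne_none hnk)⟩
    exact hflood.bind (hspin.bind (hsearch.bind (Runs.pure p _)))
  | some F =>
    obtain ⟨i, hbisect⟩ := runs_bisect (σ := σ) hp (fun i => decide (v i = id i) && F (id i)) id b
      0 (2 ^ b) (by positivity) (by simp) (by simp)
      (by simpa [hb] using not_dvd_of_some F rfl)
    refine ⟨4 * b * (2 * k) + (2 + (T + (2 * b + 0))), by nlinarith, some (id i), ?_,
      by simp, by simp⟩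
    exact hflood.bind (hspin.bind (hsearch.bind (hbisect.bind (Runs.pure p _))))

end Elect

/-! ### Agreement on the orientation of the leader -/

section Orient

variable {n : ℕ} {f h : Frame n} {p : Fin n → UnitAddCircle} {σ c c' : Fin n → Bool} {i : Fin n}

open Classical in
/-- Decide whether the leader has the same sense of direction. -/
def Program.orient (b id : ℕ) (L : Link) (isLeader : Bool) : Program Bool := do
  let o ← turn true
  let o' ← turn isLeader
  let r ← gaps b id
  let _ ← turn (!isLeader)
  let _ ← turn (!true)
  return decide ((o.dist : UnitAddCircle) + (o'.dist : UnitAddCircle) =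
    ((2 * L.halfGap true + 2 * r false : ℝ) : UnitAddCircle))

lemma rotationOf_add_rotationOf_single (g : Bool) (l : Fin n) :
    rotationOf σ g (fun _ => true) + rotationOf σ g (fun i => decide (i = l)) =
      2 * if σ l == g then 1 else -1 := by
  unfold rotationOf rotation startsForward
  rw [← Finset.sum_add_distrib, Finset.sum_eq_single l]
  · beta_reduce
    rw [decide_eq_true rfl]
    generalize σ l = x
    revert x g
    decide
  · intro i _ hi
    beta_reduce
    rw [decide_eq_false hi]
    generalize σ i = x
    revert x g
    decide
  · simp

lemma Frame.IsOwn.coe_dist_add_coe_dist (hi : h.IsOwn σ p i) :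
    ((observation σ p c i).dist : UnitAddCircle) +
        ((observation σ (roundEnd σ p c).pos c' i).dist : UnitAddCircle) =
      ((h.coord (rotationOf σ (σ i) c + rotationOf σ (σ i) c') - h.coord 0 : ℝ) :
        UnitAddCircle) := by
  obtain ⟨hg, rfl, hp⟩ := hi
  rw [coe_observation_dist hp 0, coe_observation_dist (roundEnd_at hp) 0, hg, BEq.rfl, sgn_true,
    one_mul, one_mul, ← AddCircle.coe_add]
  simp only [zero_add]
  congr 1
  ring

lemma Frame.IsOwn.rotate (hi : h.IsOwn σ p i) :
    (h.rotate (rotationOf σ (σ i) c + rotationOf σ (σ i) c')).IsOwn σ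
      (roundEnd σ (roundEnd σ p c).pos c').pos i := by
  obtain ⟨hg, hi, hp⟩ := hi
  refine ⟨hg, hi, Frame.At.rotate ?_⟩
  rw [← hg, ← zero_add (rotationOf σ h.isCw c)]
  exact roundEnd_at (roundEnd_at hp)

variable (hn : 4 < n)
include hn

lemma Frame.coe_two_mul_halfGap_add_eq_iff {s : ℤ} (hs : s = 1 ∨ s = -1) :
    ((h.coord (2 * s) - h.coord 0 : ℝ) : UnitAddCircle) =
      ((2 * h.halfGap true + 2 * (h.rotate (2 * s)).halfGap false : ℝ) : UnitAddCircle) ↔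
        s = 1 := by
  have halfGap_eq : 2 * h.halfGap true + 2 * (h.rotate (2 * s)).halfGap false =
      h.coord (2 * s) - h.coord 0 + (h.coord 1 - h.coord (-1 + 2 * s)) := by
    simp only [Frame.halfGap, Frame.rotate, if_true, Bool.false_eq_true, if_false, zero_add]
    ring
  rw [halfGap_eq, AddCircle.coe_add, left_eq_add, AddCircle.coe_sub, sub_eq_zero,
    h.coe_coord_eq_iff]
  obtain rfl | rfl := hs
  · simp
  · refine iff_of_false (fun hdvd => ?_) (by omega)
    have := Int.le_of_dvd (by norm_num) ((dvd_neg (b := (4 : ℤ))).1 (by simpa using hdvd))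
    omega

variable (hp : f.At 0 p) {L : Fin n → Link} (hL : AreLinks σ p L)
  {id : Fin n → ℕ} (hid : Function.Injective id) {b : ℕ} (hb : ∀ i, id i < 2 ^ b)
include hp hL hid hb

-- In its own orientation, the two rounds with all agents and with only the leader starting right
-- move an agent to the place `2` or `-2`, according to whether it agrees with the leader.
theorem runs_orient (l : Fin n) :
    Runs σ p (fun i => Program.orient b (id i) (L i) (decide (i = l))) (4 * (b + 2)) p
      (fun i => σ l == σ i) := by
  classical
  let p₁ := (roundEnd σ p fun _ => true).pos
  let p₂ := (roundEnd σ p₁ fun i => decide (i = l)).pos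
  have hp₁ : f.At _ p₁ := roundEnd_at hp
  have hp₂ : f.At _ p₂ := roundEnd_at hp₁
  obtain ⟨r, hr, H⟩ := runs_gaps (σ := σ) (by omega) hp₂.rotate b id
  have answer_eq (i : Fin n) : (σ l == σ i) =
      decide (((observation σ p (fun _ => true) i).dist : UnitAddCircle) +
        ((observation σ p₁ (fun i => decide (i = l)) i).dist : UnitAddCircle) =
          ((2 * (L i).halfGap true + 2 * r i false : ℝ) : UnitAddCircle)) := by
    obtain ⟨h, hi⟩ := Frame.exists_isOwn hp σ i
    have hi₂ : (h.rotate _).IsOwn σ p₂ i := hi.rotate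
    have gap_eq := (H i _ hi₂ false).2 <| Or.inr <| by
      rw [Nat.mod_eq_of_lt (hb _), Nat.mod_eq_of_lt (hb _), hid.ne_iff, ← hi₂.agent_zero]
      exact Frame.neighbor_ne (by omega) _ _
    rw [gap_eq, (hL i h hi).1, hi.coe_dist_add_coe_dist, rotationOf_add_rotationOf_single,
      Bool.eq_iff_iff, decide_eq_true_iff, Frame.coe_two_mul_halfGap_add_eq_iff hn]
    all_goals split_ifs <;> simp_all
  simp only [answer_eq]
  exact Runs.of_rounds_eq (by ring) ((Runs.turn p _).bind ((Runs.turn p₁ _).bind (hr.bind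
    ((Runs.turn_reverse (σ := σ) hp₁ _).bind ((Runs.turn_reverse hp _).bind (Runs.pure p _))))))

end Orient

/-! ### The positions of the places after the leader -/

section Window

variable {n : ℕ} {f : Frame n} {R : ℤ} {p : Fin n → UnitAddCircle} {σ c : Fin n → Bool}

namespace Frame

/-- The position of the place `m` relative to the place `a`, in the sense of direction of the agent
that is at the place `a` when all agents are in their initial positions. -/
def relPos (f : Frame n) (σ : Fin n → Bool) (a m : ℤ) : UnitAddCircle :=
  ((sgn (σ (f.agent a) == f.isCw) * (f.coord m - f.coord a) : ℝ) : UnitAddCircle)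

lemma relPos_eq_iff (a m m' : ℤ) : f.relPos σ a m = f.relPos σ a m' ↔ (n : ℤ) ∣ m - m' := by
  rw [relPos, relPos, coe_sgn_mul_sub_eq_iff, f.coe_coord_eq_iff, dvd_sub_comm]

@[simp] lemma relPos_self (a : ℤ) : f.relPos σ a a = 0 := by simp [relPos]

lemma relPos_add (a m m' : ℤ) : f.relPos σ a m +
    ((sgn (σ (f.agent a) == f.isCw) * (f.coord m' - f.coord m) : ℝ) : UnitAddCircle) =
      f.relPos σ a m' := by
  rw [relPos, relPos, ← AddCircle.coe_add]
  congr 1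
  ring

lemma halfGap_own (a : ℤ) : (f.own σ a).halfGap (!(σ (f.agent a) == f.isCw)) =
    (f.coord a - f.coord (a - 1)) / 2 := by
  unfold own
  split_ifs with hg
  · simp [halfGap, shift, hg, sub_eq_add_neg, add_comm]
  · rw [beq_false_of_ne hg]
    simp [halfGap, shift, mirror, sub_eq_add_neg, add_comm]

end Frame

/-- An agent that knows whether it agrees with the orientation `g` can start forward at will. -/
lemma startsForward_beq (g : Bool) (b : Fin n → Bool) :
    startsForward σ g (fun i => (σ i == g) == b i) = b := by
  ext i
  change ((σ i == ((σ i == g) == b i)) == g) = b i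
  generalize σ i = x, b i = y
  revert x y g
  decide

lemma rotationOf_beq (g : Bool) (b : Fin n → Bool) :
    rotationOf σ g (fun i => (σ i == g) == b i) = rotation b := by
  rw [rotationOf, startsForward_beq]

lemma exists_observation_collDist_backward (hp : f.At R p) {k : ℤ} {i : Fin n}
    (hk : startsForward σ f.isCw c (f.agent k) = false)
    (hi : startsForward σ f.isCw c i = true) :
    ∃ δ : ℤ, 0 < δ ∧ startsForward σ f.isCw c (f.agent (k - δ)) = true ∧
      (observation σ p c (f.agent k)).collDist =
        (f.coord (k + R) - f.coord (k - δ + R)) / 2 := by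
  obtain ⟨δ, hδ, h⟩ := exists_observation_collDist_forward hp.mirror (k := -k) (i := i)
    (by rw [startsForward_mirror, neg_neg, hk, Bool.not_false])
    ((startsForward_bnot _ _).trans (congrArg not hi))
  have hne := hδ.ne
  rw [startsForward_mirror, startsForward_mirror, neg_neg, hk, Bool.not_false,
    show -(-k + δ) = k - δ by ring] at hne
  refine ⟨δ, hδ.pos, by simpa using hne, ?_⟩
  simp only [Frame.mirror, neg_neg] at h
  rw [h, show -(-k + -R) = k + R by ring, show -(-k + δ + -R) = k - δ + R by ring, neg_sub_neg]

/-- The position of the place from which the first token that an agent meets has started, relative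
to the place of the agent.  The agent observes `o`; `e` says whether it agrees with the forward
direction and `b` whether it starts forward. -/
def sourcePos (e b : Bool) (o : Observation) : UnitAddCircle :=
  ((sgn e * (sgn b * (2 * o.collDist)) : ℝ) : UnitAddCircle)

lemma relPos_add_sourcePos (hp : f.At R p) {a : ℤ} {i : Fin n}
    (hi : startsForward σ f.isCw c i ≠ startsForward σ f.isCw c (f.agent a)) :
    ∃ m, startsForward σ f.isCw c (f.agent m) ≠ startsForward σ f.isCw c (f.agent a) ∧
      f.relPos σ a (a + R) + sourcePos (σ (f.agent a) == f.isCw)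
        (startsForward σ f.isCw c (f.agent a)) (observation σ p c (f.agent a)) =
          f.relPos σ a (m + R) := by
  cases ha : startsForward σ f.isCw c (f.agent a)
  · rw [ha, Bool.ne_false_iff] at hi
    obtain ⟨δ, -, hδ, h⟩ := exists_observation_collDist_backward hp ha hi
    refine ⟨a - δ, by rw [hδ]; decide, ?_⟩
    rw [← f.relPos_add a (a + R) (a - δ + R), sourcePos, h, sgn_false]
    congr 3
    ring
  · rw [ha, ne_eq, Bool.not_eq_true] at hi
    obtain ⟨δ, hδ, h⟩ := exists_observation_collDist_forward hp ha hi
    refine ⟨a + δ, ha ▸ hδ.ne, ?_⟩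
    rw [← f.relPos_add a (a + R) (a + δ + R), sourcePos, h, sgn_true]
    congr 3
    ring

/-- The position of the single agent that has started forward, relative to an agent that observes
`o`; `e` says whether the latter agrees with the forward direction, and `single` whether it is the
single agent itself. -/
def singlePos (e single : Bool) (o : Observation) : UnitAddCircle :=
  if single then 0 else sourcePos e false o

open Classical in
lemma relPos_add_singlePos (hp : f.At R p) (j a : ℤ) :
    f.relPos σ a (a + R) + singlePos (σ (f.agent a) == f.isCw) (decide (f.agent a = f.agent j))
      (observation σ p (fun i => (σ i == f.isCw) == decide (i = f.agent j)) (f.agent a)) =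
      f.relPos σ a (j + R) := by
  by_cases ha : f.agent a = f.agent j
  · rw [singlePos, decide_eq_true ha, if_pos rfl, add_zero, f.relPos_eq_iff,
      add_sub_add_right_eq_sub, ← f.agent_eq_iff, ha]
  have starts := congrFun (startsForward_beq (σ := σ) f.isCw fun i => decide (i = f.agent j))
  obtain ⟨m, hm, h⟩ := relPos_add_sourcePos (σ := σ) (a := a) (i := f.agent j)
    (c := fun i => (σ i == f.isCw) == decide (i = f.agent j)) hp
    (by simp only [starts, ha, decide_true, decide_false]; decide)
  simp only [starts, ha, decide_false, ne_eq, decide_eq_false_iff_not, not_not] at hm h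
  rw [singlePos, decide_eq_false ha, if_neg Bool.false_ne_true, h, f.relPos_eq_iff,
    add_sub_add_right_eq_sub, dvd_sub_comm, ← f.agent_eq_iff, hm]

/-- The sequence `z, P 0, P 1, …`. -/
def seqCons {α : Type*} (z : α) (P : ℕ → α) : ℕ → α
  | 0 => z
  | j + 1 => P j

open Classical in
/-- Learn the positions of the next `w` places, starting with that of the marked agent; `e` says
whether the agent agrees with the orientation of the leader and `g` is half the distance to the
agent before it.  In each step only the marked agent starts forward, and the mark then moves on to
the next agent, the one that meets it after the distance `g`. -/
def Program.window (e : Bool) (g : ℝ) : ℕ → Bool → Program (ℕ → UnitAddCircle)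
  | 0, _ => return fun _ => 0
  | w + 1, marked => do
    let o ← probe (e == marked)
    let P ← window e g w (!marked && decide (o.collDist = g))
    return seqCons (singlePos e marked o) P

variable (hn : 1 < n) (hp : f.At 0 p) {L : Fin n → Link} (hL : AreLinks σ p L)
include hn hp hL

open Classical in
lemma mark_moves_on (j : ℤ) (i : Fin n) :
    (!decide (i = f.agent j) && decide ((observation σ p
      (fun i => (σ i == f.isCw) == decide (i = f.agent j)) i).collDist =
        (L i).halfGap (!(σ i == f.isCw)))) = decide (i = f.agent (j + 1)) := by
  obtain ⟨a, rfl⟩ := f.agent_surjective i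
  by_cases ha : f.agent a = f.agent j
  · simp [ha, (f.agent_add_one_ne hn j).symm]
  have hstart := startsForward_beq (σ := σ) f.isCw fun i => decide (i = f.agent j)
  have meets := collDist_backward_eq_iff hn hp (k := a) (by rw [hstart]; exact decide_eq_false ha)
  rw [hstart, add_zero, add_zero, decide_eq_true_iff] at meets
  have previous : f.agent (a - 1) = f.agent j ↔ f.agent a = f.agent (j + 1) := by
    rw [f.agent_eq_iff, f.agent_eq_iff, show j - (a - 1) = j + 1 - a by ring]
  simp only [(hL _ _ (f.isOwn_own hp a)).1, f.halfGap_own, meets, previous, ha, decide_false,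
    Bool.not_false, Bool.true_and]

theorem runs_window (w : ℕ) (j : ℤ) :
    ∃ P : Fin n → ℕ → UnitAddCircle, Runs σ p (fun i => Program.window (σ i == f.isCw)
        ((L i).halfGap (!(σ i == f.isCw))) w (decide (i = f.agent j))) (2 * w) p P ∧
      ∀ a, ∀ k < w, P (f.agent a) k = f.relPos σ a (j + k) := by
  classical
  induction w generalizing j with
  | zero => exact ⟨fun _ _ => 0, Runs.pure p _, fun _ _ hk => absurd hk (Nat.not_lt_zero _)⟩
  | succ w ih =>
    obtain ⟨P, hP, H⟩ := ih (j + 1)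
    simp only [← mark_moves_on hn hp hL j] at hP
    refine ⟨_, Runs.of_rounds_eq (by ring) ((Runs.probe hp _).bind (hP.bind (Runs.pure p _))),
      fun a k hk => ?_⟩
    cases k with
    | zero =>
      simpa [seqCons] using relPos_add_singlePos (σ := σ) hp j a
    | succ k =>
      change P (f.agent a) k = _
      rw [H a k (by omega)]
      congr 1
      push_cast
      ring

end Window

/-! ### Walking once around the circle -/

section Walk

variable {n : ℕ} {f : Frame n} {R : ℤ} {p : Fin n → UnitAddCircle} {σ : Fin n → Bool}

namespace Frame

lemma At.of_dvd {R' : ℤ} (hp : f.At R p) (hd : (n : ℤ) ∣ R' - R) : f.At R' p := by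
  obtain ⟨m, hm⟩ := hd
  intro k
  rw [hp k, show k + R' = k + R + m * n by linarith, f.coord_add_mul]
  cases f.isCw <;> simp

end Frame

lemma sum_ite_lt {u b : ℕ} (h : u ≤ b) :
    ∑ m ∈ Finset.range b, (if m < u then (1 : ℤ) else -1) = 2 * u - b := by
  obtain ⟨v, rfl⟩ := Nat.exists_eq_add_of_le h
  rw [Finset.sum_range_add, Finset.sum_congr rfl fun m hm => if_pos (Finset.mem_range.1 hm),
    Finset.sum_congr rfl fun m _ => if_neg (show ¬ u + m < u by omega)]
  simp only [Finset.sum_const, Finset.card_range, nsmul_eq_mul, mul_one, mul_neg]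
  push_cast
  ring

lemma exists_add_mul_emod_lt {n s Q : ℕ} (hs : s ≤ n) (hQ : n ≤ s * Q) (hn : 0 < n) (a : ℤ) :
    ∃ q ≤ Q, (a + (s * q : ℕ)) % n < s := by
  have nonneg := Int.emod_nonneg a (show (n : ℤ) ≠ 0 by omega)
  have lt := Int.emod_lt_of_pos a (show (0 : ℤ) < n by omega)
  have hex : ∃ q : ℕ, (n : ℤ) ≤ a % n + (s * q : ℕ) := ⟨Q, by omega⟩
  classical
  have spec := Nat.find_spec hex
  have ne_zero : Nat.find hex ≠ 0 := fun h0 => by rw [h0, mul_zero] at spec; omega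
  have previous := Nat.find_min hex (m := Nat.find hex - 1) (by omega)
  have step : s * Nat.find hex = s * (Nat.find hex - 1) + s := by
    rw [← mul_add_one, Nat.sub_add_cancel (by omega)]
  refine ⟨Nat.find hex, Nat.find_min' hex (by omega), ?_⟩
  rw [← Int.emod_add_emod, ← Int.sub_emod_right, Int.emod_eq_of_lt (by omega) (by omega)]
  omega

open Classical in
/-- The least index below `w` at which the sequence takes the value `z`. -/
def lookup (P : ℕ → UnitAddCircle) (w : ℕ) (z : UnitAddCircle) : Option ℕ :=
  if h : ∃ j, j < w ∧ P j = z then some (Nat.find h) else none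

lemma lookup_relPos (hn : 0 < n) {a : ℤ} {P : ℕ → UnitAddCircle} {w : ℕ} (hw : w ≤ n)
    (hP : ∀ j < w, P j = f.relPos σ a j) (m : ℤ) :
    lookup P w (f.relPos σ a m) = if m % n < w then some (m % n).toNat else none := by
  have nonneg := Int.emod_nonneg m (show (n : ℤ) ≠ 0 by omega)
  have key (j : ℕ) : j < w ∧ P j = f.relPos σ a m ↔ j < w ∧ m % n = j := by
    refine and_congr_right fun hj => ?_
    rw [hP j hj, f.relPos_eq_iff, ← Int.modEq_iff_dvd, Int.ModEq,
      Int.emod_eq_of_lt (a := (j : ℤ)) (by omega) (by omega)]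
  unfold lookup
  simp only [key]
  split_ifs with h h' h'
  · rw [Option.some_inj]
    have := (Nat.find_spec h).2
    omega
  · obtain ⟨j, hj⟩ := h
    omega
  · exact absurd ⟨(m % n).toNat, by omega, by omega⟩ h
  · rfl

/-- The number of the own place: if the position `z` reached after moving on by `s` places is among
the first `w` ones, the number is inferred from it, otherwise the present value `num` is kept. -/
def updateNumber (P : ℕ → UnitAddCircle) (w s : ℕ) (z : UnitAddCircle) (num : ℤ) : ℤ :=
  (lookup P w z).elim num fun j => j - s

open Classical in
/-- Rotate by `2 * k` places in each round until the leader is back among the first `2 * k` places,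
whose positions are given by `P`.  The result consists of the number of agents and the number of
the own place modulo the number of agents, or it is `none` if the leader does not come back within
`t` rounds.  There have been `q` rounds before, which moved the agent by `pos`, and `num` is the
number of its place if one of them has shown it. -/
def Program.walk (e leader : Bool) (k : ℕ) (P : ℕ → UnitAddCircle) :
    ℕ → ℕ → UnitAddCircle → ℤ → Program (Option (ℕ × ℤ))
  | 0, _, _, _ => return none
  | t + 1, q, pos, num => do
    let o ← turn (e == decide (∃ j < k, P j = 0))
    let o' ← probe (e == leader)
    let pos' : UnitAddCircle := pos + (o.dist : UnitAddCircle)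
    let num' := updateNumber P (2 * k) (2 * k * (q + 1)) pos' num
    let r ← (lookup P (2 * k) (pos' + singlePos e leader o')).elim
      (walk e leader k P t (q + 1) pos' num')
      fun j => return some (2 * k * (q + 1) - j, num')
    let _ ← turn (!(e == decide (∃ j < k, P j = 0)))
    return r

/-- The agents know the positions of the first `2 * k` places; `q` rounds of `Program.walk` have
taken them to `p`, and `pos` and `num` are what they remember. -/
structure IsWalking (f : Frame n) (σ : Fin n → Bool) (k : ℕ) (P : Fin n → ℕ → UnitAddCircle)
    (q : ℕ) (p : Fin n → UnitAddCircle) (pos : Fin n → UnitAddCircle) (num : Fin n → ℤ) : Prop where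
  two_mul_le : 2 * k ≤ n
  place_eq : ∀ a, ∀ j < 2 * k, P (f.agent a) j = f.relPos σ a j
  at_pos : f.At (2 * k * q : ℕ) p
  pos_eq : ∀ a, pos (f.agent a) = f.relPos σ a (a + (2 * k * q : ℕ))
  num_spec : ∀ a, (n : ℤ) ∣ num (f.agent a) - a ∨
    ∀ q' ≤ q, ¬ (a + (2 * k * q' : ℕ)) % (n : ℤ) < (2 * k : ℕ)

open Classical in
/-- The directions of a round in which only the agents of the first `k` places start forward, so
that all agents move on by `2 * k` places. -/
def walkChoice (f : Frame n) (σ : Fin n → Bool) (k : ℕ) (P : Fin n → ℕ → UnitAddCircle)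
    (i : Fin n) : Bool :=
  (σ i == f.isCw) == decide (∃ j < k, P i j = 0)

namespace IsWalking

variable {k q : ℕ} {P : Fin n → ℕ → UnitAddCircle} {pos : Fin n → UnitAddCircle} {num : Fin n → ℤ}
  (h : IsWalking f σ k P q p pos num)
include h

lemma exists_place_eq_zero_iff {m : ℕ} (hm : m < n) :
    (∃ j < k, P (f.agent m) j = 0) ↔ m < k := by
  have eq_zero_iff (j : ℕ) (hj : j < k) : P (f.agent m) j = 0 ↔ j = m := by
    have := h.two_mul_le
    rw [h.place_eq m j (by omega), ← f.relPos_self (σ := σ) m, f.relPos_eq_iff]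
    refine ⟨fun hdvd => ?_, fun hj => by simp [hj]⟩
    have := Int.eq_zero_of_abs_lt_dvd hdvd (by rw [abs_lt]; omega)
    omega
  constructor
  · rintro ⟨j, hj, hP⟩
    rwa [← (eq_zero_iff j hj).1 hP]
  · exact fun hm => ⟨m, hm, (eq_zero_iff m hm).2 rfl⟩

lemma rotationOf_walkChoice : rotationOf σ f.isCw (walkChoice f σ k P) = 2 * k - n := by
  classical
  have := h.two_mul_le
  unfold walkChoice
  rw [rotationOf_beq, ← sum_ite_lt (show k ≤ n by omega), rotation, ← f.sum_agent fun i =>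
    if decide (∃ j < k, P i j = 0) = true then (1 : ℤ) else -1]
  refine Finset.sum_congr rfl fun m hm => ?_
  simp only [decide_eq_true_iff, h.exists_place_eq_zero_iff (Finset.mem_range.1 hm)]

lemma lookup_relPos (hn : 0 < n) (a m : ℤ) : lookup (P (f.agent a)) (2 * k) (f.relPos σ a m) =
    if m % n < (2 * k : ℕ) then some (m % n).toNat else none :=
  RingNetwork.lookup_relPos hn h.two_mul_le (h.place_eq a) m

lemma at_pos_succ : f.At (2 * k * (q + 1) : ℕ) (roundEnd σ p (walkChoice f σ k P)).pos :=
  (roundEnd_at h.at_pos).of_dvd ⟨1, by rw [h.rotationOf_walkChoice]; push_cast; ring⟩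

lemma pos_eq_succ (a : ℤ) : pos (f.agent a) +
    ((observation σ p (walkChoice f σ k P) (f.agent a)).dist : UnitAddCircle) =
      f.relPos σ a (a + (2 * k * (q + 1) : ℕ)) := by
  rw [h.pos_eq, coe_observation_dist h.at_pos, f.relPos_add, f.relPos_eq_iff,
    h.rotationOf_walkChoice]
  push_cast
  exact ⟨-1, by ring⟩

lemma succ (hn : 0 < n) :
    IsWalking f σ k P (q + 1) (roundEnd σ p (walkChoice f σ k P)).pos
      (fun i => pos i + ((observation σ p (walkChoice f σ k P) i).dist : UnitAddCircle))
      fun i => updateNumber (P i) (2 * k) (2 * k * (q + 1))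
        (pos i + ((observation σ p (walkChoice f σ k P) i).dist : UnitAddCircle)) (num i) := by
  refine ⟨h.two_mul_le, h.place_eq, h.at_pos_succ, h.pos_eq_succ, fun a => ?_⟩
  rw [h.pos_eq_succ, updateNumber, h.lookup_relPos hn]
  split_ifs with hlt
  · left
    rw [Option.elim_some, Int.toNat_of_nonneg (Int.emod_nonneg _ (by omega)), sub_sub,
      add_comm _ a, ← Int.modEq_iff_dvd]
    exact (Int.mod_modEq _ _).symm
  · refine (h.num_spec a).imp_right fun hnum q' hq' => ?_
    rcases hq'.eq_or_lt with rfl | hq'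
    · exact hlt
    · exact hnum q' (by omega)

lemma dvd_num_sub (hn : 0 < n) (hq : n ≤ 2 * k * q) (a : ℤ) : (n : ℤ) ∣ num (f.agent a) - a := by
  obtain ⟨q', hq', hlt⟩ := exists_add_mul_emod_lt h.two_mul_le hq hn a
  exact (h.num_spec a).resolve_right fun hnum => hnum q' hq' hlt

open Classical in
lemma lookup_leader (hn : 0 < n) (hq₀ : 0 < q) (hq : 2 * k * q < n + 2 * k) (i : Fin n) :
    lookup (P i) (2 * k) (pos i + singlePos (σ i == f.isCw) (decide (i = f.agent 0))
      (observation σ p (fun i => (σ i == f.isCw) == decide (i = f.agent 0)) i)) =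
        if n ≤ 2 * k * q then some (2 * k * q - n) else none := by
  obtain ⟨a, rfl⟩ := f.agent_surjective i
  rw [h.pos_eq, relPos_add_singlePos h.at_pos, zero_add, h.lookup_relPos hn]
  have := h.two_mul_le
  have := Nat.le_mul_of_pos_right (2 * k) hq₀
  split_ifs with hlt hle hle
  · rw [← Int.sub_emod_right, ← Nat.cast_sub hle, Int.emod_eq_of_lt (by omega) (by omega),
      Int.toNat_natCast]
  · rw [Int.emod_eq_of_lt (by omega) (by omega)] at hlt
    omega
  · rw [← Int.sub_emod_right, ← Nat.cast_sub hle, Int.emod_eq_of_lt (by omega) (by omega)] at hlt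
    omega
  · rfl

open Classical in
lemma runs_walk_succ (hn : 0 < n) (hq : 2 * k * q < n) {t T : ℕ} {r : Fin n → Option (ℕ × ℤ)}
    (hr : Runs σ (roundEnd σ p (walkChoice f σ k P)).pos
      (fun i =>
        let pos' := pos i + ((observation σ p (walkChoice f σ k P) i).dist : UnitAddCircle)
        let num' := updateNumber (P i) (2 * k) (2 * k * (q + 1)) pos' (num i)
        if n ≤ 2 * k * (q + 1) then pure (some (n, num')) else
          Program.walk (σ i == f.isCw) (decide (i = f.agent 0)) k (P i) t (q + 1) pos' num')
      T (roundEnd σ p (walkChoice f σ k P)).pos r) :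
    Runs σ p (fun i => Program.walk (σ i == f.isCw) (decide (i = f.agent 0)) k (P i) (t + 1) q
      (pos i) (num i)) (T + 4) p r := by
  have h' := h.succ hn
  have lookup_eq := h'.lookup_leader hn q.succ_pos (by rw [mul_add_one]; omega)
  refine Runs.of_rounds_eq (by ring) ((Runs.turn p (walkChoice f σ k P)).bind
    ((Runs.probe h'.at_pos fun i => (σ i == f.isCw) == decide (i = f.agent 0)).bind
      (Runs.bind (T := T) (a := r) ?_ ((Runs.turn_reverse h.at_pos _).map fun i _ => r i))))
  simp only [lookup_eq]
  convert hr using 2 with i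
  · split_ifs with hle
    · simp only [Option.elim_some, Nat.sub_sub_self hle]
    · rfl
  · rfl

end IsWalking

theorem runs_walk (hn : 0 < n) {k q : ℕ} {P : Fin n → ℕ → UnitAddCircle}
    {pos : Fin n → UnitAddCircle} {num : Fin n → ℤ} (h : IsWalking f σ k P q p pos num)
    (hq : 2 * k * q < n) (t : ℕ) :
    ∃ T ≤ 4 * t, ∃ r : Fin n → Option (ℕ × ℤ),
      Runs σ p (fun i => Program.walk (σ i == f.isCw) (decide (i = f.agent 0)) k (P i) t q (pos i)
        (num i)) T p r ∧
      ((r = fun _ => none) ∧ 2 * k * (q + t) < n ∨ ∃ num' : Fin n → ℤ,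
        (r = fun i => some (n, num' i)) ∧ n ≤ 2 * k * (q + t) ∧
          ∀ a, (n : ℤ) ∣ num' (f.agent a) - a) := by
  induction t generalizing q p pos num with
  | zero => exact ⟨0, le_rfl, _, Runs.pure p _, Or.inl ⟨rfl, by simpa using hq⟩⟩
  | succ t ih =>
    have h' := h.succ hn
    by_cases hle : n ≤ 2 * k * (q + 1)
    · refine ⟨0 + 4, by omega, _, h.runs_walk_succ hn hq ?_, Or.inr
        ⟨fun i => updateNumber (P i) (2 * k) (2 * k * (q + 1))
          (pos i + ((observation σ p (walkChoice f σ k P) i).dist : UnitAddCircle)) (num i), rfl,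
          hle.trans (Nat.mul_le_mul_left _ (by omega)), h'.dvd_num_sub hn hle⟩⟩
      simp only [if_pos hle]
      exact Runs.pure _ _
    · obtain ⟨T, hT, r, hr, H⟩ := ih h' (by omega)
      refine ⟨T + 4, by omega, r, h.runs_walk_succ hn hq ?_, ?_⟩
      · simpa only [if_neg hle] using hr
      · rwa [add_right_comm, add_assoc] at H

end Walk

/-! ### The final sweep -/

section Sweep

variable {n B : ℕ} {f : Frame n} {R r : ℤ} {p : Fin n → UnitAddCircle} {σ : Fin n → Bool}
  {num : Fin n → ℤ} {S : ℕ → ℤ}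

/-- The place with which the place `m` is paired, relative to `m`, when the places from `B` on are
divided into pairs of neighbors. -/
def pairStep (B : ℕ) (m : ℤ) : ℤ := if Even (m - B) then 1 else -1

lemma even_add_pairStep_sub_iff (m : ℤ) : Even (m + pairStep B m - B) ↔ ¬ Even (m - B) := by
  rw [add_sub_right_comm, Int.even_add, pairStep]
  split_ifs with he <;> simp [he]

lemma pairStep_add_pairStep (m : ℤ) : pairStep B (m + pairStep B m) = -pairStep B m := by
  change (if Even (m + pairStep B m - B) then (1 : ℤ) else -1) = -(if Even (m - B) then 1 else -1)
  simp only [even_add_pairStep_sub_iff, ite_not]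
  split_ifs <;> rfl

lemma add_pairStep_mem (hB : Even (n - B)) {m : ℤ} (hm : B ≤ m) (hmn : m < n) :
    B ≤ m + pairStep B m ∧ m + pairStep B m < n := by
  obtain ⟨d, hd⟩ := hB
  rw [pairStep]
  split_ifs with he
  · obtain ⟨u, hu⟩ := he
    omega
  · obtain ⟨u, hu⟩ := Int.not_even_iff_odd.1 he
    omega

/-- Whether the agent at the place `m` starts forward when all agents are to rotate by `r` places:
the first `B` places realize the rotation, and the others form pairs that move towards each
other. -/
def sweepForward (B : ℕ) (r m : ℤ) : Bool :=
  if m < B then decide (2 * m < B + r) else decide (Even (m - B))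

lemma sweepForward_of_lt {m : ℤ} (h : m < B) : sweepForward B r m = decide (2 * m < B + r) :=
  if_pos h

lemma sweepForward_of_le {m : ℤ} (h : B ≤ m) : sweepForward B r m = decide (Even (m - B)) :=
  if_neg h.not_gt

lemma sweepForward_add_pairStep (hB : Even (n - B)) {m : ℤ} (hm : B ≤ m) (hmn : m < n) :
    sweepForward B r ((m + pairStep B m) % n) = !sweepForward B r m := by
  obtain ⟨le_partner, partner_lt⟩ := add_pairStep_mem hB hm hmn
  rw [Int.emod_eq_of_lt (by omega) partner_lt, sweepForward_of_le le_partner,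
    sweepForward_of_le hm, ← decide_not]
  exact decide_eq_decide.2 (even_add_pairStep_sub_iff m)

lemma sum_range_ite_even (d : ℕ) :
    ∑ m ∈ Finset.range (2 * d), (if Even m then (1 : ℤ) else -1) = 0 := by
  induction d with
  | zero => rfl
  | succ d ih => rw [mul_add_one, Finset.sum_range_succ, Finset.sum_range_succ, ih]; simp

lemma sum_sweepForward (hBn : B ≤ n) (hB : Even (n - B)) (hr : |r| ≤ B) (hr' : Even (r - B)) :
    ∑ m ∈ Finset.range n, (if sweepForward B r (m : ℕ) = true then (1 : ℤ) else -1) = r := by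
  obtain ⟨d, hd⟩ := hB
  obtain ⟨u, hu⟩ := hr'
  obtain rfl : n = B + 2 * d := by omega
  rw [abs_le] at hr
  have block (m : ℕ) (hm : m ∈ Finset.range B) :
      sweepForward B r (m : ℕ) = true ↔ m < (B + u).toNat := by
    have := Finset.mem_range.1 hm
    rw [sweepForward_of_lt (by omega), decide_eq_true_iff]
    omega
  have pairs (m : ℕ) : sweepForward B r (B + m : ℕ) = true ↔ Even m := by
    rw [sweepForward_of_le (by omega), decide_eq_true_iff, Nat.cast_add, add_sub_cancel_left,
      Int.even_coe_nat]
  rw [Finset.sum_range_add]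
  simp only [pairs]
  rw [sum_range_ite_even, add_zero,
    Finset.sum_congr rfl fun m hm => if_congr (block m hm) rfl rfl, sum_ite_lt (by omega)]
  omega

/-- The directions of a round of the sweep in which all agents rotate by `r` places, when they have
rotated by `R` places before; `num` are the numbers of the places of the agents. -/
def sweepChoice (f : Frame n) (σ : Fin n → Bool) (B : ℕ) (num : Fin n → ℤ) (r R : ℤ) (i : Fin n) :
    Bool :=
  (σ i == f.isCw) == sweepForward B r ((num i + R) % n)

lemma startsForward_sweepChoice (i : Fin n) :
    startsForward σ f.isCw (sweepChoice f σ B num r R) i = sweepForward B r ((num i + R) % n) :=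
  congrFun (startsForward_beq f.isCw fun i => sweepForward B r ((num i + R) % n)) i

section SweepChoice

variable (hnum : ∀ a, (n : ℤ) ∣ num (f.agent a) - a)
include hnum

lemma num_add_emod (a : ℤ) : (num (f.agent a) + R) % n = (a + R) % n :=
  (Int.modEq_iff_dvd.2 (hnum a)).symm.add_right R

lemma rotationOf_sweepChoice (hBn : B ≤ n) (hB : Even (n - B)) (hr : |r| ≤ B)
    (hr' : Even (r - B)) : rotationOf σ f.isCw (sweepChoice f σ B num r R) = r := by
  refine Eq.trans ?_ (sum_sweepForward hBn hB hr hr')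
  rw [rotationOf, rotation, ← (f.shift (-R)).sum_agent]
  refine Finset.sum_congr rfl fun m hm => ?_
  have := Finset.mem_range.1 hm
  change (if startsForward _ _ _ (f.agent (m + -R)) = true then (1 : ℤ) else -1) = _
  rw [startsForward_sweepChoice, num_add_emod hnum, neg_add_cancel_right,
    Int.emod_eq_of_lt (by omega) (by omega)]

end SweepChoice

lemma exists_relPos_eq_add_sourcePos (hp : f.At R p) (c : Fin n → Bool) (a : ℤ) :
    ∃ m, f.relPos σ a (a + R) + sourcePos (σ (f.agent a) == f.isCw)
      (startsForward σ f.isCw c (f.agent a)) (observation σ p c (f.agent a)) = f.relPos σ a m := by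
  by_cases h : ∀ i, startsForward σ f.isCw c i = startsForward σ f.isCw c (f.agent a)
  · refine ⟨a + R, add_eq_left.2 ?_⟩
    rw [sourcePos, Observation.collDist,
      observation_coll_eq_none hp fun i j => (h i).trans (h j).symm, Option.getD_none]
    have two_eq_zero : ((2 : ℝ) : UnitAddCircle) = 0 :=
      (AddCircle.coe_eq_zero_iff 1).2 ⟨2, by norm_num⟩
    cases (σ (f.agent a) == f.isCw) <;> cases startsForward σ f.isCw c (f.agent a) <;>
      simp only [sgn_true, sgn_false, one_mul, mul_one, neg_one_mul, neg_neg, AddCircle.coe_neg,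
        two_eq_zero, neg_zero]
  · push Not at h
    obtain ⟨i, hi⟩ := h
    obtain ⟨m, -, h⟩ := relPos_add_sourcePos hp hi
    exact ⟨_, h⟩

lemma relPos_add_sourcePos_neighbor (hn : 1 < n) (hp : f.At R p) {c : Fin n → Bool} {a : ℤ}
    (ha : startsForward σ f.isCw c
      (f.agent (a + if startsForward σ f.isCw c (f.agent a) then 1 else -1)) =
        !startsForward σ f.isCw c (f.agent a)) :
    f.relPos σ a (a + R) + sourcePos (σ (f.agent a) == f.isCw)
      (startsForward σ f.isCw c (f.agent a)) (observation σ p c (f.agent a)) =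
        f.relPos σ a (a + R + if startsForward σ f.isCw c (f.agent a) then 1 else -1) := by
  rw [add_right_comm]
  cases hstart : startsForward σ f.isCw c (f.agent a)
  · rw [hstart, if_neg Bool.false_ne_true, ← sub_eq_add_neg] at ha
    rw [if_neg Bool.false_ne_true, ← f.relPos_add a (a + R) (a + -1 + R), sourcePos,
      (collDist_backward_eq_iff hn hp hstart).2 ha, sgn_false, ← sub_eq_add_neg]
    congr 3
    ring
  · rw [hstart, if_pos rfl] at ha
    rw [if_pos rfl, ← f.relPos_add a (a + R) (a + 1 + R), sourcePos,
      (collDist_forward_eq_iff hn hp hstart).2 ha, sgn_true]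
    congr 3
    ring

lemma relPos_add_sourcePos_sweepChoice (hnum : ∀ a, (n : ℤ) ∣ num (f.agent a) - a)
    (hn : 1 < n) (hp : f.At R p) (hB : Even (n - B)) {a : ℤ} (ha : B ≤ (a + R) % n) :
    f.relPos σ a (a + R) + sourcePos (σ (f.agent a) == f.isCw)
      (sweepForward B r ((num (f.agent a) + R) % n))
      (observation σ p (sweepChoice f σ B num r R) (f.agent a)) =
        f.relPos σ a (a + R + pairStep B ((a + R) % n)) := by
  have pairStep_eq : pairStep B ((a + R) % n) =
      if sweepForward B r ((a + R) % n) = true then 1 else -1 := by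
    simp only [sweepForward_of_le ha, decide_eq_true_iff, pairStep]
  have opposite := sweepForward_add_pairStep (r := r) hB ha (Int.emod_lt_of_pos _ (by omega))
  rw [Int.emod_add_emod, add_right_comm] at opposite
  have met := relPos_add_sourcePos_neighbor (σ := σ) (c := sweepChoice f σ B num r R) (a := a) hn hp
  simp only [startsForward_sweepChoice, num_add_emod hnum, ← pairStep_eq] at met ⊢
  exact met opposite

/-- Rotate by the numbers of places prescribed by `S`, which counts the places from the start; the
result is the set of positions that have been visited or seen.  There have been `t` rounds before,
which moved the agent by `pos`, and `num` is the number of its place. -/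
def Program.sweep (e : Bool) (n B : ℕ) (num : ℤ) (S : ℕ → ℤ) :
    ℕ → ℕ → UnitAddCircle → Program (Set UnitAddCircle)
  | 0, _, _ => return ∅
  | s + 1, t, pos => do
    let b := sweepForward B (S (t + 1) - S t) ((num + S t) % n)
    let o ← turn (e == b)
    let K ← sweep e n B num S s (t + 1) (pos + (o.dist : UnitAddCircle))
    return insert pos (insert (pos + sourcePos e b o) K)

/-- A sequence of rotations that the first `B` of `n` places can realize while the others are
paired. -/
structure IsSweepPlan (n B : ℕ) (S : ℕ → ℤ) : Prop where
  le : B ≤ n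
  even_sub : Even (n - B)
  abs_le : ∀ t, |S (t + 1) - S t| ≤ B
  even_step : ∀ t, Even (S (t + 1) - S t - B)

theorem runs_sweep (hn : 1 < n) (hS : IsSweepPlan n B S)
    (hnum : ∀ a, (n : ℤ) ∣ num (f.agent a) - a) (s t : ℕ) (hp : f.At (S t) p)
    (pos : Fin n → UnitAddCircle) (hpos : ∀ a, pos (f.agent a) = f.relPos σ a (a + S t)) :
    ∃ p' K, Runs σ p (fun i => Program.sweep (σ i == f.isCw) n B (num i) S s t (pos i)) s p' K ∧
      ∀ a, (∀ z ∈ K (f.agent a), ∃ m, z = f.relPos σ a m) ∧ ∀ t', t ≤ t' → t' < t + s →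
        f.relPos σ a (a + S t') ∈ K (f.agent a) ∧ (B ≤ (a + S t') % n →
          f.relPos σ a (a + S t' + pairStep B ((a + S t') % n)) ∈ K (f.agent a)) := by
  induction s generalizing t p pos with
  | zero => exact ⟨p, _, Runs.pure p _, fun a => ⟨by simp, fun t' h h' => by omega⟩⟩
  | succ s ih =>
    set c := sweepChoice f σ B num (S (t + 1) - S t) (S t)
    have rotates : rotationOf σ f.isCw c = S (t + 1) - S t :=
      rotationOf_sweepChoice hnum hS.le hS.even_sub (hS.abs_le t) (hS.even_step t)
    obtain ⟨p', K, hK, H⟩ := ih (t + 1) (p := (roundEnd σ p c).pos)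
      (by simpa only [rotates, add_sub_cancel] using roundEnd_at (σ := σ) (c := c) hp)
      (fun i => pos i + ((observation σ p c i).dist : UnitAddCircle)) fun a => by
        rw [hpos, coe_observation_dist hp, f.relPos_add, rotates, add_assoc, add_sub_cancel]
    refine ⟨p', _, Runs.of_rounds_eq (by ring) ((Runs.turn p c).bind (hK.bind (Runs.pure p' _))),
      fun a => ⟨?_, fun t' ht ht' => ?_⟩⟩
    · rintro z (rfl | rfl | hz)
      · exact ⟨_, hpos a⟩
      · rw [hpos, ← startsForward_sweepChoice (σ := σ)]
        exact exists_relPos_eq_add_sourcePos hp c a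
      · exact (H a).1 z hz
    · rcases ht.eq_or_lt with rfl | hlt
      · refine ⟨Or.inl (hpos a).symm, fun hB => Or.inr (Or.inl ?_)⟩
        rw [hpos]
        exact (relPos_add_sourcePos_sweepChoice hnum hn hp hS.even_sub hB).symm
      · obtain ⟨visited, seen⟩ := (H a).2 t' hlt (by omega)
        exact ⟨Or.inr (Or.inr visited), fun hB => Or.inr (Or.inr (seen hB))⟩

end Sweep

/-! ### Locating all agents -/

section Locate

variable {n k : ℕ} {f : Frame n} {p : Fin n → UnitAddCircle} {σ : Fin n → Bool}

/-- The number of places that realize the rotations of the sweep. -/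
def sweepBlock (n k : ℕ) : ℕ := if Even n then 2 else 2 * k - 1

/-- The number of places by which the agents have rotated after `t` rounds of the sweep. For odd `n`
the agents rotate forward by `2 * k - 1` places in every other round, and between these rounds they
return by `2 * k - 3` places, except in every `k`-th of these rounds, where they advance by one
place. -/
def sweepShift (n k t : ℕ) : ℤ :=
  if Even n then 2 * t
  else 2 * (t / 2 : ℕ) + (2 * k - 2) * (t / 2 / k : ℕ) + (2 * k - 1) * (t % 2 : ℕ)

/-- The number of rounds of the sweep. -/
def sweepTime (n k : ℕ) : ℕ := if Even n then n / 2 else 2 * k * (n / (2 * k - 1) / 2 + 1)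

lemma sweepShift_zero (n k : ℕ) : sweepShift n k 0 = 0 := by simp [sweepShift]

lemma sweepShift_succ_of_odd (hn : ¬ Even n) (t : ℕ) :
    sweepShift n k (t + 1) - sweepShift n k t =
      if Even t then (2 * k - 1 : ℤ) else if k ∣ t / 2 + 1 then 1 else 3 - 2 * k := by
  rw [sweepShift, sweepShift, if_neg hn, if_neg hn]
  obtain ⟨u, rfl | rfl⟩ := t.even_or_odd'
  · rw [if_pos (even_two_mul u), show (2 * u + 1) / 2 = u by omega,
      show (2 * u + 1) % 2 = 1 by omega, show 2 * u / 2 = u by omega,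
      show 2 * u % 2 = 0 by omega]
    push_cast
    ring
  · rw [if_neg (Nat.not_even_bit1 u), show (2 * u + 1 + 1) / 2 = u + 1 by omega,
      show (2 * u + 1 + 1) % 2 = 0 by omega, show (2 * u + 1) / 2 = u by omega,
      show (2 * u + 1) % 2 = 1 by omega, Nat.succ_div]
    split_ifs <;> push_cast <;> ring

theorem isSweepPlan_sweepShift (hk : 0 < k) (hkn : 2 * k + 1 ≤ n) :
    IsSweepPlan n (sweepBlock n k) (sweepShift n k) := by
  by_cases hn : Even n
  · have block_eq : sweepBlock n k = 2 := if_pos hn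
    have step_eq (t : ℕ) : sweepShift n k (t + 1) - sweepShift n k t = 2 := by
      rw [sweepShift, sweepShift, if_pos hn, if_pos hn]
      push_cast
      ring
    simp only [block_eq]
    exact ⟨by omega, (Nat.even_sub (by omega)).2 (by simp [hn]), fun t => by simp [step_eq],
      fun t => by simp [step_eq]⟩
  · have block_eq : sweepBlock n k = 2 * k - 1 := if_neg hn
    obtain ⟨d, hd⟩ := Nat.not_even_iff_odd.1 hn
    have cast_block : ((2 * k - 1 : ℕ) : ℤ) = 2 * k - 1 := by omega
    rw [block_eq]
    refine ⟨by omega, ⟨d + 1 - k, by omega⟩, fun t => ?_, fun t => ?_⟩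
    · rw [sweepShift_succ_of_odd hn, cast_block, abs_le]
      split_ifs <;> omega
    · rw [sweepShift_succ_of_odd hn, cast_block, Int.even_iff]
      split_ifs <;> omega

lemma exists_sweepShift_of_even (hn : Even n) (hn0 : 0 < n) (y : ℤ) :
    ∃ t < sweepTime n k,
      (n : ℤ) ∣ sweepShift n k t - y ∨ (n : ℤ) ∣ sweepShift n k t - (y + 1) := by
  have time_eq : sweepTime n k = n / 2 := if_pos hn
  have shift_eq (t : ℕ) : sweepShift n k t = 2 * t := if_pos hn
  obtain ⟨d, rfl⟩ := hn
  have nonneg := Int.emod_nonneg ((y + 1) / 2) (show (d : ℤ) ≠ 0 by omega)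
  have lt := Int.emod_lt_of_pos ((y + 1) / 2) (show (0 : ℤ) < d by omega)
  obtain ⟨c, hc⟩ := Int.dvd_self_sub_emod (x := (y + 1) / 2) (m := d)
  refine ⟨((y + 1) / 2 % d).toNat, by omega, ?_⟩
  rw [shift_eq, Int.toNat_of_nonneg nonneg]
  refine (Int.even_or_odd y).imp (fun hy => ⟨-c, ?_⟩) fun hy => ⟨-c, ?_⟩ <;>
  · obtain ⟨u, rfl⟩ := hy
    push_cast
    rw [mul_neg, add_mul]
    omega

lemma sweepShift_of_odd (hn : ¬ Even n) {w : ℕ} (hw : w < k) (s : ℕ) :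
    sweepShift n k (2 * (k * (s / 2) + w) + s % 2) = (2 * k - 1) * s + 2 * w := by
  have s_eq : (s : ℤ) = 2 * (s / 2 : ℕ) + (s % 2 : ℕ) := by omega
  rw [sweepShift, if_neg hn, show (2 * (k * (s / 2) + w) + s % 2) / 2 = k * (s / 2) + w by omega,
    show (2 * (k * (s / 2) + w) + s % 2) % 2 = s % 2 by omega, Nat.mul_add_div (by omega),
    Nat.div_eq_of_lt hw, add_zero, s_eq]
  push_cast
  ring

lemma exists_sweepShift_of_odd (hn : ¬ Even n) (hk : 0 < k) (y : ℤ) :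
    ∃ t < sweepTime n k,
      (n : ℤ) ∣ sweepShift n k t - y ∨ (n : ℤ) ∣ sweepShift n k t - (y + 1) := by
  have time_eq : sweepTime n k = 2 * k * (n / (2 * k - 1) / 2 + 1) := if_neg hn
  have hn0 : 0 < n := Nat.pos_of_ne_zero fun h => hn (h ▸ Even.zero)
  have nonneg := Int.emod_nonneg y (show (n : ℤ) ≠ 0 by omega)
  have lt := Int.emod_lt_of_pos y (show (0 : ℤ) < n by omega)
  obtain ⟨c, hc⟩ := Int.dvd_self_sub_emod (x := y) (m := n)
  set z := (y % n).toNat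
  set s := z / (2 * k - 1)
  set x := z % (2 * k - 1)
  have z_eq : (2 * k - 1 : ℤ) * s + x = z := by
    have div_add_mod : (2 * k - 1) * s + x = z := Nat.div_add_mod z _
    rw [← div_add_mod]
    push_cast [show 1 ≤ 2 * k by omega]
    rfl
  have x_lt : x < 2 * k - 1 := Nat.mod_lt _ (by omega)
  have s_le : k * (s / 2) ≤ k * (n / (2 * k - 1) / 2) :=
    Nat.mul_le_mul_left _ (Nat.div_le_div_right (Nat.div_le_div_right (by omega)))
  refine ⟨2 * (k * (s / 2) + (x + 1) / 2) + s % 2, ?_, ?_⟩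
  · rw [time_eq, mul_assoc, mul_add_one]
    omega
  · rw [sweepShift_of_odd hn (by omega)]
    refine x.even_or_odd.imp (fun hx => ⟨-c, ?_⟩) fun hx => ⟨-c, ?_⟩ <;>
    · obtain ⟨u, hu⟩ := hx
      rw [mul_neg]
      omega

theorem exists_sweepShift (hn : 0 < n) (hk : 0 < k) (y : ℤ) :
    ∃ t < sweepTime n k,
      (n : ℤ) ∣ sweepShift n k t - y ∨ (n : ℤ) ∣ sweepShift n k t - (y + 1) :=
  if he : Even n then exists_sweepShift_of_even he hn y else exists_sweepShift_of_odd he hk y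

lemma sweepTime_le (hk : 0 < k) (hn : n ≤ 32 * k ^ 2) : 2 * sweepTime n k ≤ n + 36 * k := by
  unfold sweepTime
  split_ifs with h
  · omega
  · obtain ⟨j, rfl⟩ := Nat.exists_eq_add_of_le' hk
    rw [show 2 * (j + 1) - 1 = 2 * j + 1 by omega]
    have div_mul_le := Nat.div_mul_le_self n (2 * j + 1)
    have half_le := Nat.div_mul_le_self (n / (2 * j + 1)) 2
    set m := n / (2 * j + 1)
    have m_le : m ≤ 32 * (j + 1) := by
      by_contra! hc
      nlinarith [Nat.mul_le_mul_right (2 * j + 1) hc]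
    nlinarith

variable {B : ℕ} {S : ℕ → ℤ} {T : ℕ} {a : ℤ} {K : Set UnitAddCircle}

lemma relPos_mem_of_visits (hB : Even (n - B))
    (hS : ∀ y, ∃ t < T, (n : ℤ) ∣ a + S t - y ∨ (n : ℤ) ∣ a + S t - (y + 1))
    (visited : ∀ t < T, f.relPos σ a (a + S t) ∈ K)
    (seen : ∀ t < T, B ≤ (a + S t) % n →
      f.relPos σ a (a + S t + pairStep B ((a + S t) % n)) ∈ K)
    {m : ℤ} (hm : B ≤ m) (hmn : m < n) : f.relPos σ a m ∈ K := by
  obtain ⟨le_partner, partner_lt⟩ := add_pairStep_mem hB hm hmn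
  have visits : ∃ t < T, (n : ℤ) ∣ a + S t - m ∨ (n : ℤ) ∣ a + S t - (m + pairStep B m) := by
    rw [pairStep]
    split_ifs
    · exact hS m
    · simpa only [sub_add_cancel, ← sub_eq_add_neg, or_comm] using hS (m - 1)
  obtain ⟨t, ht, visits_self | visits_partner⟩ := visits
  · rw [(f.relPos_eq_iff a m (a + S t)).2 ((dvd_sub_comm).1 visits_self)]
    exact visited t ht
  · have place_eq : (a + S t) % n = m + pairStep B m := by
      rw [← Int.emod_eq_of_lt (by omega : 0 ≤ m + pairStep B m) partner_lt]
      exact (Int.modEq_iff_dvd.2 visits_partner).symm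
    have mem := seen t ht (place_eq ▸ le_partner)
    rw [place_eq, pairStep_add_pairStep, ← sub_eq_add_neg] at mem
    convert mem using 1
    rwa [f.relPos_eq_iff, dvd_sub_comm, sub_right_comm, sub_sub]

/-- The positions of the agents other than `i`, given by their distances from the agent `i` in its
own clockwise direction. -/
def otherDistances (σ : Fin n → Bool) (p : Fin n → UnitAddCircle) (i : Fin n) : Set ℝ :=
  {x | ∃ j, j ≠ i ∧ x = rightDist (σ i) (p i) (p j)}

/-- The distances in the own clockwise direction to the points of `K` other than the own
position, which is `0`. -/
def nonzeroDistances (K : Set UnitAddCircle) : Set ℝ :=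
  (fun z => (AddCircle.equivIco (1 : ℝ) 0 z : ℝ)) '' (K \ {0})

lemma rightDist_eq_relPos (hp : f.At 0 p) (a m : ℤ) :
    rightDist (σ (f.agent a)) (p (f.agent a)) (p (f.agent m)) =
      (AddCircle.equivIco (1 : ℝ) 0 (f.relPos σ a m) : ℝ) := by
  unfold rightDist cwArc Frame.relPos
  rw [hp, hp, add_zero, add_zero, ← AddCircle.coe_sub, ← AddCircle.coe_sub, ← mul_sub, ← mul_sub,
    sgn_beq]
  cases σ (f.agent a)
  · rw [sgn_false, if_neg Bool.false_ne_true, ← neg_sub (f.coord m), mul_neg, neg_one_mul, neg_mul]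
  · rw [sgn_true, if_pos rfl, one_mul]

lemma nonzeroDistances_range_relPos (hp : f.At 0 p) (a : ℤ) :
    nonzeroDistances (Set.range (f.relPos σ a)) = otherDistances σ p (f.agent a) := by
  have relPos_eq_zero_iff (m : ℤ) : f.relPos σ a m = 0 ↔ f.agent m = f.agent a := by
    rw [← f.relPos_self (σ := σ) a, f.relPos_eq_iff, f.agent_eq_iff, dvd_sub_comm]
  ext x
  constructor
  · rintro ⟨_, ⟨⟨m, rfl⟩, hm⟩, rfl⟩
    exact ⟨f.agent m, mt (relPos_eq_zero_iff m).2 hm, (rightDist_eq_relPos hp a m).symm⟩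
  · rintro ⟨j, hj, rfl⟩
    obtain ⟨m, rfl⟩ := f.agent_surjective j
    exact ⟨_, ⟨⟨m, rfl⟩, mt (relPos_eq_zero_iff m).1 hj⟩, (rightDist_eq_relPos hp a m).symm⟩

lemma range_relPos_subset (hn : 0 < n) {P : ℕ → UnitAddCircle} {w : ℕ}
    (hP : ∀ j < w, P j = f.relPos σ a j)
    (hK : ∀ m : ℤ, w ≤ m → m < n → f.relPos σ a m ∈ K) :
    Set.range (f.relPos σ a) ⊆ K ∪ P '' Set.Iio w := by
  rintro _ ⟨m, rfl⟩
  have nonneg := Int.emod_nonneg m (show (n : ℤ) ≠ 0 by omega)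
  have lt := Int.emod_lt_of_pos m (show (0 : ℤ) < n by omega)
  rw [(f.relPos_eq_iff a m (m % n)).2 Int.dvd_self_sub_emod]
  by_cases hm : m % n < w
  · exact Or.inr ⟨(m % n).toNat, Set.mem_Iio.2 (by omega),
      by rw [hP _ (by omega), Int.toNat_of_nonneg nonneg]⟩
  · exact Or.inl (hK _ (not_lt.1 hm) lt)

/-- Sweep the circle; `P` are the positions of the first `2 * k` places and `num` is the number of
the own place. -/
def Program.locate (e : Bool) (k : ℕ) (P : ℕ → UnitAddCircle) (n : ℕ) (num : ℤ) :
    Program (Set ℝ) := do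
  let K ← sweep e n (sweepBlock n k) num (sweepShift n k) (sweepTime n k) 0 0
  return nonzeroDistances (K ∪ P '' Set.Iio (2 * k))

theorem runs_locate (hp : f.At 0 p) (hk : 0 < k) (hkn : 2 * k + 1 ≤ n)
    {P : Fin n → ℕ → UnitAddCircle} (hP : ∀ a, ∀ j < 2 * k, P (f.agent a) j = f.relPos σ a j)
    {num : Fin n → ℤ} (hnum : ∀ a, (n : ℤ) ∣ num (f.agent a) - a) :
    ∃ p', Runs σ p (fun i => Program.locate (σ i == f.isCw) k (P i) n (num i)) (sweepTime n k) p'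
      (otherDistances σ p) := by
  have plan := isSweepPlan_sweepShift hk hkn
  have block_le : sweepBlock n k ≤ 2 * k := by unfold sweepBlock; split_ifs <;> omega
  obtain ⟨p', K, hK, H⟩ := runs_sweep (σ := σ) (by omega) plan hnum (sweepTime n k) 0
    (by rwa [sweepShift_zero]) 0 (by simp [sweepShift_zero])
  refine ⟨p', Runs.of_rounds_eq (add_zero _) (hK.bind ?_)⟩
  convert Runs.pure p' _ using 1
  funext i
  obtain ⟨a, rfl⟩ := f.agent_surjective i
  rw [← nonzeroDistances_range_relPos hp]
  congr 1
  refine Set.Subset.antisymm ?_ (Set.union_subset (fun z hz => ?_) ?_)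
  · refine range_relPos_subset (by omega) (hP a) fun m hm hmn =>
      relPos_mem_of_visits (T := sweepTime n k) plan.even_sub (fun y => ?_)
        (fun t ht => ((H a).2 t t.zero_le (by omega)).1)
        (fun t ht => ((H a).2 t t.zero_le (by omega)).2) (by omega) hmn
    simpa only [sub_sub_eq_add_sub, add_comm _ a, sub_add_eq_add_sub] using
      exists_sweepShift (n := n) (by omega) hk (y - a)
  · obtain ⟨m, rfl⟩ := (H a).1 z hz
    exact ⟨m, rfl⟩
  · rintro _ ⟨j, hj, rfl⟩
    exact ⟨j, (hP a j hj).symm⟩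

end Locate

/-! ### The algorithm -/

/-- Locate the other agents with the help of a leader; fail if `k` is too small. -/
def Program.locateFromLeader (b id : ℕ) (L : Link) (k : ℕ) (isLeader : Bool) :
    Program (Option (Set ℝ)) := do
  let e ← orient b id L isLeader
  let W ← window e (L.halfGap (!e)) (2 * k) isLeader
  let w ← walk e isLeader k W (16 * k) 0 0 ((lookup W (2 * k) 0).getD 0 : ℕ)
  match w with
  | none => return none
  | some (n, num) => some <$> locate e k W n num

/-- Try to solve location discovery with windows of `2 * k` places. -/
def Program.attempt (b P id : ℕ) (L : Link) (k : ℕ) : Program (Option (Set ℝ)) := do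
  let r ← elect (powerFamily P (16 * k) (b + 1)) b (2 * k) L id
  match r with
  | none => return none
  | some θ => locateFromLeader b id L k (decide (id = θ))

/-- At most `s` attempts, with `k` doubled after every failure. -/
def Program.attempts (b P id : ℕ) (L : Link) : (s k : ℕ) → Program (Set ℝ)
  | 0, _ => return ∅
  | s + 1, k => do
    let r ← attempt b P id L k
    match r with
    | none => attempts b P id L s (2 * k)
    | some K => return K

section Attempts

variable {n b k P : ℕ} {f : Frame n} {p : Fin n → UnitAddCircle} {σ : Fin n → Bool}

/-- The result `r` of an attempt that starts at `p` and ends at `p'` after `T` rounds: either `k` is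
too small and the agents are back, or they have located each other. Here `c` bounds the number of
rounds in excess of the `n / 2` rounds of the final sweep. -/
def IsAttemptResult (σ : Fin n → Bool) (p : Fin n → UnitAddCircle) (k c T : ℕ)
    (p' : Fin n → UnitAddCircle) (r : Fin n → Option (Set ℝ)) : Prop :=
  (r = fun _ => none) ∧ p' = p ∧ 32 * k ^ 2 < n ∧ T ≤ c ∨
    r = (fun i => some (otherDistances σ p i)) ∧ 2 * T ≤ n + 2 * c

lemma isWalking_start (hp : f.At 0 p) (hk : 0 < k) (hkn : 2 * k ≤ n)
    {W : Fin n → ℕ → UnitAddCircle} (hW : ∀ a, ∀ j < 2 * k, W (f.agent a) j = f.relPos σ a j) :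
    IsWalking f σ k W 0 p 0 fun i => ((lookup (W i) (2 * k) 0).getD 0 : ℕ) := by
  refine ⟨hkn, hW, by simpa using hp, fun a => by simp, fun a => ?_⟩
  rw [← f.relPos_self (σ := σ) a, lookup_relPos (by omega) hkn (hW a)]
  split_ifs with h
  · left
    rw [Option.getD_some, Int.toNat_of_nonneg (Int.emod_nonneg _ (by omega))]
    exact (Int.mod_modEq _ _).symm.dvd
  · right
    rintro q' hq'
    rw [Nat.le_zero.1 hq']
    simpa using h

theorem runs_locateFromLeader (hn : 4 < n) (hp : f.At 0 p) {L : Fin n → Link}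
    (hL : AreLinks σ p L) {id : Fin n → ℕ} (hid : Function.Injective id)
    (hb : ∀ i, id i < 2 ^ b) (hk : 0 < k) (hkn : 2 * k + 1 ≤ n) (l : Fin n) :
    ∃ T p' r,
      Runs σ p (fun i => Program.locateFromLeader b (id i) (L i) k (decide (i = l))) T p' r ∧
      IsAttemptResult σ p k (4 * (b + 2) + 86 * k) T p' r := by
  classical
  obtain ⟨φ, hφ⟩ := Frame.exists_isOwn hp σ l
  obtain rfl := hφ.agent_zero
  have orients := runs_orient hn hp hL hid hb (φ.agent 0)
  have agrees_eq (i : Fin n) : (σ (φ.agent 0) == σ i) = (σ i == φ.isCw) := by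
    rw [hφ.isCw_eq, BEq.comm]
  simp only [agrees_eq] at orients
  obtain ⟨W, hW, W_eq⟩ := runs_window (σ := σ) (by omega) hφ.at_zero hL (2 * k) 0
  simp only [zero_add] at W_eq
  obtain ⟨T, hT, w, hw, ⟨rfl, hlt⟩ | ⟨num, rfl, hle, hnum⟩⟩ := runs_walk (by omega)
    (isWalking_start hφ.at_zero hk (by omega) W_eq) (by omega) (16 * k)
  · refine ⟨_, p, _, orients.bind (hW.bind (hw.bind (Runs.pure p fun _ => none))),
      Or.inl ⟨rfl, rfl, by nlinarith, by omega⟩⟩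
  · obtain ⟨p', hK⟩ := runs_locate hφ.at_zero hk hkn W_eq hnum
    have := sweepTime_le hk (n := n) (by nlinarith)
    exact ⟨_, p', _, orients.bind (hW.bind (hw.bind (hK.map fun _ => some))),
      Or.inr ⟨rfl, by omega⟩⟩

variable (hn : 4 < n) (hp : f.At 0 p) {L : Fin n → Link} (hL : AreLinks σ p L) {id : Fin n → ℕ}
  (hid : Function.Injective id) (hb : ∀ i, id i < 2 ^ b) [Fact P.Prime] (hP : P ≤ 2 ^ (b + 1))
  (hlt : ∀ i, id i < P)
include hn hp hL hid hb hP hlt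

theorem runs_attempt (hk : 0 < k) (hkn : 2 * k + 1 ≤ n) :
    ∃ T p' r, Runs σ p (fun i => Program.attempt b P (id i) (L i) k) T p' r ∧
      IsAttemptResult σ p k (136 * (k * (b + 1))) T p' r := by
  have k_le : k ≤ k * (b + 1) := Nat.le_mul_of_pos_right _ (by omega)
  have b_le : b + 1 ≤ k * (b + 1) := Nat.le_mul_of_pos_left _ hk
  obtain ⟨T₁, hT₁, r, elects, eq_id, ne_none⟩ := runs_elect (by omega) hp hL hid hb hP hlt hk hkn
  have T₁_le : T₁ ≤ 42 * (k * (b + 1)) := by nlinarith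
  cases r with
  | none =>
    exact ⟨_, p, _, elects.bind (Runs.pure p fun _ => none),
      Or.inl ⟨rfl, rfl, not_le.1 fun h => ne_none h rfl, by omega⟩⟩
  | some θ =>
    obtain ⟨l, rfl⟩ := eq_id θ rfl
    obtain ⟨T₂, p', r, hr, h⟩ := runs_locateFromLeader hn hp hL hid hb hk hkn l
    simp only [← hid.eq_iff (b := l)] at hr
    exact ⟨_, p', r, elects.bind hr, h.imp (fun h => ⟨h.1, h.2.1, h.2.2.1, by omega⟩)
      fun h => ⟨h.1, by omega⟩⟩

theorem runs_attempts (s : ℕ) (hk : 0 < k) (hkn : 2 * k + 1 ≤ n) (hk2 : k ^ 2 ≤ n)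
    (hs : n ≤ k * 2 ^ s) :
    ∃ T p', Runs σ p (fun i => Program.attempts b P (id i) (L i) s k) T p' (otherDistances σ p) ∧
      ∃ m, m ^ 2 ≤ n ∧ 2 * T + 272 * (k * (b + 1)) ≤ n + 544 * (m * (b + 1)) := by
  induction s generalizing k with
  | zero => omega
  | succ s ih =>
    obtain ⟨T, p', r, hr, ⟨rfl, rfl, lt_n, hT⟩ | ⟨rfl, hT⟩⟩ :=
      runs_attempt hn hp hL hid hb hP hlt hk hkn
    · obtain ⟨T', p'', hr', m, hm, hT'⟩ := ih (k := 2 * k) (by omega) (by nlinarith) (by nlinarith)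
        (by rwa [mul_assoc, mul_left_comm, ← pow_succ'])
      exact ⟨T + T', p'', hr.bind hr', m, hm, by rw [mul_assoc 2 k] at hT'; omega⟩
    · exact ⟨T + 0, p', hr.bind (Runs.pure p' _), k, hk2, by omega⟩

end Attempts

/-- A prime number that is larger than all identifiers in `{1, …, N}`. -/
def primeAbove (N : ℕ) : ℕ := Nat.find (Nat.exists_infinite_primes (N + 1))

lemma prime_primeAbove (N : ℕ) : (primeAbove N).Prime :=
  (Nat.find_spec (Nat.exists_infinite_primes (N + 1))).2

lemma lt_primeAbove (N : ℕ) : N < primeAbove N :=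
  (Nat.find_spec (Nat.exists_infinite_primes (N + 1))).1

lemma primeAbove_le {N : ℕ} (hN : N ≠ 0) : primeAbove N ≤ 2 * N := by
  obtain ⟨q, hq, lt, le⟩ := Nat.exists_prime_lt_and_le_two_mul N hN
  exact (Nat.find_min' _ ⟨lt, hq⟩).trans le

/-- The program of the agent `id` that solves location discovery: learn the distances to the two
neighbors and their senses of direction, then try windows of growing size. -/
def Program.locationDiscovery (N id : ℕ) : Program (Set ℝ) := do
  let L ← link (Nat.log 2 N + 1) id
  attempts (Nat.log 2 N + 1) (primeAbove N) id L N 1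

section LocationDiscovery

variable {N n : ℕ}

lemma Network.card_le (net : Network N n) : n ≤ N := by
  simpa using Finset.card_le_card_of_injOn (s := Finset.univ) (t := Finset.Icc 1 N) net.ident
    (fun i _ => net.ident_mem i) net.ident_injective.injOn

theorem exists_solvesLocationDiscovery (hn : 4 < n) (net : Network N n) :
    ∃ T, (Algorithm.ofProgram Program.locationDiscovery).SolvesLocationDiscovery net T ∧
      ∃ m, m ^ 2 ≤ n ∧ 2 * T ≤ n + 544 * (m * (Nat.log 2 N + 2)) + 8 * (Nat.log 2 N + 3) := by
  obtain ⟨f, hf⟩ := exists_frame (by omega) net.pos_injective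
  have ident_le (i : Fin n) : net.ident i ≤ N := (Finset.mem_Icc.1 (net.ident_mem i)).2
  have card_le := net.card_le
  have lt_two_pow : N < 2 ^ (Nat.log 2 N + 1) := Nat.lt_pow_succ_log_self one_lt_two N
  have ident_lt (i : Fin n) := (ident_le i).trans_lt lt_two_pow
  have : Fact (primeAbove N).Prime := ⟨prime_primeAbove N⟩
  obtain ⟨L, links, hL⟩ := runs_link (σ := net.sense) (by omega) hf (Nat.log 2 N + 1) net.ident
    net.ident_injective ident_lt
  obtain ⟨T, p', locates, m, hm, hT⟩ := runs_attempts hn hf hL net.ident_injective ident_lt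
    ((primeAbove_le (by omega)).trans (by rw [pow_succ _ (_ + 1)]; omega))
    (fun i => (ident_le i).trans_lt (lt_primeAbove N)) N one_pos (by omega) (by omega)
    (by rw [one_mul]; exact card_le.trans Nat.lt_two_pow_self.le)
  replace hT : 2 * T + 272 * (1 * (Nat.log 2 N + 2)) ≤ n + 544 * (m * (Nat.log 2 N + 2)) := hT
  exact ⟨_, solvesLocationDiscovery_ofProgram (links.bind locates), m, hm, by omega⟩

lemma natLog_two_le (N : ℕ) : (Nat.log 2 N : ℝ) ≤ 2 * Real.log N := by
  refine (Real.natLog_le_logb N 2).trans ?_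
  rw [Nat.cast_ofNat, Real.logb, div_le_iff₀ (Real.log_pos one_lt_two)]
  nlinarith [Real.log_two_gt_d9, Real.log_natCast_nonneg N]

lemma rounds_le {T m : ℕ} (hn : 1 ≤ n) (hN : 3 ≤ N) (hm : m ^ 2 ≤ n)
    (hT : 2 * T ≤ n + 544 * (m * (Nat.log 2 N + 2)) + 8 * (Nat.log 2 N + 3)) :
    (T : ℝ) ≤ n / 2 + 1108 * (√n * Real.log N) := by
  have m_le : (m : ℝ) ≤ √n := Real.le_sqrt_of_sq_le (by exact_mod_cast hm)
  have one_le_sqrt : 1 ≤ √(n : ℝ) := Real.one_le_sqrt.2 (by exact_mod_cast hn)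
  have one_le_log : 1 ≤ Real.log N := by
    rw [Real.le_log_iff_exp_le (by positivity)]
    exact Real.exp_one_lt_three.le.trans (by exact_mod_cast hN)
  have log_le := natLog_two_le N
  have attempts_le : (m : ℝ) * (Nat.log 2 N + 2) ≤ √n * (4 * Real.log N) :=
    mul_le_mul m_le (by linarith) (by positivity) (by positivity)
  have link_le : (1 : ℝ) * (Nat.log 2 N + 3) ≤ √n * (5 * Real.log N) :=
    mul_le_mul one_le_sqrt (by linarith) (by positivity) (by positivity)
  have hT' : (2 : ℝ) * T ≤ n + 544 * (m * (Nat.log 2 N + 2)) + 8 * (Nat.log 2 N + 3) := by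
    exact_mod_cast hT
  linarith

end LocationDiscovery

/-- The agents do without their knowledge of the parity of their number. -/
def Algorithm.IgnoresParity (A : Algorithm) : Prop :=
  ∀ N b b' id l, A.move N b id l = A.move N b' id l ∧ A.output N b id l = A.output N b' id l

lemma ignoresParity_ofProgram (P : ℕ → ℕ → Program (Set ℝ)) :
    (Algorithm.ofProgram P).IgnoresParity := fun _ _ _ _ _ => ⟨rfl, rfl⟩

end RingNetwork

end

theorem mainTheorem5_general :
    ∃ (A : RingNetwork.Algorithm) (C : ℝ), A.IgnoresParity ∧
      ∀ (N n : ℕ), 4 < n → ∀ net : RingNetwork.Network N n,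
        ∃ t : ℕ, (t : ℝ) ≤ (n : ℝ) / 2 + C * (Real.sqrt n * Real.log N) ∧
          A.SolvesLocationDiscovery net t := by
  refine ⟨.ofProgram RingNetwork.Program.locationDiscovery, 1108,
    RingNetwork.ignoresParity_ofProgram _, fun N n hn net => ?_⟩
  obtain ⟨T, hT, m, hm, hle⟩ := RingNetwork.exists_solvesLocationDiscovery hn net
  have hN : n ≤ N := net.card_le
  exact ⟨T, RingNetwork.rounds_le (by omega) (by omega) hm hle, hT⟩

theorem mainTheorem5 :
    ∃ (A : RingNetwork.Algorithm) (C : ℝ),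
      ∀ (N n : ℕ), 4 < n → ∀ net : RingNetwork.Network N n,
        ∃ t : ℕ, (t : ℝ) ≤ (n : ℝ) / 2 + C * (Real.sqrt n * Real.log N) ∧
          A.SolvesLocationDiscovery net t := by
  obtain ⟨A, C, -, h⟩ := mainTheorem5_general
  exact ⟨A, C, h⟩
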